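/- Let $k$ be a field, $n\ge 0$, $S=k[x_1,\dots,x_n]$ with the $\mathbb Z^n$-grading $\deg x_i=\varepsilon_i$ (the $i$-th unit vector), and let $E=\bigwedge\langle e_1,\dots,e_n\rangle$ be the exterior algebra over $k$ with $\deg e_i=-\varepsilon_i$. Write $\mathbf 1=(1,\dots,1)$, $\|\mathbf a\|=\sum_i a_i$ and $M(\mathbf a)_{\mathbf b}=M_{\mathbf a+\mathbf b}$. Let ${}^*\mathbf{mod}_S$ and ${}^*\mathbf{mod}_E$ be the abelian categories of finitely generated $\mathbb Z^n$-graded $S$-modules and of finitely generated $\mathbb Z^n$-graded left $E$-modules, with degree-preserving module homomorphisms; let $\mathrm{Com}^b$ denote bounded cochain complexes, and let $D^b$ denote the bounded derived category (realized as the full subcategory of the derived category consisting of the complexes with bounded cohomology), with translation $[1]$. For $M^\bullet=(M^j,\delta^j)\in \mathrm{Com}^b({}^*\mathbf{mod}_S)$ let $\mathcal R(M^\bullet)$ be the complex of finitely generated $\mathbb Z^n$-graded $E$-modules $$\mathcal R^i(M^\bullet)=\bigoplus_{j+\|\mathbf a\|=i}\operatorname{Hom}_k(E(-\mathbf 1),M^j_{\mathbf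 a}),\qquad (cf)(y)=f(yc)\ \ (c,y\in E),$$ with differential sending $f\in \operatorname{Hom}_k(E(-\mathbf 1),M^j_{\mathbf a})$ in cohomological degree $i$ to $\bigl[y\mapsto\sum_{l} x_l f(e_l y)\bigr]+(-1)^i\,\delta^j\circ f$. For $N^\bullet=(N^j,\delta^j)\in \mathrm{Com}^b({}^*\mathbf{mod}_E)$ let $\mathcal L(N^\bullet)$ be the bounded complex of finitely generated $\mathbb Z^n$-graded $S$-modules $$\mathcal L^i(N^\bullet)=\bigoplus_{j-\|\mathbf a\|=i}S(-\mathbf 1)\otimes_k N^j_{\mathbf a},$$ with differential sending $s\otimes y\in S(-\mathbf 1)\otimes_k N^j_{\mathbf a}$ in cohomological degree $i$ to $\sum_l x_l s\otimes e_l y+(-1)^i s\otimes\delta^j(y)$. **Theorem ($\mathbb Z^n$-graded Bernstein–Gel'fand–Gel'fand correspondence).** The functors $\mathcal R$ and $\mathcal L$ induce (compatibly with the canonical functors from bounded complexes to derived categories, up to natural isomorphism) triangulated functors $$\mathcal R: D^b({}^*\mathbf{mod}_S)\to D^b({}^*\mathbf{mod}_E),\qquad \mathcal L: D^b({}^*\mathbf{mod}_E)\to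 D^b({}^*\mathbf{mod}_S);$$ in particular $\mathcal R(M^\bullet)$ has bounded cohomology for every bounded $M^\bullet$. Both are equivalences of triangulated categories, and they are quasi-inverse to each other up to translation by $n$: there are natural isomorphisms $\mathcal L\circ\mathcal R\cong[-n]$ and $\mathcal R\circ\mathcal L\cong[-n]$. -/

import Mathlib

open CategoryTheory CategoryTheory.Limits
open scoped TensorProduct DirectSum

universe u v w

noncomputable section

namespace ZnBGG

/-! ### Internal gradings on modules -/

section Gradings

variable {k : Type*} [Field k] {ι : Type*}

/-- The homogeneous components of a direct sum of graded modules. -/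
def sumGr {σ : Type*} {X : σ → Type*} [∀ s, AddCommGroup (X s)] [∀ s, Module k (X s)]
    (𝒳 : ∀ s, ι → Submodule k (X s)) (a : ι) : Submodule k (⨁ s, X s) where
  carrier := {F | ∀ s, F s ∈ 𝒳 s a}
  zero_mem' s := (𝒳 s a).zero_mem
  add_mem' hF hG s := (𝒳 s a).add_mem (hF s) (hG s)
  smul_mem' c _ hF s := (𝒳 s a).smul_mem c (hF s)

theorem lof_mem_sumGr {σ : Type*} [DecidableEq σ] {R : Type*} [Semiring R] {X : σ → Type*}
    [∀ s, AddCommGroup (X s)] [∀ s, Module k (X s)] [∀ s, Module R (X s)]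
    (𝒳 : ∀ s, ι → Submodule k (X s)) (a : ι) (s : σ)
    {x : X s} (hx : x ∈ 𝒳 s a) : DirectSum.lof R σ X s x ∈ sumGr 𝒳 a := by
  intro t
  by_cases h : s = t
  · subst h; simpa [DirectSum.lof_eq_of, DirectSum.of_eq_same] using hx
  · rw [DirectSum.lof_eq_of, DirectSum.of_eq_of_ne _ _ _ (Ne.symm h)]
    exact zero_mem _

variable [DecidableEq ι]

/-- The projection of a module with an internal grading onto its component of degree `a`. -/
def proj {M : Type*} [AddCommGroup M] [Module k M] {ℳ : ι → Submodule k M}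
    (h : DirectSum.IsInternal ℳ) (a : ι) : M →ₗ[k] M :=
  letI := h.chooseDecomposition
  (ℳ a).subtype ∘ₗ DirectSum.component k ι (fun b => ℳ b) a ∘ₗ
    (DirectSum.decomposeLinearEquiv ℳ).toLinearMap

variable {M : Type*} [AddCommGroup M] [Module k M] {ℳ : ι → Submodule k M}

theorem proj_mem (h : DirectSum.IsInternal ℳ) (a : ι) (m : M) : proj h a m ∈ ℳ a := by
  simp [proj]

theorem proj_of_mem (h : DirectSum.IsInternal ℳ) {a : ι} {m : M} (hm : m ∈ ℳ a) :
    proj h a m = m := by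
  let := h.chooseDecomposition
  exact DirectSum.decompose_of_mem_same ℳ hm

theorem proj_of_mem_ne (h : DirectSum.IsInternal ℳ) {a b : ι} {m : M} (hm : m ∈ ℳ b)
    (hab : b ≠ a) : proj h a m = 0 := by
  let := h.chooseDecomposition
  exact DirectSum.decompose_of_mem_ne ℳ hm hab

theorem isInternal_of_proj (π : ι → M →ₗ[k] M) (h₁ : ∀ a, ∀ m ∈ ℳ a, π a m = m)
    (h₂ : ∀ a b, ∀ m ∈ ℳ b, b ≠ a → π a m = 0) (h₃ : ∀ m, m ∈ ⨆ a, ℳ a) :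
    DirectSum.IsInternal ℳ := by
  refine DirectSum.isInternal_submodule_of_iSupIndep_of_iSup_eq_top (fun a => ?_)
    (Submodule.eq_top_iff'.2 h₃)
  rw [Submodule.disjoint_def]
  intro x hx hx'
  rw [← h₁ a x hx]
  have : (⨆ (b) (_ : b ≠ a), ℳ b) ≤ LinearMap.ker (π a) :=
    iSup₂_le fun b hb m hm => h₂ a b m hm hb
  exact this hx'

theorem mem_iSup_of_isInternal (h : DirectSum.IsInternal ℳ) (m : M) : m ∈ ⨆ a, ℳ a := by
  rw [h.submodule_iSup_eq_top]; trivial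

theorem map_proj {N : Type*} [AddCommGroup N] [Module k N] {𝒩 : ι → Submodule k N}
    (hM : DirectSum.IsInternal ℳ) (hN : DirectSum.IsInternal 𝒩) (f : M →ₗ[k] N)
    (hf : ∀ a, ∀ m ∈ ℳ a, f m ∈ 𝒩 a) (a : ι) (m : M) :
    f (proj hM a m) = proj hN a (f m) := by
  have hm := mem_iSup_of_isInternal hM m
  induction hm using Submodule.iSup_induction' with
  | mem b x hx =>
    by_cases hb : b = a
    · subst hb
      rw [proj_of_mem hM hx, proj_of_mem hN (hf _ _ hx)]
    · rw [proj_of_mem_ne hM hx hb, proj_of_mem_ne hN (hf _ _ hx) hb, map_zero]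
  | zero => simp
  | add x y _ _ hx hy => simp [hx, hy]

theorem mem_of_proj (h : DirectSum.IsInternal ℳ) {a : ι} {m : M}
    (hm : ∀ b, b ≠ a → proj h b m = 0) : m ∈ ℳ a := by
  classical
  let := h.chooseDecomposition
  rw [← DirectSum.sum_support_decompose ℳ m]
  refine Submodule.sum_mem _ fun b _ => ?_
  by_cases hb : b = a
  · subst hb; exact SetLike.coe_mem _
  · have : ((DirectSum.decompose ℳ m b : ℳ b) : M) = 0 := hm b hb
    rw [this]; exact zero_mem _

theorem sumGr_isInternal {σ : Type*} {X : σ → Type*} [∀ s, AddCommGroup (X s)]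
    [∀ s, Module k (X s)] (𝒳 : ∀ s, ι → Submodule k (X s))
    (h : ∀ s, DirectSum.IsInternal (𝒳 s)) : DirectSum.IsInternal (sumGr 𝒳) := by
  classical
  refine isInternal_of_proj (fun a => DirectSum.lmap fun s => proj (h s) a) ?_ ?_ ?_
  · intro a m hm
    refine DFinsupp.ext fun s => ?_
    exact proj_of_mem (h s) (hm s)
  · intro a b m hm hb
    refine DFinsupp.ext fun s => ?_
    exact proj_of_mem_ne (h s) (hm s) hb
  · intro m
    induction m using DirectSum.induction_on with
    | zero => exact zero_mem _
    | add x y hx hy => exact add_mem hx hy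
    | of s x =>
      have : (⨆ a, 𝒳 s a) ≤ (⨆ a, sumGr 𝒳 a).comap (DirectSum.lof k σ X s) :=
        iSup_le fun a y hy => Submodule.mem_iSup_of_mem a (lof_mem_sumGr 𝒳 a s hy)
      exact this (mem_iSup_of_isInternal (h s) x)

theorem finite_directSum {R : Type*} [Ring R] [IsNoetherianRing R] {σ : Type*} (X : σ → Type*)
    [∀ s, AddCommGroup (X s)] [∀ s, Module R (X s)] [∀ s, Module.Finite R (X s)]
    (h : {s | ¬ Subsingleton (X s)}.Finite) : Module.Finite R (⨁ s, X s) := by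
  classical
  have : Finite {s | ¬ Subsingleton (X s)} := h
  let f : (⨁ s, X s) →ₗ[R] (∀ s : {s | ¬ Subsingleton (X s)}, X s) :=
    LinearMap.pi fun s => DirectSum.component R σ X s
  refine Module.Finite.of_injective f fun F G hFG => DFinsupp.ext fun s => ?_
  by_cases hs : Subsingleton (X s)
  · exact Subsingleton.elim _ _
  · exact congrFun hFG ⟨s, hs⟩

end Gradings

/-! ### The category of finitely generated graded modules over a graded algebra -/

section GrMod

variable {k : Type u} [Field k] {A : Type u} [Ring A] [Algebra k A] {ι : Type v} [AddCommGroup ι]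
  [DecidableEq ι]

/-- A finitely generated graded left module over the `k`-algebra `A` with homogeneous components
`𝒜 a`, `a ∈ ι`. -/
structure GrMod (𝒜 : ι → Submodule k A) where
  carrier : Type u
  [addCommGroup : AddCommGroup carrier]
  [modk : Module k carrier]
  [modA : Module A carrier]
  [tower : IsScalarTower k A carrier]
  /-- The homogeneous components. -/
  gr : ι → Submodule k carrier
  isInternal : DirectSum.IsInternal gr
  smul_mem : ∀ {a b : ι} {r : A} {m : carrier}, r ∈ 𝒜 a → m ∈ gr b → r • m ∈ gr (a + b)
  finite : Module.Finite A carrier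

attribute [instance] GrMod.addCommGroup GrMod.modk GrMod.modA GrMod.tower GrMod.finite

namespace GrMod

variable {𝒜 : ι → Submodule k A}

instance : CoeSort (GrMod 𝒜) (Type u) := ⟨GrMod.carrier⟩

/-- The degree preserving `A`-linear maps. -/
def homs (M N : GrMod 𝒜) : AddSubgroup (M →ₗ[A] N) where
  carrier := {f | ∀ a, ∀ m ∈ M.gr a, f m ∈ N.gr a}
  zero_mem' a _ _ := (N.gr a).zero_mem
  add_mem' hf hg a m hm := (N.gr a).add_mem (hf a m hm) (hg a m hm)
  neg_mem' hf a m hm := (N.gr a).neg_mem (hf a m hm)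

/-- Morphisms are the degree preserving `A`-linear maps. -/
@[ext]
structure Hom (M N : GrMod 𝒜) where
  lin : M →ₗ[A] N
  map_mem : ∀ a, ∀ m ∈ M.gr a, lin m ∈ N.gr a

instance : Category (GrMod 𝒜) where
  Hom M N := Hom M N
  id M := ⟨LinearMap.id, fun _ _ h => h⟩
  comp f g := ⟨g.lin ∘ₗ f.lin, fun a m hm => g.map_mem a _ (f.map_mem a m hm)⟩

@[ext]
theorem hom_ext {M N : GrMod 𝒜} {f g : M ⟶ N} (h : ∀ m, f.lin m = g.lin m) : f = g :=
  Hom.ext (LinearMap.ext h)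

@[simp] theorem id_lin (M : GrMod 𝒜) : Hom.lin (𝟙 M) = LinearMap.id := rfl
@[simp] theorem comp_lin {M N P : GrMod 𝒜} (f : M ⟶ N) (g : N ⟶ P) :
    (f ≫ g).lin = g.lin ∘ₗ f.lin := rfl

/-- Morphisms form a subgroup of the group of linear maps. -/
def homEquiv (M N : GrMod 𝒜) : (M ⟶ N) ≃ homs M N where
  toFun f := ⟨f.lin, f.map_mem⟩
  invFun f := ⟨f.1, f.2⟩
  left_inv _ := rfl
  right_inv _ := rfl

instance (M N : GrMod 𝒜) : AddCommGroup (M ⟶ N) := (homEquiv M N).addCommGroup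

@[simp] theorem zero_lin (M N : GrMod 𝒜) : Hom.lin (0 : M ⟶ N) = 0 := rfl
@[simp] theorem add_lin {M N : GrMod 𝒜} (f g : M ⟶ N) : (f + g).lin = f.lin + g.lin := rfl

instance : Preadditive (GrMod 𝒜) where
  add_comp _ _ _ f f' g := by ext; simp
  comp_add _ _ _ f g g' := by ext; simp

/-- The zero module. -/
def zero : GrMod 𝒜 where
  carrier := PUnit
  gr _ := ⊤
  isInternal := isInternal_of_proj (fun _ => 0) (fun _ _ _ => rfl) (fun _ _ _ _ _ => rfl)
    (fun m => by rw [Subsingleton.elim m 0]; exact zero_mem _)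
  smul_mem _ _ := trivial
  finite := inferInstance

theorem isZero_of_subsingleton (M : GrMod 𝒜) [Subsingleton M] : IsZero M :=
  (IsZero.iff_id_eq_zero M).2 (hom_ext fun _ => Subsingleton.elim _ _)

theorem subsingleton_of_isZero {M : GrMod 𝒜} (h : IsZero M) : Subsingleton M := by
  refine ⟨fun x y => ?_⟩
  have := (IsZero.iff_id_eq_zero M).1 h
  have hx : ∀ z : M, z = 0 := fun z => congrArg (fun f : M ⟶ M => f.lin z) this
  rw [hx x, hx y]

instance : HasZeroObject (GrMod 𝒜) :=
  ⟨⟨zero, haveI : Subsingleton (zero : GrMod 𝒜) := inferInstanceAs (Subsingleton PUnit)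
    isZero_of_subsingleton _⟩⟩

/-- The direct sum of two graded modules. -/
def prod (M N : GrMod 𝒜) : GrMod 𝒜 where
  carrier := M × N
  gr a := (M.gr a).prod (N.gr a)
  isInternal := isInternal_of_proj (fun a => (proj M.isInternal a).prodMap (proj N.isInternal a))
    (fun a m hm => Prod.ext (proj_of_mem _ hm.1) (proj_of_mem _ hm.2))
    (fun a b m hm h => Prod.ext (proj_of_mem_ne _ hm.1 h) (proj_of_mem_ne _ hm.2 h))
    (fun m => by
      have h₁ : (⨆ a, M.gr a) ≤ (⨆ a, (M.gr a).prod (N.gr a)).comap (LinearMap.inl k M N) :=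
        iSup_le fun a x hx => Submodule.mem_iSup_of_mem a ⟨hx, zero_mem _⟩
      have h₂ : (⨆ a, N.gr a) ≤ (⨆ a, (M.gr a).prod (N.gr a)).comap (LinearMap.inr k M N) :=
        iSup_le fun a x hx => Submodule.mem_iSup_of_mem a ⟨zero_mem _, hx⟩
      have h₃ := h₁ (mem_iSup_of_isInternal M.isInternal m.1)
      have h₄ := h₂ (mem_iSup_of_isInternal N.isInternal m.2)
      have : m = LinearMap.inl k M N m.1 + LinearMap.inr k M N m.2 := by ext <;> simp
      rw [this]
      exact add_mem h₃ h₄)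
  smul_mem hr hm := ⟨M.smul_mem hr hm.1, N.smul_mem hr hm.2⟩
  finite := inferInstance

instance : HasBinaryBiproducts (GrMod 𝒜) where
  has_binary_biproduct M N := hasBinaryBiproduct_of_total
    { pt := prod M N
      fst := ⟨LinearMap.fst A M N, fun _ _ h => h.1⟩
      snd := ⟨LinearMap.snd A M N, fun _ _ h => h.2⟩
      inl := ⟨LinearMap.inl A M N, fun _ _ h => ⟨h, zero_mem _⟩⟩
      inr := ⟨LinearMap.inr A M N, fun _ _ h => ⟨zero_mem _, h⟩⟩
      inl_fst := rfl
      inl_snd := rfl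
      inr_fst := rfl
      inr_snd := rfl }
    (hom_ext fun m => by
      exact Prod.ext (add_zero _) (zero_add _))

instance : HasFiniteProducts (GrMod 𝒜) := hasFiniteProducts_of_has_binary_and_terminal

/-- The cokernel of a morphism. -/
def coker {M N : GrMod 𝒜} (f : M ⟶ N) : GrMod 𝒜 where
  carrier := N ⧸ LinearMap.range f.lin
  gr a := (N.gr a).map ((LinearMap.range f.lin).mkQ.restrictScalars k)
  isInternal := by
    let q := (LinearMap.range f.lin).mkQ.restrictScalars k
    have hq : ∀ a x, q x = 0 → q (proj N.isInternal a x) = 0 := by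
      intro a x hx
      obtain ⟨y, rfl⟩ : x ∈ LinearMap.range f.lin := (Submodule.Quotient.mk_eq_zero _).1 hx
      have := map_proj M.isInternal N.isInternal (f.lin.restrictScalars k) f.map_mem a y
      refine (Submodule.Quotient.mk_eq_zero _).2 ⟨_, this⟩
    let π : ι → (N ⧸ LinearMap.range f.lin) →ₗ[k] (N ⧸ LinearMap.range f.lin) := fun a =>
      ((LinearMap.range f.lin).restrictScalars k).liftQ (q ∘ₗ proj N.isInternal a) (by
        intro x hx
        exact hq a x ((Submodule.Quotient.mk_eq_zero _).2 hx))
    have hπ : ∀ a x, π a (q x) = q (proj N.isInternal a x) := fun a x => rfl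
    refine isInternal_of_proj π ?_ ?_ ?_
    · rintro a _ ⟨x, hx, rfl⟩
      exact (hπ a x).trans (by rw [proj_of_mem _ hx])
    · rintro a b _ ⟨x, hx, rfl⟩ hb
      exact (hπ a x).trans (by rw [proj_of_mem_ne _ hx hb, map_zero])
    · intro m
      obtain ⟨x, rfl⟩ := Submodule.mkQ_surjective _ m
      rw [← Submodule.map_iSup]
      exact ⟨x, mem_iSup_of_isInternal N.isInternal x, rfl⟩
  smul_mem := by
    rintro a b r _ hr ⟨x, hx, rfl⟩
    exact ⟨r • x, N.smul_mem hr hx, rfl⟩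
  finite := inferInstance

/-- The projection to the cokernel. -/
def cokerπ {M N : GrMod 𝒜} (f : M ⟶ N) : N ⟶ coker f :=
  ⟨(LinearMap.range f.lin).mkQ, fun _ x hx => ⟨x, hx, rfl⟩⟩

theorem comp_cokerπ {M N : GrMod 𝒜} (f : M ⟶ N) : f ≫ cokerπ f = 0 :=
  hom_ext fun m => (Submodule.Quotient.mk_eq_zero _).2 ⟨m, rfl⟩

theorem lin_apply_of_comp_eq_zero {M N P : GrMod 𝒜} {f : M ⟶ N} {g : N ⟶ P} (h : f ≫ g = 0)
    (m : M) : g.lin (f.lin m) = 0 :=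
  congrArg (fun t : M ⟶ P => t.lin m) h

/-- The universal property of the cokernel. -/
def cokerIsColimit {M N : GrMod 𝒜} (f : M ⟶ N) :
    IsColimit (CokernelCofork.ofπ (cokerπ f) (comp_cokerπ f)) :=
  CokernelCofork.IsColimit.ofπ _ _
    (fun g hg => ⟨(LinearMap.range f.lin).liftQ g.lin (by
        rintro _ ⟨m, rfl⟩; exact lin_apply_of_comp_eq_zero hg m), by
      rintro a _ ⟨x, hx, rfl⟩; exact g.map_mem a x hx⟩)
    (fun _ _ => rfl)
    (fun _ _ _ hm => hom_ext fun x => by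
      obtain ⟨x, rfl⟩ := Submodule.mkQ_surjective _ x
      exact congrArg (fun t : N ⟶ _ => t.lin x) hm)

instance : HasCokernels (GrMod 𝒜) := ⟨fun f => ⟨⟨⟨_, cokerIsColimit f⟩⟩⟩⟩

theorem surjective_of_epi {M N : GrMod 𝒜} (f : M ⟶ N) [Epi f] : Function.Surjective f.lin := by
  intro y
  have h : cokerπ f = 0 := by rw [← cancel_epi f, comp_cokerπ, comp_zero]
  exact (Submodule.Quotient.mk_eq_zero _).1 (congrArg (fun t : N ⟶ coker f => t.lin y) h)

variable [IsNoetherianRing A]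

/-- The kernel of a morphism. -/
def ker {M N : GrMod 𝒜} (f : M ⟶ N) : GrMod 𝒜 where
  carrier := LinearMap.ker f.lin
  gr a := (M.gr a).comap ((LinearMap.ker f.lin).subtype.restrictScalars k)
  isInternal := by
    let K := (LinearMap.ker f.lin).restrictScalars k
    have hK : ∀ a, ∀ x ∈ K, proj M.isInternal a x ∈ K := by
      intro a x hx
      have := map_proj M.isInternal N.isInternal (f.lin.restrictScalars k) f.map_mem a x
      exact this.trans (by
        have : f.lin x = 0 := hx
        simp [this])
    let π : ι → (LinearMap.ker f.lin) →ₗ[k] (LinearMap.ker f.lin) := fun a =>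
      (proj M.isInternal a).restrict (p := K) (q := K) (hK a)
    refine isInternal_of_proj π ?_ ?_ ?_
    · intro a m hm
      exact Subtype.ext (proj_of_mem M.isInternal hm)
    · intro a b m hm hb
      exact Subtype.ext (proj_of_mem_ne M.isInternal hm hb)
    · intro m
      classical
      let := M.isInternal.chooseDecomposition
      have hm : m = ∑ a ∈ (DirectSum.decompose M.gr (m : M)).support, π a m := by
        refine Subtype.ext ?_
        rw [AddSubmonoidClass.coe_finsetSum]
        exact (DirectSum.sum_support_decompose M.gr (m : M)).symm
      rw [hm]
      exact Submodule.sum_mem _ fun a _ => Submodule.mem_iSup_of_mem a (proj_mem M.isInternal a m)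
  smul_mem hr hm := M.smul_mem hr hm
  finite := inferInstance

/-- The inclusion of the kernel. -/
def kerι {M N : GrMod 𝒜} (f : M ⟶ N) : ker f ⟶ M :=
  ⟨(LinearMap.ker f.lin).subtype, fun _ _ hx => hx⟩

theorem kerι_comp {M N : GrMod 𝒜} (f : M ⟶ N) : kerι f ≫ f = 0 :=
  hom_ext fun m => m.2

/-- The universal property of the kernel. -/
def kerIsLimit {M N : GrMod 𝒜} (f : M ⟶ N) :
    IsLimit (KernelFork.ofι (kerι f) (kerι_comp f)) :=
  KernelFork.IsLimit.ofι _ _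
    (fun g hg => ⟨g.lin.codRestrict _ (lin_apply_of_comp_eq_zero hg), fun a m hm =>
      g.map_mem a m hm⟩)
    (fun _ _ => rfl)
    (fun _ _ _ hm => hom_ext fun x => Subtype.ext <|
      congrArg (fun t : _ ⟶ M => t.lin x) hm)

instance : HasKernels (GrMod 𝒜) := ⟨fun f => ⟨⟨⟨_, kerIsLimit f⟩⟩⟩⟩

theorem injective_of_mono {M N : GrMod 𝒜} (f : M ⟶ N) [Mono f] : Function.Injective f.lin := by
  rw [← LinearMap.ker_eq_bot, Submodule.eq_bot_iff]
  intro x hx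
  have h : kerι f = 0 := by rw [← cancel_mono f, kerι_comp, zero_comp]
  exact congrArg (fun t : ker f ⟶ M => t.lin ⟨x, hx⟩) h

/-- Every monomorphism is the kernel of its cokernel. -/
@[reducible]
def normalMono {M N : GrMod 𝒜} (f : M ⟶ N) [Mono f] : NormalMono f where
  Z := coker f
  g := cokerπ f
  w := comp_cokerπ f
  isLimit := KernelFork.IsLimit.ofι' _ _ fun {P} g hg => by
    let e := LinearEquiv.ofInjective f.lin (injective_of_mono f)
    have hg' : ∀ x, g.lin x ∈ LinearMap.range f.lin := fun x =>
      (Submodule.Quotient.mk_eq_zero _).1 (lin_apply_of_comp_eq_zero hg x)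
    have he : ∀ x, f.lin (e.symm ⟨g.lin x, hg' x⟩) = g.lin x := fun x =>
      congrArg Subtype.val (e.apply_symm_apply ⟨g.lin x, hg' x⟩)
    refine ⟨⟨e.symm.toLinearMap ∘ₗ g.lin.codRestrict _ hg', fun a m hm => ?_⟩,
      hom_ext fun x => he x⟩
    refine mem_of_proj M.isInternal fun b hb => injective_of_mono f ?_
    have := map_proj M.isInternal N.isInternal (f.lin.restrictScalars k) f.map_mem b
      (e.symm ⟨g.lin m, hg' m⟩)
    refine this.trans ?_
    rw [map_zero]
    refine (congrArg _ (he m)).trans ?_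
    exact proj_of_mem_ne _ (g.map_mem a m hm) hb.symm

/-- Every epimorphism is the cokernel of its kernel. -/
@[reducible]
def normalEpi {M N : GrMod 𝒜} (f : M ⟶ N) [Epi f] : NormalEpi f where
  W := ker f
  g := kerι f
  w := kerι_comp f
  isColimit := CokernelCofork.IsColimit.ofπ' _ _ fun {P} g hg => by
    let e := f.lin.quotKerEquivOfSurjective (surjective_of_epi f)
    let l : N →ₗ[A] P := (LinearMap.ker f.lin).liftQ g.lin
      (fun x hx => lin_apply_of_comp_eq_zero hg ⟨x, hx⟩) ∘ₗ e.symm.toLinearMap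
    have hl : ∀ x, l (f.lin x) = g.lin x := by
      intro x
      have : e.symm (f.lin x) = Submodule.Quotient.mk x := by
        rw [LinearEquiv.symm_apply_eq]; rfl
      refine (congrArg ((LinearMap.ker f.lin).liftQ g.lin
        (fun x hx => lin_apply_of_comp_eq_zero hg ⟨x, hx⟩)) this).trans ?_
      rfl
    refine ⟨⟨l, fun a y hy => ?_⟩, hom_ext hl⟩
    obtain ⟨x, rfl⟩ := surjective_of_epi f y
    have := map_proj M.isInternal N.isInternal (f.lin.restrictScalars k) f.map_mem a x
    have h2 : f.lin x = f.lin (proj M.isInternal a x) :=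
      (this.trans (proj_of_mem _ hy)).symm
    rw [h2, hl]
    exact g.map_mem a _ (proj_mem _ _ _)

instance : Abelian (GrMod 𝒜) where
  normalMonoOfMono f _ := ⟨normalMono f⟩
  normalEpiOfEpi f _ := ⟨normalEpi f⟩

end GrMod

end GrMod

/-! ### The polynomial ring and the exterior algebra -/

section Algebras

variable (k : Type u) [Field k] (n : ℕ)

/-- The polynomial ring in `n` variables. -/
def Sym : Type u := MvPolynomial (Fin n) k

instance : CommRing (Sym k n) := inferInstanceAs (CommRing (MvPolynomial (Fin n) k))
instance : Algebra k (Sym k n) := inferInstanceAs (Algebra k (MvPolynomial (Fin n) k))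
instance : IsNoetherianRing (Sym k n) :=
  inferInstanceAs (IsNoetherianRing (MvPolynomial (Fin n) k))

/-- The exterior algebra in `n` variables. -/
def Ext : Type u := ExteriorAlgebra k (Fin n → k)

instance : Ring (Ext k n) := inferInstanceAs (Ring (ExteriorAlgebra k (Fin n → k)))
instance : Algebra k (Ext k n) := inferInstanceAs (Algebra k (ExteriorAlgebra k (Fin n → k)))

variable {n}

/-- The `i`-th standard basis vector of `ℤ^n`. -/
def ε (i : Fin n) : Fin n → ℤ := Pi.single i 1

/-- The vector `(1, …, 1)`. -/
def one : Fin n → ℤ := fun _ => 1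

/-- The sum of the coordinates. -/
def deg (a : Fin n → ℤ) : ℤ := ∑ i, a i

theorem deg_add (a b : Fin n → ℤ) : deg (a + b) = deg a + deg b := Finset.sum_add_distrib

theorem deg_ε (i : Fin n) : deg (ε i) = 1 := by simp [deg, ε]

theorem deg_add_ε (a : Fin n → ℤ) (i : Fin n) : deg (a + ε i) = deg a + 1 := by
  rw [deg_add, deg_ε]

theorem deg_sub_ε (a : Fin n → ℤ) (i : Fin n) : deg (a - ε i) = deg a - 1 := by
  have := deg_add_ε (a - ε i) i
  rw [sub_add_cancel] at this
  lia

/-- The variable `x_i`. -/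
def x (i : Fin n) : Sym k n := (MvPolynomial.X i : MvPolynomial (Fin n) k)

/-- The generator `e_i` of the exterior algebra. -/
def e (i : Fin n) : Ext k n :=
  (ExteriorAlgebra.ι k (Pi.single i 1) : ExteriorAlgebra k (Fin n → k))

/-- The monomial `x^s`. -/
def mono (s : Fin n →₀ ℕ) : Sym k n := MvPolynomial.monomial s (1 : k)

variable (n) in
/-- The `ℤ^n`-grading of the polynomial ring with `deg x_i = ε_i`. -/
def symGr : (Fin n → ℤ) → Submodule k (Sym k n) := MvPolynomial.weightedHomogeneousSubmodule k ε

variable (n) in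
/-- The `ℤ^n`-grading of the exterior algebra with `deg e_i = -ε_i`: the component of degree `a` is
spanned by the products of generators whose degrees add up to `a`. -/
def extGr (a : Fin n → ℤ) : Submodule k (Ext k n) :=
  Submodule.span k {y | ∃ l : List (Fin n), (l.map fun i => -ε i).sum = a ∧ (l.map (e k)).prod = y}

theorem x_mem (i : Fin n) : x k i ∈ symGr k n (ε i) :=
  MvPolynomial.isWeightedHomogeneous_X k ε i

theorem e_mem (i : Fin n) : e k i ∈ extGr k n (-ε i) :=
  Submodule.subset_span ⟨[i], by simp, by simp⟩

theorem e_mul_self (i : Fin n) : e k i * e k i = 0 := ExteriorAlgebra.ι_sq_zero _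

theorem e_mul_add_swap (i j : Fin n) : e k i * e k j + e k j * e k i = 0 :=
  ExteriorAlgebra.ι_add_mul_swap _ _

theorem symGr_isInternal : DirectSum.IsInternal (symGr k n) :=
  letI := MvPolynomial.weightedDecomposition k (ε (n := n))
  DirectSum.Decomposition.isInternal (MvPolynomial.weightedHomogeneousSubmodule k ε)

instance : SetLike.GradedMonoid (symGr k n) :=
  MvPolynomial.WeightedHomogeneousSubmodule.gradedMonoid (R := k) (w := ε (n := n))

instance : SetLike.GradedMonoid (extGr k n) where
  one_mem := Submodule.subset_span ⟨[], by simp, by simp⟩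
  mul_mem := by
    intro a b y z hy hz
    have : extGr k n a * extGr k n b ≤ extGr k n (a + b) := by
      rw [extGr, extGr, Submodule.span_mul_span]
      refine Submodule.span_mono ?_
      rintro _ ⟨_, ⟨l, rfl, rfl⟩, _, ⟨l', rfl, rfl⟩, rfl⟩
      exact ⟨l ++ l', by simp, by simp⟩
    exact this (Submodule.mul_mem_mul hy hz)

/-- The generator `e_i` in the direct sum of the components of the exterior algebra. -/
def eSum (i : Fin n) : ⨁ a, extGr k n a :=
  DirectSum.of (fun a => extGr k n a) (-ε i) ⟨e k i, e_mem k i⟩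

theorem of_congr {a b : Fin n → ℤ} (h : a = b) {y z : Ext k n} (hyz : y = z)
    (hy : y ∈ extGr k n a) (hz : z ∈ extGr k n b) :
    DirectSum.of (fun a => extGr k n a) a ⟨y, hy⟩ =
      DirectSum.of (fun a => extGr k n a) b ⟨z, hz⟩ := by
  subst h hyz; rfl

theorem eSum_mul (i j : Fin n) : eSum k i * eSum k j =
    DirectSum.of (fun a => extGr k n a) (-ε i + -ε j)
      ⟨e k i * e k j, SetLike.mul_mem_graded (e_mem k i) (e_mem k j)⟩ :=
  DirectSum.of_mul_of _ _

theorem eSum_mul_self (i : Fin n) : eSum k i * eSum k i = 0 := by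
  rw [eSum_mul]
  have h0 : (⟨e k i * e k i, SetLike.mul_mem_graded (e_mem k i) (e_mem k i)⟩ :
      extGr k n (-ε i + -ε i)) = 0 := Subtype.ext (e_mul_self k i)
  rw [h0, map_zero]

theorem eSum_mul_add_swap (i j : Fin n) : eSum k i * eSum k j + eSum k j * eSum k i = 0 := by
  rw [eSum_mul, eSum_mul]
  have hm : e k j * e k i ∈ extGr k n (-ε i + -ε j) := by
    rw [add_comm]; exact SetLike.mul_mem_graded (e_mem k j) (e_mem k i)
  have : DirectSum.of (fun a => extGr k n a) (-ε j + -ε i)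
      ⟨e k j * e k i, SetLike.mul_mem_graded (e_mem k j) (e_mem k i)⟩ =
      DirectSum.of (fun a => extGr k n a) (-ε i + -ε j) ⟨e k j * e k i, hm⟩ :=
    of_congr k (add_comm _ _) rfl _ _
  rw [this, ← map_add, AddMemClass.mk_add_mk]
  have h0 : (⟨e k i * e k j + e k j * e k i, add_mem
      (SetLike.mul_mem_graded (e_mem k i) (e_mem k j)) hm⟩ : extGr k n (-ε i + -ε j)) = 0 :=
    Subtype.ext (e_mul_add_swap k i j)
  rw [h0, map_zero]

/-- The map from the exterior algebra to the direct sum of its components, on generators. -/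
def extToSumι : (Fin n → k) →ₗ[k] ⨁ a, extGr k n a := Fintype.linearCombination k (eSum k)

theorem sum_sum_eq_zero {B σ : Type*} [AddCommGroup B] [Fintype σ] (F : σ → σ → B)
    (h : ∀ i j, F i j + F j i = 0) (h' : ∀ i, F i i = 0) : ∑ i, ∑ j, F i j = 0 := by
  classical
  rw [← Fintype.sum_prod_type' (f := F)]
  refine Finset.sum_involution (fun p _ => p.swap) (fun p _ => h p.1 p.2) ?_ ?_ ?_
  · rintro ⟨i, j⟩ _ hp heq
    obtain rfl : j = i := congrArg Prod.fst heq
    exact hp (h' j)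
  · intros; exact Finset.mem_univ _
  · intros; rfl

theorem extToSumι_sq (v : Fin n → k) : extToSumι k v * extToSumι k v = 0 := by
  rw [extToSumι, Fintype.linearCombination_apply, Finset.sum_mul_sum]
  refine sum_sum_eq_zero (fun i j => v i • eSum k i * v j • eSum k j) (fun i j => ?_) (fun i => ?_)
  · rw [smul_mul_smul_comm, smul_mul_smul_comm, mul_comm (v j), ← smul_add, eSum_mul_add_swap,
      smul_zero]
  · rw [smul_mul_smul_comm, eSum_mul_self, smul_zero]

/-- The map from the exterior algebra to the direct sum of its components. -/
def extToSum : Ext k n →ₐ[k] ⨁ a, extGr k n a := ExteriorAlgebra.lift k ⟨extToSumι k, extToSumι_sq k⟩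

theorem extToSum_e (i : Fin n) :
    extToSum k (e k i) = DirectSum.of (fun a => extGr k n a) (-ε i) ⟨e k i, e_mem k i⟩ := by
  refine (ExteriorAlgebra.lift_ι_apply k (extToSumι k) (extToSumι_sq k) (Pi.single i 1)).trans ?_
  rw [extToSumι, Fintype.linearCombination_apply_single, one_smul]
  rfl

theorem prod_mem_extGr (l : List (Fin n)) :
    (l.map (e k)).prod ∈ extGr k n (l.map fun i => -ε i).sum :=
  Submodule.subset_span ⟨l, rfl, rfl⟩

theorem extToSum_prod (l : List (Fin n)) :
    extToSum k (l.map (e k)).prod = DirectSum.of (fun a => extGr k n a)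
      (l.map fun i => -ε i).sum ⟨(l.map (e k)).prod, prod_mem_extGr k l⟩ := by
  induction l with
  | nil => exact map_one (extToSum k)
  | cons i l ih =>
    have : extToSum k ((i :: l).map (e k)).prod =
        extToSum k (e k i) * extToSum k (l.map (e k)).prod := by
      rw [← map_mul, List.map_cons, List.prod_cons]
    rw [this, ih, extToSum_e, DirectSum.of_mul_of]
    exact of_congr k List.sum_cons.symm List.prod_cons.symm _ _

/-- The exterior algebra is `ℤ^n`-graded. -/
instance extGradedAlgebra : GradedAlgebra (extGr k n) :=
  GradedAlgebra.ofAlgHom _ (extToSum k)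
    (ExteriorAlgebra.hom_ext (LinearMap.pi_ext' fun i => LinearMap.ext_ring (by
      change DirectSum.coeAlgHom (extGr k n) (extToSum k (e k i)) = e k i
      rw [extToSum_e, DirectSum.coeAlgHom_of])))
    (by
      rintro a ⟨y, hy⟩
      dsimp only
      induction hy using Submodule.span_induction with
      | mem y hy =>
        obtain ⟨l, rfl, rfl⟩ := hy
        exact extToSum_prod k l
      | zero => rw [map_zero]; exact (map_zero _).symm
      | add y z hy hz ihy ihz => rw [map_add, ihy, ihz, ← map_add]; rfl
      | smul c y hy ih => 
        rw [map_smul, ih]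
        exact (map_smul (DirectSum.lof k _ (fun a => extGr k n a) a) c ⟨y, hy⟩).symm)

theorem extGr_isInternal : DirectSum.IsInternal (extGr k n) :=
  DirectSum.Decomposition.isInternal _

theorem extGr_mul_mem {a b : Fin n → ℤ} {y z : Ext k n} (hy : y ∈ extGr k n a)
    (hz : z ∈ extGr k n b) : y * z ∈ extGr k n (a + b) :=
  SetLike.mul_mem_graded hy hz

theorem symGr_mul_mem {a b : Fin n → ℤ} {y z : Sym k n} (hy : y ∈ symGr k n a)
    (hz : z ∈ symGr k n b) : y * z ∈ symGr k n (a + b) :=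
  SetLike.mul_mem_graded hy hz

/-- The exterior algebra is finite-dimensional. -/
instance : Module.Finite k (Ext k n) := by
  have (m : ℕ) : Module.Finite k (⋀[k]^m (Fin n → k)) := inferInstance
  have : Module.Finite k (⨁ m, ⋀[k]^m (Fin n → k)) := by
    refine finite_directSum _ ((Set.finite_Iic n).subset fun m hm => ?_)
    by_contra h
    refine hm (Module.finrank_zero_iff (R := k).1 ?_)
    rw [exteriorPower.finrank_eq, Module.finrank_fin_fun]
    exact Nat.choose_eq_zero_of_lt (not_le.1 h)
  have : Module.Finite k (ExteriorAlgebra k (Fin n → k)) := Module.Finite.equiv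
    (DirectSum.decomposeLinearEquiv fun m : ℕ => ⋀[k]^m (Fin n → k)).symm
  exact this

instance : IsNoetherianRing (Ext k n) := isNoetherian_of_tower k inferInstance

variable (n) in
/-- The category of finitely generated `ℤ^n`-graded modules over the polynomial ring. -/
abbrev GrS := GrMod (symGr k n)

variable (n) in
/-- The category of finitely generated `ℤ^n`-graded left modules over the exterior algebra. -/
abbrev GrE := GrMod (extGr k n)

end Algebras

/-! ### Finiteness properties of homogeneous components -/

section Finiteness

variable {k : Type u} [Field k] {n : ℕ}

theorem weight_ε (t : Fin n →₀ ℕ) (i : Fin n) : Finsupp.weight ε t i = t i := by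
  rw [Finsupp.weight_apply, Finsupp.sum_fintype _ _ (by simp), Finset.sum_apply]
  simp [ε, Pi.single_apply]

theorem deg_weight_ε (t : Fin n →₀ ℕ) : deg (Finsupp.weight ε t) = t.degree := by
  simp [deg, weight_ε, Finsupp.degree_eq_sum]

open scoped Pointwise in
theorem GrMod.exists_generators (M : GrS k n) : ∃ T : Set (M × (Fin n → ℤ)), T.Finite ∧
    ∀ a, M.gr a ≤ Submodule.span k {y | ∃ t ∈ T, ∃ s : Fin n →₀ ℕ,
      Finsupp.weight ε s + t.2 = a ∧ mono k s • t.1 = y} := by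
  classical
  obtain ⟨G, hG⟩ := (M.finite).fg_top
  let := M.isInternal.chooseDecomposition
  let T : Set (M × (Fin n → ℤ)) := ⋃ g ∈ G, (fun a => (proj M.isInternal a g, a)) ''
    ((DirectSum.decompose M.gr g).support : Set (Fin n → ℤ))
  have hT : ∀ t ∈ T, t.1 ∈ M.gr t.2 := by
    intro t ht
    simp only [T, Set.mem_iUnion] at ht
    obtain ⟨g, _, a, _, rfl⟩ := ht
    exact proj_mem _ _ _
  refine ⟨T, ?_, fun a y hy => ?_⟩
  · exact Set.Finite.biUnion G.finite_toSet fun g _ => (Finset.finite_toSet _).image _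
  · have h₁ : Submodule.span (Sym k n) (Prod.fst '' T) = ⊤ := by
      rw [eq_top_iff, ← hG, Submodule.span_le]
      intro g hg
      rw [← DirectSum.sum_support_decompose M.gr g]
      refine Submodule.sum_mem _ fun b hb => Submodule.subset_span ?_
      refine ⟨(proj M.isInternal b g, b), ?_, rfl⟩
      simp only [T, Set.mem_iUnion]
      exact ⟨g, hg, b, hb, rfl⟩
    have h₀ : Submodule.span k (Set.range (mono k (n := n))) = ⊤ := by
      have := (MvPolynomial.basisMonomials (Fin n) k).span_eq
      rwa [MvPolynomial.coe_basisMonomials] at this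
    have h₂ := Submodule.span_smul_of_span_eq_top h₀ (Prod.fst '' T)
    rw [h₁] at h₂
    have h₃ : y ∈ Submodule.span k (Set.range (mono k (n := n)) •
      (Prod.fst '' T)) := by rw [h₂]; trivial
    rw [← proj_of_mem M.isInternal hy]
    clear hy h₂
    induction h₃ using Submodule.span_induction with
    | mem z hz =>
      obtain ⟨_, ⟨s, rfl⟩, _, ⟨t, ht, rfl⟩, rfl⟩ := hz
      have hm : mono k s • t.1 ∈ M.gr (Finsupp.weight ε s + t.2) :=
        M.smul_mem (MvPolynomial.isWeightedHomogeneous_monomial ε s 1 rfl) (hT t ht)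
      by_cases h : Finsupp.weight ε s + t.2 = a
      · subst h
        rw [proj_of_mem _ hm]
        exact Submodule.subset_span ⟨t, ht, s, rfl, rfl⟩
      · rw [proj_of_mem_ne _ hm h]
        exact zero_mem _
    | zero => rw [map_zero]; exact zero_mem _
    | add z w _ _ hz hw => rw [map_add]; exact add_mem hz hw
    | smul c z _ hz => rw [map_smul]; exact Submodule.smul_mem _ c hz

instance (M : GrS k n) (a : Fin n → ℤ) : Module.Finite k (M.gr a) := by
  obtain ⟨T, hT, h⟩ := M.exists_generators
  have hf : {y | ∃ t ∈ T, ∃ s : Fin n →₀ ℕ,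
      Finsupp.weight ε s + t.2 = a ∧ mono k s • t.1 = y}.Finite := by
    have : {y | ∃ t ∈ T, ∃ s : Fin n →₀ ℕ,
      Finsupp.weight ε s + t.2 = a ∧ mono k s • t.1 = y} =
      ⋃ t ∈ T, (fun s => mono k s • t.1) ''
        {s : Fin n →₀ ℕ | Finsupp.weight ε s + t.2 = a} := by
      ext y; simp
    rw [this]
    refine Set.Finite.biUnion hT fun t _ => Set.Finite.image _ (Set.Subsingleton.finite ?_)
    intro s hs s' hs'
    refine Finsupp.ext fun i => ?_
    have h1 : (Finsupp.weight ε s + t.2) i = (Finsupp.weight ε s' + t.2) i :=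
      congrFun (hs.trans hs'.symm) i
    rw [Pi.add_apply, Pi.add_apply, weight_ε, weight_ε] at h1
    lia
  have := FiniteDimensional.span_of_finite k hf
  exact Submodule.finiteDimensional_of_le (h a)

theorem GrMod.finite_degree_symm (M : GrS k n) (d : ℤ) :
    {a | deg a = d ∧ ¬ Subsingleton (M.gr a)}.Finite := by
  obtain ⟨T, hT, h⟩ := M.exists_generators
  have : {a | deg a = d ∧ ¬ Subsingleton (M.gr a)} ⊆ ⋃ t ∈ T,
      (fun s : Fin n →₀ ℕ => Finsupp.weight ε s + t.2) '' {s | s.degree ≤ (d - deg t.2).toNat} := by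
    rintro a ⟨rfl, ha⟩
    by_contra hc
    refine ha (Submodule.subsingleton_iff_eq_bot.2 (eq_bot_iff.2 ((h a).trans ?_)))
    rw [Submodule.span_le]
    rintro _ ⟨t, ht, s, rfl, -⟩
    refine (hc ?_).elim
    simp only [Set.mem_iUnion]
    refine ⟨t, ht, s, ?_, rfl⟩
    rw [Set.mem_ofPred_eq, deg_add, deg_weight_ε]
    lia
  exact (Set.Finite.biUnion hT fun t _ => (Finsupp.finite_of_degree_le _).image _).subset this

instance (N : GrE k n) : Module.Finite k N := Module.Finite.trans (Ext k n) N

theorem GrMod.finite_ext (N : GrE k n) : {a | ¬ Subsingleton (N.gr a)}.Finite := by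
  have := WellFoundedGT.finite_ne_bot_of_iSupIndep N.isInternal.submodule_iSupIndep
  refine this.subset fun a ha h => ha (Submodule.subsingleton_iff_eq_bot.2 h)

end Finiteness

/-! ### Bounded complexes -/

section Bounded

/-- The bounded cochain complexes. -/
def isBounded (C : Type*) [Category* C] [HasZeroMorphisms C] :
    ObjectProperty (CochainComplex C ℤ) :=
  fun K => ∃ a b : ℤ, K.IsStrictlyGE a ∧ K.IsStrictlyLE b

/-- The category of bounded cochain complexes. -/
abbrev ComB (C : Type*) [Category* C] [HasZeroMorphisms C] := (isBounded C).FullSubcategory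

variable {C : Type*} [Category* C] [Abelian C] [HasDerivedCategory.{w} C]

theorem bounded_Q (K : ComB C) :
    (DerivedCategory.TStructure.t : Triangulated.TStructure (DerivedCategory C)).bounded
      (DerivedCategory.Q.obj K.obj) := by
  obtain ⟨a, b, _, _⟩ := K.property
  exact ⟨⟨a, inferInstanceAs (DerivedCategory.IsGE _ a)⟩,
    ⟨b, inferInstanceAs (DerivedCategory.IsLE _ b)⟩⟩

variable (C) in
/-- The canonical functor from bounded complexes to the bounded derived category. -/
def QB : ComB C ⥤ DerivedCategory.Bounded C :=
  ObjectProperty.lift _ ((isBounded C).ι ⋙ DerivedCategory.Q) bounded_Q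

theorem finite_of_bounded {k : Type u} [Field k] {A : Type u} [Ring A] [Algebra k A] {ι : Type v}
    [AddCommGroup ι] [DecidableEq ι] {𝒜 : ι → Submodule k A} [IsNoetherianRing A]
    (K : ComB (GrMod 𝒜)) (P : ℤ → ι → Prop)
    (hP : ∀ j, {a | P j a ∧ ¬ Subsingleton ((K.obj.X j).gr a)}.Finite) :
    {p : ℤ × ι | P p.1 p.2 ∧ ¬ Subsingleton ((K.obj.X p.1).gr p.2)}.Finite := by
  obtain ⟨a, b, _, _⟩ := K.property
  have : {p : ℤ × ι | P p.1 p.2 ∧ ¬ Subsingleton ((K.obj.X p.1).gr p.2)} ⊆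
      ⋃ j ∈ Set.Icc a b, (fun c => (j, c)) '' {c | P j c ∧ ¬ Subsingleton ((K.obj.X j).gr c)} := by
    rintro ⟨j, c⟩ ⟨h, h'⟩
    simp only [Set.mem_iUnion]
    have hz : ¬ IsZero (K.obj.X j) := fun hz => h' <| by
      have := GrMod.subsingleton_of_isZero hz
      infer_instance
    refine ⟨j, ⟨?_, ?_⟩, c, ⟨h, h'⟩, rfl⟩
    · by_contra hj; exact hz (K.obj.isZero_of_isStrictlyGE a j (by lia))
    · by_contra hj; exact hz (K.obj.isZero_of_isStrictlyLE b j (by lia))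
  exact (Set.Finite.biUnion (Set.finite_Icc a b) fun j _ => (hP j).image _).subset this

end Bounded

/-! ### Maps between homogeneous components -/

section Components

theorem toModule_mem {k : Type*} [Field k] {ι : Type*} {R : Type*} [Ring R] {σ : Type*} [DecidableEq σ] {X : σ → Type*}
    [∀ s, AddCommGroup (X s)] [∀ s, Module k (X s)] [∀ s, Module R (X s)] {Y : Type*}
    [AddCommGroup Y] [Module k Y] [Module R Y]
    (𝒳 : ∀ s, ι → Submodule k (X s)) (P : Submodule k Y) (a : ι) (φ : ∀ s, X s →ₗ[R] Y)
    (h : ∀ s, ∀ z ∈ 𝒳 s a, φ s z ∈ P) (F : ⨁ s, X s) (hF : F ∈ sumGr 𝒳 a) :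
    DirectSum.toModule R σ Y φ F ∈ P := by
  classical
  rw [← DirectSum.sum_support_of F, map_sum]
  refine Submodule.sum_mem _ fun s _ => ?_
  have := DirectSum.toModule_lof R (φ := φ) s (F s)
  rw [DirectSum.lof_eq_of] at this
  rw [this]
  exact h s _ (hF s)

variable {k : Type u} [Field k] {A : Type u} [Ring A] [Algebra k A] {ι : Type v} [AddCommGroup ι]
  [DecidableEq ι] {𝒜 : ι → Submodule k A}

/-- Multiplication by a homogeneous element, between homogeneous components. -/
def grSmul (M : GrMod 𝒜) {c : ι} {r : A} (hr : r ∈ 𝒜 c) {a b : ι} (h : c + a = b) :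
    M.gr a →ₗ[k] M.gr b :=
  (Algebra.lsmul k k M r).restrict fun _ hm => h ▸ M.smul_mem hr hm

@[simp] theorem coe_grSmul (M : GrMod 𝒜) {c : ι} {r : A} (hr : r ∈ 𝒜 c) {a b : ι} (h : c + a = b)
    (m : M.gr a) : (grSmul M hr h m : M) = r • (m : M) := rfl

/-- The map induced by a morphism on homogeneous components. -/
def grMap {M N : GrMod 𝒜} (f : M ⟶ N) (a : ι) : M.gr a →ₗ[k] N.gr a :=
  (f.lin.restrictScalars k).restrict (f.map_mem a)

@[simp] theorem coe_grMap {M N : GrMod 𝒜} (f : M ⟶ N) (a : ι) (m : M.gr a) :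
    (grMap f a m : N) = f.lin (m : M) := rfl

theorem lin_d_d (K : CochainComplex (GrMod 𝒜) ℤ) (i j l : ℤ) (m : K.X i) :
    (K.d j l).lin ((K.d i j).lin m) = 0 :=
  GrMod.lin_apply_of_comp_eq_zero (K.d_comp_d i j l) m

theorem lin_comm {K L : CochainComplex (GrMod 𝒜) ℤ} (f : K ⟶ L) (i j : ℤ) (m : K.X i) :
    (L.d i j).lin ((f.f i).lin m) = (f.f j).lin ((K.d i j).lin m) :=
  congrArg (fun t : K.X i ⟶ L.X j => t.lin m) (f.comm i j)

theorem zsmul_mem' {Y : Type*} [AddCommGroup Y] [Module k Y] (P : Submodule k Y) (c : ℤ) {y : Y}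
    (hy : y ∈ P) : c • y ∈ P := P.toAddSubgroup.zsmul_mem hy c

end Components

/-! ### The functor `R` -/

section R

variable (k : Type u) [Field k] (n : ℕ)

/-- The coinduced `E`-module `Hom_k(E, V)`, with `(a f)(y) = f(y a)`. -/
def ExtHom (V : Type u) [AddCommGroup V] [Module k V] : Type u := Ext k n →ₗ[k] V

namespace ExtHom

variable {k n} {V W : Type u} [AddCommGroup V] [Module k V] [AddCommGroup W] [Module k W]

instance : AddCommGroup (ExtHom k n V) := inferInstanceAs (AddCommGroup (Ext k n →ₗ[k] V))
instance : Module k (ExtHom k n V) := inferInstanceAs (Module k (Ext k n →ₗ[k] V))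
instance : FunLike (ExtHom k n V) (Ext k n) V := inferInstanceAs (FunLike (Ext k n →ₗ[k] V) _ _)
instance : LinearMapClass (ExtHom k n V) k (Ext k n) V :=
  inferInstanceAs (LinearMapClass (Ext k n →ₗ[k] V) k _ _)
instance [Module.Finite k V] : Module.Finite k (ExtHom k n V) :=
  inferInstanceAs (Module.Finite k (Ext k n →ₗ[k] V))
instance [Subsingleton V] : Subsingleton (ExtHom k n V) :=
  inferInstanceAs (Subsingleton (Ext k n →ₗ[k] V))

theorem ext {f g : ExtHom k n V} (h : ∀ y, f y = g y) : f = g := LinearMap.ext h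

@[simp] theorem add_apply (f g : ExtHom k n V) (y : Ext k n) : (f + g) y = f y + g y := rfl
@[simp] theorem zero_apply (y : Ext k n) : (0 : ExtHom k n V) y = 0 := rfl
@[simp] theorem smulk_apply (c : k) (f : ExtHom k n V) (y : Ext k n) : (c • f) y = c • f y := rfl

instance : SMul (Ext k n) (ExtHom k n V) := ⟨fun a f => LinearMap.comp f (LinearMap.mulRight k a)⟩

@[simp] theorem smul_apply (a : Ext k n) (f : ExtHom k n V) (y : Ext k n) :
    (a • f) y = f (y * a) := rfl

instance : Module (Ext k n) (ExtHom k n V) where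
  one_smul f := ext fun y => by simp
  mul_smul a b f := ext fun y => by simp [mul_assoc]
  smul_zero a := ext fun y => by simp
  smul_add a f g := ext fun y => by simp
  add_smul a b f := ext fun y => by simp [mul_add]
  zero_smul f := ext fun y => by simp

instance : IsScalarTower k (Ext k n) (ExtHom k n V) where
  smul_assoc c a f := ext fun y => by simp

instance [Module.Finite k V] : Module.Finite (Ext k n) (ExtHom k n V) :=
  Module.Finite.of_restrictScalars_finite k _ _

variable (k n V) in
/-- If `V` is concentrated in degree `a`, this is the component of degree `b` of the graded vector
space `Hom_k(E(-1), V)`: a homomorphism of degree `b` maps `E(-1)_c = E_{c-1}` to `V_{b+c}`, which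
is zero unless `b + c = a`. -/
def gr (a b : Fin n → ℤ) : Submodule k (ExtHom k n V) where
  carrier := {f | ∀ c, b + c ≠ a → ∀ y ∈ extGr k n (c - one), f y = 0}
  zero_mem' _ _ _ _ := rfl
  add_mem' hf hg c hc y hy := by rw [add_apply, hf c hc y hy, hg c hc y hy, add_zero]
  smul_mem' r f hf c hc y hy := by rw [smulk_apply, hf c hc y hy, smul_zero]

theorem smul_mem_gr {a b c : Fin n → ℤ} {r : Ext k n} {f : ExtHom k n V} (hr : r ∈ extGr k n c)
    (hf : f ∈ gr k n V a b) : r • f ∈ gr k n V a (c + b) := by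
  intro c' hc y hy
  refine hf (c' + c) (fun h => hc (by rw [← h]; abel)) _ ?_
  have := extGr_mul_mem k hy hr
  rwa [show c' - one + c = c' + c - one by abel] at this

theorem gr_isInternal (a : Fin n → ℤ) : DirectSum.IsInternal (gr k n V a) := by
  classical
  have hE := extGr_isInternal k (n := n)
  let π : (Fin n → ℤ) → ExtHom k n V →ₗ[k] ExtHom k n V := fun b =>
    LinearMap.lcomp k V (proj hE (a - b - one))
  have hπ : ∀ b f y, π b f y = f (proj hE (a - b - one) y) := fun _ _ _ => rfl
  have key : ∀ b f, f ∈ gr k n V a b → ∀ c, c ≠ a - b - one → ∀ y, f (proj hE c y) = 0 := by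
    intro b f hf c hc y
    refine hf (c + one) (fun h => hc (by rw [← h]; abel)) _ ?_
    rw [add_sub_cancel_right]
    exact proj_mem hE c y
  have hsum : ∀ y : Ext k n, ∃ s : Finset (Fin n → ℤ), ∀ t, s ⊆ t → ∑ c ∈ t, proj hE c y = y := by
    intro y
    let := hE.chooseDecomposition
    refine ⟨(DirectSum.decompose (extGr k n) y).support, fun t ht => ?_⟩
    refine Eq.trans ?_ (DirectSum.sum_support_decompose (extGr k n) y)
    symm
    refine Finset.sum_subset ht fun c _ hc => ?_
    rw [DFinsupp.notMem_support_iff] at hc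
    exact congrArg Subtype.val hc
  refine isInternal_of_proj π ?_ ?_ ?_
  · intro b f hf
    refine ext fun y => ?_
    rw [hπ]
    obtain ⟨s, hs⟩ := hsum y
    have h1 := hs (insert (a - b - one) s) (Finset.subset_insert _ _)
    conv_rhs => rw [← h1, map_sum]
    rw [Finset.sum_eq_single_of_mem (a - b - one) (Finset.mem_insert_self _ _)]
    intro c _ hc
    exact key b f hf c hc y
  · intro b b' f hf h
    refine ext fun y => ?_
    rw [hπ]
    refine key b' f hf _ (fun h' => h ?_) y
    rw [sub_left_inj, sub_right_inj] at h'
    exact h'.symm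
  · intro f
    have hfin : {c | ¬ Subsingleton (extGr k n c)}.Finite := by
      have := WellFoundedGT.finite_ne_bot_of_iSupIndep hE.submodule_iSupIndep
      exact this.subset fun c hc h => hc (Submodule.subsingleton_iff_eq_bot.2 h)
    have hf : f = ∑ c ∈ hfin.toFinset, π (a - c - one) f := by
      refine ext fun y => ?_
      have h1 : (∑ c ∈ hfin.toFinset, π (a - c - one) f) y =
          ∑ c ∈ hfin.toFinset, π (a - c - one) f y := LinearMap.sum_apply _ _ _
      obtain ⟨s, hs⟩ := hsum y
      have h2 := hs (s ∪ hfin.toFinset) Finset.subset_union_left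
      rw [← Finset.sum_subset Finset.subset_union_right (fun c _ hc => by
        have : Subsingleton (extGr k n c) := by simpa using hc
        exact congrArg Subtype.val (Subsingleton.elim
          (⟨_, proj_mem hE c y⟩ : extGr k n c) 0))] at h2
      rw [h1]
      conv_lhs => rw [← h2, map_sum]
      refine Finset.sum_congr rfl fun c _ => ?_
      rw [hπ, show a - (a - c - one) - one = c by abel]
    rw [hf]
    refine Submodule.sum_mem _ fun c _ => Submodule.mem_iSup_of_mem (a - c - one) ?_
    intro c' hc' y hy
    rw [hπ, show a - (a - c - one) - one = c by abel, proj_of_mem_ne hE hy, map_zero]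
    intro h
    refine hc' ?_
    rw [← h]; abel

/-- Postcomposition with a linear map. -/
def map (φ : V →ₗ[k] W) : ExtHom k n V →ₗ[Ext k n] ExtHom k n W where
  toFun f := LinearMap.comp φ f
  map_add' _ _ := ext fun _ => map_add φ _ _
  map_smul' _ _ := rfl

@[simp] theorem map_apply (φ : V →ₗ[k] W) (f : ExtHom k n V) (y : Ext k n) :
    map φ f y = φ (f y) := rfl

/-- Precomposition with left multiplication by `e_l`. -/
def pre (l : Fin n) : ExtHom k n V →ₗ[Ext k n] ExtHom k n V where
  toFun f := LinearMap.comp f (LinearMap.mulLeft k (e k l))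
  map_add' _ _ := rfl
  map_smul' a f := ext fun y => congrArg f (mul_assoc (e k l) y a)

@[simp] theorem pre_apply (l : Fin n) (f : ExtHom k n V) (y : Ext k n) :
    pre l f y = f (e k l * y) := rfl

theorem map_mem_gr (φ : V →ₗ[k] W) {a b : Fin n → ℤ} {f : ExtHom k n V} (hf : f ∈ gr k n V a b) :
    map φ f ∈ gr k n W a b := fun c hc y hy => by rw [map_apply, hf c hc y hy, map_zero]

theorem pre_mem_gr (l : Fin n) {a b : Fin n → ℤ} {f : ExtHom k n V} (hf : f ∈ gr k n V a b) :
    pre l f ∈ gr k n V (a + ε l) b := fun c hc y hy => by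
  refine hf (c - ε l) (fun h => hc (by rw [← h]; abel)) _ ?_
  have := extGr_mul_mem k (e_mem k l) hy
  rwa [show -ε l + (c - one) = c - ε l - one by abel] at this

end ExtHom

variable {k n}

variable (n) in
/-- The pairs `(j, a)` with `j + ||a|| = i`. -/
abbrev RIdx (i : ℤ) : Type := {p : ℤ × (Fin n → ℤ) // p.1 + deg p.2 = i}

theorem RIdx.up {i i' j : ℤ} {a : Fin n → ℤ} (hp : j + deg a = i) (h : i + 1 = i') (l : Fin n) :
    j + deg (a + ε l) = i' := by
  rw [deg_add_ε]; lia

theorem RIdx.right {i i' j : ℤ} {a : Fin n → ℤ} (hp : j + deg a = i) (h : i + 1 = i') :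
    j + 1 + deg a = i' := by
  lia

/-- The summand `Hom_k(E(-1), M^j_a)` of `R(M)`. -/
abbrev RSummand (M : CochainComplex (GrS k n) ℤ) {i : ℤ} (p : RIdx n i) : Type u :=
  ExtHom k n ((M.X p.1.1).gr p.1.2)

/-- The grading of the summand `Hom_k(E(-1), M^j_a)` of `R(M)`. -/
abbrev RSummandGr (M : CochainComplex (GrS k n) ℤ) {i : ℤ} (p : RIdx n i) :
    (Fin n → ℤ) → Submodule k (RSummand M p) :=
  ExtHom.gr k n ((M.X p.1.1).gr p.1.2) p.1.2

/-- The direct sum of the modules `Hom_k(E(-1), M^j_a)` with `j + ||a|| = i`. -/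
def RSum (M : CochainComplex (GrS k n) ℤ) (i : ℤ) : Type u := ⨁ p : RIdx n i, RSummand M p

instance (M : CochainComplex (GrS k n) ℤ) (i : ℤ) : AddCommGroup (RSum M i) :=
  inferInstanceAs (AddCommGroup (⨁ p : RIdx n i, RSummand M p))
instance (M : CochainComplex (GrS k n) ℤ) (i : ℤ) : Module k (RSum M i) :=
  inferInstanceAs (Module k (⨁ p : RIdx n i, RSummand M p))
instance (M : CochainComplex (GrS k n) ℤ) (i : ℤ) : Module (Ext k n) (RSum M i) :=
  inferInstanceAs (Module (Ext k n) (⨁ p : RIdx n i, RSummand M p))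
instance (M : CochainComplex (GrS k n) ℤ) (i : ℤ) : IsScalarTower k (Ext k n) (RSum M i) :=
  inferInstanceAs (IsScalarTower k (Ext k n) (⨁ p : RIdx n i, RSummand M p))

/-- The grading of `RSum M i`. -/
def RSumGr (M : CochainComplex (GrS k n) ℤ) (i : ℤ) :
    (Fin n → ℤ) → Submodule k (RSum M i) := sumGr (fun p : RIdx n i => RSummandGr M p)

/-- The component of cohomological degree `i` of `R(M)`, the direct sum of the modules
`Hom_k(E(-1), M^j_a)` with `j + ||a|| = i`. -/
def RX (M : ComB (GrS k n)) (i : ℤ) : GrE k n where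
  carrier := RSum M.obj i
  gr := RSumGr M.obj i
  isInternal := sumGr_isInternal _ fun p => ExtHom.gr_isInternal p.1.2
  smul_mem hr hm p := ExtHom.smul_mem_gr hr (hm p)
  finite := by
    refine finite_directSum (RSummand M.obj (i := i)) ?_
    have h := finite_of_bounded M (fun j a => j + deg a = i) fun j =>
      ((M.obj.X j).finite_degree_symm (i - j)).subset fun a ha => ⟨by rw [← ha.1]; lia, ha.2⟩
    refine (h.preimage (f := (Subtype.val : RIdx n i → _)) Subtype.val_injective.injOn).subset
      fun p hp => ⟨p.2, fun hs => hp ?_⟩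
    infer_instance

/-- The inclusion of the summand `Hom_k(E(-1), M^j_a)`. -/
def Rlof (M : CochainComplex (GrS k n) ℤ) {i : ℤ} (j : ℤ) (a : Fin n → ℤ) (h : j + deg a = i) :
    ExtHom k n ((M.X j).gr a) →ₗ[Ext k n] RSum M i :=
  DirectSum.lof (Ext k n) (RIdx n i) (RSummand M) ⟨(j, a), h⟩

/-- The linear map on the direct sum given by linear maps on the summands. -/
def Rdesc (M : CochainComplex (GrS k n) ℤ) {i : ℤ} {Y : Type u} [AddCommGroup Y]
    [Module (Ext k n) Y]
    (φ : ∀ (j : ℤ) (a : Fin n → ℤ), j + deg a = i → ExtHom k n ((M.X j).gr a) →ₗ[Ext k n] Y) :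
    RSum M i →ₗ[Ext k n] Y :=
  DirectSum.toModule (Ext k n) (RIdx n i) Y fun p => φ p.1.1 p.1.2 p.2

theorem Rdesc_lof (M : CochainComplex (GrS k n) ℤ) {i : ℤ} {Y : Type u} [AddCommGroup Y]
    [Module (Ext k n) Y]
    (φ : ∀ (j : ℤ) (a : Fin n → ℤ), j + deg a = i → ExtHom k n ((M.X j).gr a) →ₗ[Ext k n] Y)
    (j : ℤ) (a : Fin n → ℤ) (hp : j + deg a = i) (f : ExtHom k n ((M.X j).gr a)) :
    Rdesc M φ (Rlof M j a hp f) = φ j a hp f :=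
  DirectSum.toModule_lof (Ext k n) (φ := fun p : RIdx n i => φ p.1.1 p.1.2 p.2) ⟨(j, a), hp⟩ f

/-- The differential of `R(M)`, on the component of cohomological degree `i`: an element
`f ∈ Hom_k(E(-1), M^j_a)` is mapped to `(y ↦ ∑_l x_l f(e_l y)) + (-1)^i (δ^j ∘ f)`. -/
def RdLin (M : CochainComplex (GrS k n) ℤ) (i i' : ℤ) (h : i + 1 = i') :
    RSum M i →ₗ[Ext k n] RSum M i' :=
  Rdesc M fun j a hp =>
    (∑ l : Fin n, Rlof M j (a + ε l) (RIdx.up hp h l) ∘ₗ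
      ExtHom.map (grSmul (M.X j) (x_mem k l) (add_comm (ε l) a)) ∘ₗ ExtHom.pre l) +
    (i.negOnePow : ℤ) • (Rlof M (j + 1) a (RIdx.right hp h) ∘ₗ
      ExtHom.map (grMap (M.d j (j + 1)) a))

theorem RdLin_lof (M : CochainComplex (GrS k n) ℤ) (i i' : ℤ) (h : i + 1 = i') (j : ℤ)
    (a : Fin n → ℤ) (hp : j + deg a = i) (f : ExtHom k n ((M.X j).gr a)) :
    RdLin M i i' h (Rlof M j a hp f) =
      (∑ l : Fin n, Rlof M j (a + ε l) (RIdx.up hp h l)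
        (ExtHom.map (grSmul (M.X j) (x_mem k l) (add_comm (ε l) a)) (ExtHom.pre l f))) +
      (i.negOnePow : ℤ) • (Rlof M (j + 1) a (RIdx.right hp h)
        (ExtHom.map (grMap (M.d j (j + 1)) a) f)) := by
  rw [RdLin, Rdesc_lof, LinearMap.add_apply, LinearMap.sum_apply, LinearMap.smul_apply]
  rfl

theorem Rlof_congr (M : CochainComplex (GrS k n) ℤ) {i j : ℤ} {a a' : Fin n → ℤ} (h : a = a')
    (hp : j + deg a = i) (hp' : j + deg a' = i) (f : ExtHom k n ((M.X j).gr a))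
    (g : ExtHom k n ((M.X j).gr a')) (hfg : ∀ y, (f y : M.X j) = g y) :
    Rlof M j a hp f = Rlof M j a' hp' g := by
  subst h
  exact congrArg _ (ExtHom.ext fun y => Subtype.ext (hfg y))

theorem Rlof_eq_zero (M : CochainComplex (GrS k n) ℤ) {i j : ℤ} {a : Fin n → ℤ}
    (hp : j + deg a = i) (f : ExtHom k n ((M.X j).gr a)) (hf : ∀ y, (f y : M.X j) = 0) :
    Rlof M j a hp f = 0 := by
  have : f = 0 := ExtHom.ext fun y => Subtype.ext (hf y)
  rw [this, map_zero]

theorem Rhom_ext (M : CochainComplex (GrS k n) ℤ) {i : ℤ} {Y : Type*} [AddCommGroup Y]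
    [Module (Ext k n) Y] {φ ψ : RSum M i →ₗ[Ext k n] Y}
    (h : ∀ j a hp f, φ (Rlof M j a hp f) = ψ (Rlof M j a hp f)) : φ = ψ :=
  DirectSum.linearMap_ext _ fun p => LinearMap.ext fun f => h p.1.1 p.1.2 p.2 f

theorem RdLin_RdLin (M : CochainComplex (GrS k n) ℤ) (i i' i'' : ℤ) (h : i + 1 = i')
    (h' : i' + 1 = i'') (F : RSum M i) :
    RdLin M i' i'' h' (RdLin M i i' h F) = 0 := by
  suffices RdLin M i' i'' h' ∘ₗ RdLin M i i' h = 0 from LinearMap.congr_fun this F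
  refine Rhom_ext M fun j a hp f => ?_
  rw [LinearMap.comp_apply, RdLin_lof, map_add, map_sum, map_zsmul, RdLin_lof]
  simp only [RdLin_lof, Finset.sum_add_distrib, smul_add, Finset.smul_sum]
  have h1 : ∑ s : Fin n, ∑ t : Fin n,
      Rlof M j (a + ε s + ε t) (RIdx.up (RIdx.up hp h s) h' t)
        (ExtHom.map (grSmul (M.X j) (x_mem k t) (add_comm (ε t) (a + ε s)))
          (ExtHom.pre t (ExtHom.map (grSmul (M.X j) (x_mem k s) (add_comm (ε s) a))
            (ExtHom.pre s f)))) = 0 := by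
    refine sum_sum_eq_zero (σ := Fin n) (fun s t =>
      Rlof M j (a + ε s + ε t) (RIdx.up (RIdx.up hp h s) h' t)
        (ExtHom.map (grSmul (M.X j) (x_mem k t) (add_comm (ε t) (a + ε s)))
          (ExtHom.pre t (ExtHom.map (grSmul (M.X j) (x_mem k s) (add_comm (ε s) a))
            (ExtHom.pre s f))))) (fun s t => ?_) (fun s => ?_)
    · rw [add_eq_zero_iff_eq_neg, ← map_neg]
      refine Rlof_congr M (add_right_comm _ _ _) _ _ _ _ fun y => ?_
      change x k t • x k s • (f (e k s * (e k t * y)) : M.X j) =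
        -(x k s • x k t • (f (e k t * (e k s * y)) : M.X j))
      rw [smul_comm, ← smul_neg, ← smul_neg, ← Submodule.coe_neg, ← map_neg, ← mul_assoc,
        ← mul_assoc, ← neg_mul, ← eq_neg_of_add_eq_zero_left (e_mul_add_swap k s t)]
    · refine Rlof_eq_zero M _ _ fun y => ?_
      change x k s • x k s • (f (e k s * (e k s * y)) : M.X j) = 0
      rw [← mul_assoc, e_mul_self, zero_mul, map_zero, Submodule.coe_zero, smul_zero, smul_zero]
  have h2 : Rlof M (j + 1 + 1) a (RIdx.right (RIdx.right hp h) h')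
      (ExtHom.map (grMap (M.d (j + 1) (j + 1 + 1)) a)
        (ExtHom.map (grMap (M.d j (j + 1)) a) f)) = 0 :=
    Rlof_eq_zero M _ _ fun y => lin_d_d M _ _ _ _
  have h3 : ∀ s : Fin n, Rlof M (j + 1) (a + ε s) (RIdx.up (RIdx.right hp h) h' s)
      (ExtHom.map (grSmul (M.X (j + 1)) (x_mem k s) (add_comm (ε s) a))
        (ExtHom.pre s (ExtHom.map (grMap (M.d j (j + 1)) a) f))) =
      Rlof M (j + 1) (a + ε s) (RIdx.right (RIdx.up hp h s) h')
      (ExtHom.map (grMap (M.d j (j + 1)) (a + ε s))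
        (ExtHom.map (grSmul (M.X j) (x_mem k s) (add_comm (ε s) a)) (ExtHom.pre s f))) := by
    intro s
    refine Rlof_congr M rfl _ _ _ _ fun y => ?_
    exact (((M.d j (j + 1)).lin).map_smul (x k s) _).symm
  have h4 : (i'.negOnePow : ℤ) = -(i.negOnePow : ℤ) := by
    rw [← h, Int.negOnePow_succ, Units.val_neg]
  rw [h1, h2, Finset.sum_congr rfl fun s _ => congrArg _ (h3 s)]
  simp only [smul_zero, add_zero, zero_add, h4, neg_smul, Finset.sum_neg_distrib]
  exact neg_add_cancel _

theorem RdLin_mem (M : CochainComplex (GrS k n) ℤ) (i i' : ℤ) (h : i + 1 = i') (b : Fin n → ℤ)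
    (F : RSum M i)
    (hF : F ∈ RSumGr M i b) :
    RdLin M i i' h F ∈ RSumGr M i' b := by
  have hl : ∀ j a hp f, f ∈ ExtHom.gr k n ((M.X j).gr a) a b →
      Rlof M j a hp f ∈ RSumGr M i' b := fun j a hp f hf =>
    lof_mem_sumGr (R := Ext k n) (fun p : RIdx n i' => RSummandGr M p) b ⟨(j, a), hp⟩ hf
  refine toModule_mem _ _ b _ (fun p f hf => ?_) F hF
  rw [LinearMap.add_apply, LinearMap.sum_apply, LinearMap.smul_apply]
  refine add_mem (Submodule.sum_mem _ fun l _ => ?_) (zsmul_mem' _ _ ?_)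
  · exact hl _ _ _ _ (ExtHom.map_mem_gr _ (ExtHom.pre_mem_gr l hf))
  · exact hl _ _ _ _ (ExtHom.map_mem_gr _ hf)

/-- The differential of `R(M)`. -/
def Rd (M : ComB (GrS k n)) (i i' : ℤ) : RX M i ⟶ RX M i' :=
  if h : i + 1 = i' then ⟨RdLin M.obj i i' h, RdLin_mem M.obj i i' h⟩ else 0

theorem Rd_eq (M : ComB (GrS k n)) (i i' : ℤ) (h : i + 1 = i') :
    Rd M i i' = ⟨RdLin M.obj i i' h, RdLin_mem M.obj i i' h⟩ := dif_pos h

/-- The complex `R(M)`. -/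
def RObj (M : ComB (GrS k n)) : CochainComplex (GrE k n) ℤ where
  X := RX M
  d := Rd M
  shape _ _ h := dif_neg h
  d_comp_d' i i' i'' h h' :=
    (congrArg₂ (· ≫ ·) (Rd_eq M i i' h) (Rd_eq M i' i'' h')).trans
      (GrMod.hom_ext (RdLin_RdLin M.obj i i' i'' h h'))

/-- The map `R(φ)` in cohomological degree `i`, `f ↦ φ ∘ f`. -/
def RMapLin {M M' : CochainComplex (GrS k n) ℤ} (φ : M ⟶ M') (i : ℤ) :
    RSum M i →ₗ[Ext k n] RSum M' i :=
  DirectSum.lmap fun p => ExtHom.map (grMap (φ.f p.1.1) p.1.2)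

theorem RMapLin_lof {M M' : CochainComplex (GrS k n) ℤ} (φ : M ⟶ M') (i : ℤ) (j : ℤ)
    (a : Fin n → ℤ) (hp : j + deg a = i) (f : ExtHom k n ((M.X j).gr a)) :
    RMapLin φ i (Rlof M j a hp f) = Rlof M' j a hp (ExtHom.map (grMap (φ.f j) a) f) :=
  DirectSum.lmap_lof _ _ _

theorem RMapLin_comm {M M' : CochainComplex (GrS k n) ℤ} (φ : M ⟶ M') (i i' : ℤ)
    (h : i + 1 = i') (F : RSum M i) :
    RdLin M' i i' h (RMapLin φ i F) = RMapLin φ i' (RdLin M i i' h F) := by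
  suffices RdLin M' i i' h ∘ₗ RMapLin φ i = RMapLin φ i' ∘ₗ RdLin M i i' h from
    LinearMap.congr_fun this F
  refine Rhom_ext M fun j a hp f => ?_
  rw [LinearMap.comp_apply, LinearMap.comp_apply, RdLin_lof, RMapLin_lof, RdLin_lof, map_add,
    map_sum, map_zsmul]
  simp only [RMapLin_lof]
  refine congrArg₂ (· + ·) (Finset.sum_congr rfl fun l _ => ?_) (congrArg _ ?_)
  · exact Rlof_congr M' rfl _ _ _ _ fun y => (((φ.f j).lin).map_smul (x k l) _).symm
  · exact Rlof_congr M' rfl _ _ _ _ fun y => lin_comm φ _ _ _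

/-- The morphism of complexes `R(φ)`. -/
def RMap {M M' : ComB (GrS k n)} (φ : M ⟶ M') : RObj M ⟶ RObj M' where
  f i := ⟨RMapLin φ.hom i, fun _ _ hF p => ExtHom.map_mem_gr _ (hF p)⟩
  comm' i i' h :=
    (congrArg₂ (· ≫ ·) rfl (Rd_eq M' i i' h)).trans <|
      (GrMod.hom_ext (RMapLin_comm φ.hom i i' h)).trans
      (congrArg₂ (· ≫ ·) (Rd_eq M i i' h) rfl).symm

variable (k n) in
/-- The functor `R` from bounded complexes of graded `S`-modules to complexes of graded
`E`-modules. -/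
def functorR : ComB (GrS k n) ⥤ CochainComplex (GrE k n) ℤ where
  obj := RObj
  map := RMap
  map_id _ := HomologicalComplex.hom_ext _ _ fun _ => GrMod.hom_ext fun _ =>
    DFinsupp.ext fun _ => rfl
  map_comp _ _ := HomologicalComplex.hom_ext _ _ fun _ => GrMod.hom_ext fun _ =>
    DFinsupp.ext fun _ => rfl

end R

/-! ### The functor `L` -/

section L

variable (k : Type u) [Field k] (n : ℕ)

/-- The `S`-module `S ⊗_k V`. -/
def SymTensor (V : Type u) [AddCommGroup V] [Module k V] : Type u := Sym k n ⊗[k] V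

namespace SymTensor

variable {k n} {V W : Type u} [AddCommGroup V] [Module k V] [AddCommGroup W] [Module k W]

instance : AddCommGroup (SymTensor k n V) := inferInstanceAs (AddCommGroup (Sym k n ⊗[k] V))
instance : Module k (SymTensor k n V) := inferInstanceAs (Module k (Sym k n ⊗[k] V))
instance : Module (Sym k n) (SymTensor k n V) := inferInstanceAs (Module (Sym k n) (Sym k n ⊗[k] V))
instance : IsScalarTower k (Sym k n) (SymTensor k n V) :=
  inferInstanceAs (IsScalarTower k (Sym k n) (Sym k n ⊗[k] V))
instance [Module.Finite k V] : Module.Finite (Sym k n) (SymTensor k n V) :=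
  inferInstanceAs (Module.Finite (Sym k n) (Sym k n ⊗[k] V))
instance [Subsingleton V] : Subsingleton (SymTensor k n V) :=
  ⟨fun z w => by
    have h : ∀ z : Sym k n ⊗[k] V, z = 0 := fun z => by
      induction z using TensorProduct.induction_on with
      | zero => rfl
      | tmul s v => rw [Subsingleton.elim v 0, TensorProduct.tmul_zero]
      | add z w hz hw => rw [hz, hw, add_zero]
    exact (h z).trans (h w).symm⟩

/-- The element `s ⊗ v`. -/
def tmul (s : Sym k n) (v : V) : SymTensor k n V := s ⊗ₜ[k] v

theorem smul_tmul (r s : Sym k n) (v : V) : r • tmul s v = tmul (r * s) v := rfl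

theorem tmul_neg (s : Sym k n) (v : V) : tmul s (-v) = -tmul s v :=
  TensorProduct.tmul_neg (R := k) s v

theorem zero_tmul (v : V) : tmul (0 : Sym k n) v = 0 := TensorProduct.zero_tmul (R := k) _ v

theorem tmul_zero (s : Sym k n) : tmul s (0 : V) = 0 := TensorProduct.tmul_zero (R := k) _ s

theorem induction_on {P : SymTensor k n V → Prop} (z : SymTensor k n V) (zero : P 0)
    (tmul : ∀ s v, P (tmul s v)) (add : ∀ z w, P z → P w → P (z + w)) : P z :=
  TensorProduct.induction_on (R := k) (motive := P) z zero tmul add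

/-- The map `s ↦ s ⊗ v`. -/
def tmulRight (v : V) : Sym k n →ₗ[k] SymTensor k n V := (TensorProduct.mk k (Sym k n) V).flip v

variable (k n V) in
/-- If `V` is concentrated in degree `a`, this is the component of degree `b` of the graded vector
space `S(-1) ⊗_k V`, which is `S(-1)_{b-a} ⊗_k V = S_{b-1-a} ⊗_k V`. -/
def gr (a b : Fin n → ℤ) : Submodule k (SymTensor k n V) :=
  Submodule.span k {z | ∃ s ∈ symGr k n (b - one - a), ∃ v : V, tmul s v = z}

theorem tmul_mem_gr {a b : Fin n → ℤ} {s : Sym k n} (hs : s ∈ symGr k n (b - one - a)) (v : V) :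
    tmul s v ∈ gr k n V a b := Submodule.subset_span ⟨s, hs, v, rfl⟩

theorem smul_mem_gr {a b c : Fin n → ℤ} {r : Sym k n} {z : SymTensor k n V}
    (hr : r ∈ symGr k n c) (hz : z ∈ gr k n V a b) : r • z ∈ gr k n V a (c + b) := by
  induction hz using Submodule.span_induction with
  | mem z hz =>
    obtain ⟨s, hs, v, rfl⟩ := hz
    rw [smul_tmul]
    refine tmul_mem_gr ?_ v
    have := symGr_mul_mem k hr hs
    rwa [show c + (b - one - a) = c + b - one - a by abel] at this
  | zero => rw [smul_zero]; exact zero_mem _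
  | add z w _ _ hz hw => rw [smul_add]; exact add_mem hz hw
  | smul t z _ hz => rw [smul_comm]; exact Submodule.smul_mem _ t hz

theorem gr_isInternal (a : Fin n → ℤ) : DirectSum.IsInternal (gr k n V a) := by
  have hS := symGr_isInternal k (n := n)
  let π : (Fin n → ℤ) → SymTensor k n V →ₗ[k] SymTensor k n V := fun b =>
    LinearMap.rTensor V (proj hS (b - one - a))
  have hπ : ∀ b s v, π b (tmul s v) = tmul (proj hS (b - one - a) s) v := fun _ _ _ => rfl
  refine isInternal_of_proj π ?_ ?_ ?_
  · intro b z hz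
    induction hz using Submodule.span_induction with
    | mem z hz =>
      obtain ⟨s, hs, v, rfl⟩ := hz
      rw [hπ, proj_of_mem hS hs]
    | zero => rw [map_zero]
    | add z w _ _ hz hw => rw [map_add, hz, hw]
    | smul t z _ hz => rw [map_smul, hz]
  · intro b b' z hz h
    induction hz using Submodule.span_induction with
    | mem z hz =>
      obtain ⟨s, hs, v, rfl⟩ := hz
      rw [hπ, proj_of_mem_ne hS hs, zero_tmul]
      rwa [Ne, sub_left_inj, sub_left_inj]
    | zero => rw [map_zero]
    | add z w _ _ hz hw => rw [map_add, hz, hw, add_zero]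
    | smul t z _ hz => rw [map_smul, hz, smul_zero]
  · intro z
    induction z using induction_on with
    | zero => exact zero_mem _
    | add z w hz hw => exact add_mem hz hw
    | tmul s v =>
      have : (⨆ c, symGr k n c) ≤
          (⨆ b, gr k n V a b).comap (tmulRight v) :=
        iSup_le fun c t ht => Submodule.mem_iSup_of_mem (c + one + a) (tmul_mem_gr (by
          rwa [show c + one + a - one - a = c by abel]) v)
      exact this (mem_iSup_of_isInternal hS s)

/-- The map `s ⊗ v ↦ r s ⊗ φ(v)`. -/
def map (r : Sym k n) (φ : V →ₗ[k] W) : SymTensor k n V →ₗ[Sym k n] SymTensor k n W :=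
  TensorProduct.AlgebraTensorModule.map (R := k) (A := Sym k n) (LinearMap.lsmul (Sym k n) (Sym k n) r) φ

@[simp] theorem map_tmul (r : Sym k n) (φ : V →ₗ[k] W) (s : Sym k n) (v : V) :
    map r φ (tmul s v) = tmul (r * s) (φ v) := rfl

theorem map_mem_gr {r : Sym k n} {c : Fin n → ℤ} (hr : r ∈ symGr k n c) (φ : V →ₗ[k] W)
    {a b : Fin n → ℤ} {z : SymTensor k n V} (hz : z ∈ gr k n V a b) :
    map r φ z ∈ gr k n W (a - c) b := by
  induction hz using Submodule.span_induction with
  | mem z hz =>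
    obtain ⟨s, hs, v, rfl⟩ := hz
    refine tmul_mem_gr ?_ _
    have := symGr_mul_mem k hr hs
    rwa [show c + (b - one - a) = b - one - (a - c) by abel] at this
  | zero => rw [map_zero]; exact zero_mem _
  | add z w _ _ hz hw => rw [map_add]; exact add_mem hz hw
  | smul t z _ hz =>
    rw [LinearMap.map_smul_of_tower]; exact Submodule.smul_mem _ t hz

theorem map_one_mem_gr (φ : V →ₗ[k] W) {a b : Fin n → ℤ} {z : SymTensor k n V}
    (hz : z ∈ gr k n V a b) : map 1 φ z ∈ gr k n W a b := by
  have := map_mem_gr (c := 0) (SetLike.GradedOne.one_mem (A := symGr k n)) φ hz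
  rwa [sub_zero] at this

theorem linearMap_ext {Y : Type*} [AddCommGroup Y] [Module (Sym k n) Y]
    {φ ψ : SymTensor k n V →ₗ[Sym k n] Y} (h : ∀ s v, φ (tmul s v) = ψ (tmul s v)) : φ = ψ := by
  refine LinearMap.ext fun z => ?_
  induction z using induction_on with
  | zero => rw [map_zero, map_zero]
  | add z w hz hw => rw [map_add, map_add, hz, hw]
  | tmul s v => exact h s v

end SymTensor

variable {k n}

variable (n) in
/-- The pairs `(j, a)` with `j - ||a|| = i`. -/
abbrev LIdx (i : ℤ) : Type := {p : ℤ × (Fin n → ℤ) // p.1 - deg p.2 = i}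

theorem LIdx.down {i i' j : ℤ} {a : Fin n → ℤ} (hp : j - deg a = i) (h : i + 1 = i') (l : Fin n) :
    j - deg (a - ε l) = i' := by
  rw [deg_sub_ε]; lia

theorem LIdx.right {i i' j : ℤ} {a : Fin n → ℤ} (hp : j - deg a = i) (h : i + 1 = i') :
    j + 1 - deg a = i' := by
  lia

/-- The summand `S(-1) ⊗_k N^j_a` of `L(N)`. -/
abbrev LSummand (N : CochainComplex (GrE k n) ℤ) {i : ℤ} (p : LIdx n i) : Type u :=
  SymTensor k n ((N.X p.1.1).gr p.1.2)

/-- The grading of the summand `S(-1) ⊗_k N^j_a` of `L(N)`. -/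
abbrev LSummandGr (N : CochainComplex (GrE k n) ℤ) {i : ℤ} (p : LIdx n i) :
    (Fin n → ℤ) → Submodule k (LSummand N p) :=
  SymTensor.gr k n ((N.X p.1.1).gr p.1.2) p.1.2

theorem finite_LSummand (N : ComB (GrE k n)) :
    {p : ℤ × (Fin n → ℤ) | ¬ Subsingleton ((N.obj.X p.1).gr p.2)}.Finite := by
  have h := finite_of_bounded N (fun _ _ => True) fun j => by
    simpa using (N.obj.X j).finite_ext
  simpa using h

/-- The direct sum of the modules `S(-1) ⊗_k N^j_a` with `j - ||a|| = i`. -/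
def LSum (N : CochainComplex (GrE k n) ℤ) (i : ℤ) : Type u := ⨁ p : LIdx n i, LSummand N p

instance (N : CochainComplex (GrE k n) ℤ) (i : ℤ) : AddCommGroup (LSum N i) :=
  inferInstanceAs (AddCommGroup (⨁ p : LIdx n i, LSummand N p))
instance (N : CochainComplex (GrE k n) ℤ) (i : ℤ) : Module k (LSum N i) :=
  inferInstanceAs (Module k (⨁ p : LIdx n i, LSummand N p))
instance (N : CochainComplex (GrE k n) ℤ) (i : ℤ) : Module (Sym k n) (LSum N i) :=
  inferInstanceAs (Module (Sym k n) (⨁ p : LIdx n i, LSummand N p))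
instance (N : CochainComplex (GrE k n) ℤ) (i : ℤ) : IsScalarTower k (Sym k n) (LSum N i) :=
  inferInstanceAs (IsScalarTower k (Sym k n) (⨁ p : LIdx n i, LSummand N p))

/-- The grading of `LSum N i`. -/
def LSumGr (N : CochainComplex (GrE k n) ℤ) (i : ℤ) :
    (Fin n → ℤ) → Submodule k (LSum N i) := sumGr (fun p : LIdx n i => LSummandGr N p)

/-- The component of cohomological degree `i` of `L(N)`, the direct sum of the modules
`S(-1) ⊗_k N^j_a` with `j - ||a|| = i`. -/
def LX (N : ComB (GrE k n)) (i : ℤ) : GrS k n where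
  carrier := LSum N.obj i
  gr := LSumGr N.obj i
  isInternal := sumGr_isInternal _ fun p => SymTensor.gr_isInternal p.1.2
  smul_mem hr hm p := SymTensor.smul_mem_gr hr (hm p)
  finite := by
    refine finite_directSum (LSummand N.obj (i := i)) ?_
    refine ((finite_LSummand N).preimage (f := (Subtype.val : LIdx n i → _))
      Subtype.val_injective.injOn).subset fun p hp => fun hs => hp ?_
    infer_instance

/-- The inclusion of the summand `S(-1) ⊗_k N^j_a`. -/
def Llof (N : CochainComplex (GrE k n) ℤ) {i : ℤ} (j : ℤ) (a : Fin n → ℤ) (h : j - deg a = i) :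
    SymTensor k n ((N.X j).gr a) →ₗ[Sym k n] LSum N i :=
  DirectSum.lof (Sym k n) (LIdx n i) (LSummand N) ⟨(j, a), h⟩

/-- The linear map on the direct sum given by linear maps on the summands. -/
def Ldesc (N : CochainComplex (GrE k n) ℤ) {i : ℤ} {Y : Type u} [AddCommGroup Y]
    [Module (Sym k n) Y]
    (φ : ∀ (j : ℤ) (a : Fin n → ℤ), j - deg a = i → SymTensor k n ((N.X j).gr a) →ₗ[Sym k n] Y) :
    LSum N i →ₗ[Sym k n] Y :=
  DirectSum.toModule (Sym k n) (LIdx n i) Y fun p => φ p.1.1 p.1.2 p.2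

theorem Ldesc_lof (N : CochainComplex (GrE k n) ℤ) {i : ℤ} {Y : Type u} [AddCommGroup Y]
    [Module (Sym k n) Y]
    (φ : ∀ (j : ℤ) (a : Fin n → ℤ), j - deg a = i → SymTensor k n ((N.X j).gr a) →ₗ[Sym k n] Y)
    (j : ℤ) (a : Fin n → ℤ) (hp : j - deg a = i) (z : SymTensor k n ((N.X j).gr a)) :
    Ldesc N φ (Llof N j a hp z) = φ j a hp z :=
  DirectSum.toModule_lof (Sym k n) (φ := fun p : LIdx n i => φ p.1.1 p.1.2 p.2) ⟨(j, a), hp⟩ z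

/-- The differential of `L(N)`, on the component of cohomological degree `i`: an element
`s ⊗ y ∈ S(-1) ⊗_k N^j_a` is mapped to `∑_l x_l s ⊗ e_l y + (-1)^i (s ⊗ δ^j(y))`. -/
def LdLin (N : CochainComplex (GrE k n) ℤ) (i i' : ℤ) (h : i + 1 = i') :
    LSum N i →ₗ[Sym k n] LSum N i' :=
  Ldesc N fun j a hp =>
    (∑ l : Fin n, Llof N j (a - ε l) (LIdx.down hp h l) ∘ₗ
      SymTensor.map (x k l) (grSmul (N.X j) (e_mem k l) (neg_add_eq_sub (ε l) a))) +
    (i.negOnePow : ℤ) • (Llof N (j + 1) a (LIdx.right hp h) ∘ₗ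
      SymTensor.map 1 (grMap (N.d j (j + 1)) a))

theorem LdLin_lof (N : CochainComplex (GrE k n) ℤ) (i i' : ℤ) (h : i + 1 = i') (j : ℤ)
    (a : Fin n → ℤ) (hp : j - deg a = i) (s : Sym k n) (y : (N.X j).gr a) :
    LdLin N i i' h (Llof N j a hp (SymTensor.tmul s y)) =
      (∑ l : Fin n, Llof N j (a - ε l) (LIdx.down hp h l)
        (SymTensor.tmul (x k l * s) (grSmul (N.X j) (e_mem k l) (neg_add_eq_sub (ε l) a) y))) +
      (i.negOnePow : ℤ) • (Llof N (j + 1) a (LIdx.right hp h)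
        (SymTensor.tmul s (grMap (N.d j (j + 1)) a y))) := by
  rw [LdLin, Ldesc_lof, LinearMap.add_apply, LinearMap.sum_apply, LinearMap.smul_apply]
  simp only [LinearMap.comp_apply, SymTensor.map_tmul, one_mul]

theorem Llof_congr (N : CochainComplex (GrE k n) ℤ) {i j : ℤ} {a a' : Fin n → ℤ} (h : a = a')
    (hp : j - deg a = i) (hp' : j - deg a' = i) (s s' : Sym k n) (hs : s = s') (y : (N.X j).gr a)
    (y' : (N.X j).gr a') (hy : (y : N.X j) = y') :
    Llof N j a hp (SymTensor.tmul s y) = Llof N j a' hp' (SymTensor.tmul s' y') := by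
  subst h hs
  rw [Subtype.ext hy]

theorem Llof_eq_zero (N : CochainComplex (GrE k n) ℤ) {i j : ℤ} {a : Fin n → ℤ}
    (hp : j - deg a = i) (s : Sym k n) (y : (N.X j).gr a) (hy : (y : N.X j) = 0) :
    Llof N j a hp (SymTensor.tmul s y) = 0 := by
  have : y = 0 := Subtype.ext hy
  rw [this, SymTensor.tmul_zero, map_zero]

theorem Lhom_ext (N : CochainComplex (GrE k n) ℤ) {i : ℤ} {Y : Type*} [AddCommGroup Y]
    [Module (Sym k n) Y] {φ ψ : LSum N i →ₗ[Sym k n] Y}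
    (h : ∀ j a hp s y, φ (Llof N j a hp (SymTensor.tmul s y)) = ψ (Llof N j a hp (SymTensor.tmul s y))) : φ = ψ :=
  DirectSum.linearMap_ext _ fun p => SymTensor.linearMap_ext fun s y => h p.1.1 p.1.2 p.2 s y

theorem LdLin_LdLin (N : CochainComplex (GrE k n) ℤ) (i i' i'' : ℤ) (h : i + 1 = i')
    (h' : i' + 1 = i'') (F : LSum N i) :
    LdLin N i' i'' h' (LdLin N i i' h F) = 0 := by
  suffices LdLin N i' i'' h' ∘ₗ LdLin N i i' h = 0 from LinearMap.congr_fun this F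
  refine Lhom_ext N fun j a hp s y => ?_
  rw [LinearMap.comp_apply, LdLin_lof, map_add, map_sum, map_zsmul, LdLin_lof]
  simp only [LdLin_lof, Finset.sum_add_distrib, smul_add, Finset.smul_sum]
  have h1 : ∑ t : Fin n, ∑ t' : Fin n,
      Llof N j (a - ε t - ε t') (LIdx.down (LIdx.down hp h t) h' t')
        (SymTensor.tmul (x k t' * (x k t * s))
          (grSmul (N.X j) (e_mem k t') (neg_add_eq_sub (ε t') (a - ε t))
          (grSmul (N.X j) (e_mem k t) (neg_add_eq_sub (ε t) a) y))) = 0 := by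
    refine sum_sum_eq_zero (σ := Fin n) (fun t t' =>
      Llof N j (a - ε t - ε t') (LIdx.down (LIdx.down hp h t) h' t')
        (SymTensor.tmul (x k t' * (x k t * s))
          (grSmul (N.X j) (e_mem k t') (neg_add_eq_sub (ε t') (a - ε t))
          (grSmul (N.X j) (e_mem k t) (neg_add_eq_sub (ε t) a) y))))
      (fun t t' => ?_) (fun t => ?_)
    · rw [add_eq_zero_iff_eq_neg, ← map_neg, ← SymTensor.tmul_neg]
      refine Llof_congr N (sub_right_comm _ _ _) _ _ _ _ (mul_left_comm _ _ _) _ _ ?_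
      rw [Submodule.coe_neg]
      simp only [coe_grSmul]
      rw [← mul_smul, ← mul_smul, ← neg_smul, ← eq_neg_of_add_eq_zero_left (e_mul_add_swap k t' t)]
    · refine Llof_eq_zero N _ _ _ ?_
      simp only [coe_grSmul]
      rw [← mul_smul, e_mul_self, zero_smul]
  have h2 : Llof N (j + 1 + 1) a (LIdx.right (LIdx.right hp h) h')
      (SymTensor.tmul s (grMap (N.d (j + 1) (j + 1 + 1)) a (grMap (N.d j (j + 1)) a y))) = 0 :=
    Llof_eq_zero N _ _ _ (lin_d_d N _ _ _ _)
  have h3 : ∀ t : Fin n, Llof N (j + 1) (a - ε t) (LIdx.down (LIdx.right hp h) h' t)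
      (SymTensor.tmul (x k t * s) (grSmul (N.X (j + 1)) (e_mem k t) (neg_add_eq_sub (ε t) a)
        (grMap (N.d j (j + 1)) a y))) =
      Llof N (j + 1) (a - ε t) (LIdx.right (LIdx.down hp h t) h')
      (SymTensor.tmul (x k t * s) (grMap (N.d j (j + 1)) (a - ε t)
        (grSmul (N.X j) (e_mem k t) (neg_add_eq_sub (ε t) a) y))) := by
    intro t
    refine Llof_congr N rfl _ _ _ _ rfl _ _ ?_
    exact (((N.d j (j + 1)).lin).map_smul (e k t) _).symm
  have h4 : (i'.negOnePow : ℤ) = -(i.negOnePow : ℤ) := by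
    rw [← h, Int.negOnePow_succ, Units.val_neg]
  rw [h1, h2, Finset.sum_congr rfl fun t _ => congrArg _ (h3 t)]
  simp only [smul_zero, add_zero, zero_add, h4, neg_smul, Finset.sum_neg_distrib]
  exact neg_add_cancel _

theorem LdLin_mem (N : CochainComplex (GrE k n) ℤ) (i i' : ℤ) (h : i + 1 = i') (b : Fin n → ℤ)
    (F : LSum N i)
    (hF : F ∈ LSumGr N i b) :
    LdLin N i i' h F ∈ LSumGr N i' b := by
  have hl : ∀ j a hp z, z ∈ SymTensor.gr k n ((N.X j).gr a) a b →
      Llof N j a hp z ∈ LSumGr N i' b := fun j a hp z hz =>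
    lof_mem_sumGr (R := Sym k n) (fun p : LIdx n i' => LSummandGr N p) b ⟨(j, a), hp⟩ hz
  refine toModule_mem _ _ b _ (fun p z hz => ?_) F hF
  rw [LinearMap.add_apply, LinearMap.sum_apply, LinearMap.smul_apply]
  refine add_mem (Submodule.sum_mem _ fun l _ => ?_) (zsmul_mem' _ _ ?_)
  · exact hl _ _ _ _ (SymTensor.map_mem_gr (x_mem k l) _ hz)
  · exact hl _ _ _ _ (SymTensor.map_one_mem_gr _ hz)

/-- The differential of `L(N)`. -/
def Ld (N : ComB (GrE k n)) (i i' : ℤ) : LX N i ⟶ LX N i' :=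
  if h : i + 1 = i' then ⟨LdLin N.obj i i' h, LdLin_mem N.obj i i' h⟩ else 0

theorem Ld_eq (N : ComB (GrE k n)) (i i' : ℤ) (h : i + 1 = i') :
    Ld N i i' = ⟨LdLin N.obj i i' h, LdLin_mem N.obj i i' h⟩ := dif_pos h

/-- The complex `L(N)`. -/
def LObj (N : ComB (GrE k n)) : CochainComplex (GrS k n) ℤ where
  X := LX N
  d := Ld N
  shape _ _ h := dif_neg h
  d_comp_d' i i' i'' h h' :=
    (congrArg₂ (· ≫ ·) (Ld_eq N i i' h) (Ld_eq N i' i'' h')).trans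
      (GrMod.hom_ext (LdLin_LdLin N.obj i i' i'' h h'))

theorem isZero_LX (N : ComB (GrE k n)) (i : ℤ)
    (h : ∀ j a, ¬ Subsingleton ((N.obj.X j).gr a) → j - deg a ≠ i) : IsZero (LX N i) := by
  have : Subsingleton (LX N i) := by
    refine ⟨fun F G => DFinsupp.ext fun p => ?_⟩
    have hp : Subsingleton ((N.obj.X p.1.1).gr p.1.2) := by
      by_contra hp
      exact h _ _ hp p.2
    have : Subsingleton (LSummand N.obj p) := inferInstance
    exact Subsingleton.elim _ _
  exact GrMod.isZero_of_subsingleton _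

theorem isBounded_LObj (N : ComB (GrE k n)) : isBounded (GrS k n) (LObj N) := by
  have hf := (finite_LSummand N).image fun p => p.1 - deg p.2
  obtain ⟨a, ha⟩ := hf.bddBelow
  obtain ⟨b, hb⟩ := hf.bddAbove
  refine ⟨a, b, ?_, ?_⟩
  · rw [CochainComplex.isStrictlyGE_iff]
    intro i hi
    refine isZero_LX N i fun j c hj h => ?_
    have := ha ⟨(j, c), hj, h⟩
    lia
  · rw [CochainComplex.isStrictlyLE_iff]
    intro i hi
    refine isZero_LX N i fun j c hj h => ?_
    have := hb ⟨(j, c), hj, h⟩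
    lia

/-- The map `L(φ)` in cohomological degree `i`, `s ⊗ y ↦ s ⊗ φ(y)`. -/
def LMapLin {N N' : CochainComplex (GrE k n) ℤ} (φ : N ⟶ N') (i : ℤ) :
    LSum N i →ₗ[Sym k n] LSum N' i :=
  DirectSum.lmap fun p => SymTensor.map 1 (grMap (φ.f p.1.1) p.1.2)

theorem LMapLin_lof {N N' : CochainComplex (GrE k n) ℤ} (φ : N ⟶ N') (i : ℤ) (j : ℤ)
    (a : Fin n → ℤ) (hp : j - deg a = i) (s : Sym k n) (y : (N.X j).gr a) :
    LMapLin φ i (Llof N j a hp (SymTensor.tmul s y)) = Llof N' j a hp (SymTensor.tmul s (grMap (φ.f j) a y)) := by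
  refine (DirectSum.lmap_lof _ _ _).trans (congrArg _ ?_)
  rw [SymTensor.map_tmul, one_mul]

theorem LMapLin_comm {N N' : CochainComplex (GrE k n) ℤ} (φ : N ⟶ N') (i i' : ℤ)
    (h : i + 1 = i') (F : LSum N i) :
    LdLin N' i i' h (LMapLin φ i F) = LMapLin φ i' (LdLin N i i' h F) := by
  suffices LdLin N' i i' h ∘ₗ LMapLin φ i = LMapLin φ i' ∘ₗ LdLin N i i' h from
    LinearMap.congr_fun this F
  refine Lhom_ext N fun j a hp s y => ?_
  rw [LinearMap.comp_apply, LinearMap.comp_apply, LdLin_lof, LMapLin_lof, LdLin_lof, map_add,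
    map_sum, map_zsmul]
  simp only [LMapLin_lof]
  refine congrArg₂ (· + ·) (Finset.sum_congr rfl fun l _ => ?_) (congrArg _ ?_)
  · exact Llof_congr N' rfl _ _ _ _ rfl _ _ (((φ.f j).lin).map_smul (e k l) _).symm
  · exact Llof_congr N' rfl _ _ _ _ rfl _ _ (lin_comm φ _ _ _)

/-- The morphism of complexes `L(φ)`. -/
def LMap {N N' : ComB (GrE k n)} (φ : N ⟶ N') : LObj N ⟶ LObj N' where
  f i := ⟨LMapLin φ.hom i, fun _ _ hF p => SymTensor.map_one_mem_gr _ (hF p)⟩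
  comm' i i' h :=
    (congrArg₂ (· ≫ ·) rfl (Ld_eq N' i i' h)).trans <|
      (GrMod.hom_ext (LMapLin_comm φ.hom i i' h)).trans
      (congrArg₂ (· ≫ ·) (Ld_eq N i i' h) rfl).symm

theorem LMapLin_id (N : CochainComplex (GrE k n) ℤ) (i : ℤ) :
    LMapLin (𝟙 N) i = LinearMap.id := by
  refine Lhom_ext N fun j a hp s y => ?_
  rw [LMapLin_lof]
  rfl

theorem LMapLin_comp {N N' N'' : CochainComplex (GrE k n) ℤ} (φ : N ⟶ N') (ψ : N' ⟶ N'') (i : ℤ) :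
    LMapLin (φ ≫ ψ) i = LMapLin ψ i ∘ₗ LMapLin φ i := by
  refine Lhom_ext N fun j a hp s y => ?_
  rw [LinearMap.comp_apply, LMapLin_lof, LMapLin_lof, LMapLin_lof]
  rfl

variable (k n) in
/-- The functor `L` from bounded complexes of graded `E`-modules to bounded complexes of graded
`S`-modules. -/
def functorL : ComB (GrE k n) ⥤ ComB (GrS k n) :=
  ObjectProperty.lift _
    { obj := LObj
      map := LMap
      map_id N := HomologicalComplex.hom_ext _ _ fun i => GrMod.Hom.ext (LMapLin_id N.obj i)
      map_comp φ ψ := HomologicalComplex.hom_ext _ _ fun i =>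
        GrMod.Hom.ext (LMapLin_comp φ.hom ψ.hom i) }
    isBounded_LObj

end L

end ZnBGG

end

noncomputable section

namespace ZnBGG

section BoundedLocalization

open Pretriangulated HomotopicalAlgebra ZeroObject

variable (C : Type*) [Category* C] [Abelian C]

/-- The objects of the bounded below homotopy category which are isomorphic to bounded
complexes. -/
def homotopyBounded : ObjectProperty (HomotopyCategory.Plus C) :=
  fun K => ∃ L : CochainComplex C ℤ, isBounded C L ∧
    Nonempty ((HomotopyCategory.quotient C (.up ℤ)).obj L ≅ K.obj)

variable {C}

theorem isStrictlyLE_mappingCone {K L : CochainComplex C ℤ} (f : K ⟶ L) (n₁ n₂ n : ℤ)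
    [K.IsStrictlyLE n₁] [L.IsStrictlyLE n₂] (hn₁ : n₁ ≤ n + 1) (hn₂ : n₂ ≤ n) :
    (CochainComplex.mappingCone f).IsStrictlyLE n := by
  rw [CochainComplex.isStrictlyLE_iff]
  intro i hi
  simp only [CochainComplex.mappingCone.isZero_X_iff]
  exact ⟨K.isZero_of_isStrictlyLE n₁ _ (by lia), L.isZero_of_isStrictlyLE n₂ _ (by lia)⟩

theorem isBounded_mappingCone {K L : CochainComplex C ℤ} (f : K ⟶ L) (hK : isBounded C K)
    (hL : isBounded C L) : isBounded C (CochainComplex.mappingCone f) := by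
  obtain ⟨a, b, _, _⟩ := hK
  obtain ⟨a', b', _, _⟩ := hL
  exact ⟨min a a' - 1, max b b',
    CochainComplex.isStrictlyGE_mappingCone f a a' _ (by lia) (by lia),
    isStrictlyLE_mappingCone f b b' _ (by lia) (by lia)⟩

theorem isBounded_cylinder (K : CochainComplex C ℤ) (hK : isBounded C K) :
    isBounded C (HomologicalComplex.cylinder K) := by
  obtain ⟨a, b, _, _⟩ := hK
  have h : ∀ i, IsZero (K.X i) → (∀ j, (ComplexShape.up ℤ).Rel i j → IsZero (K.X j)) →
      IsZero ((HomologicalComplex.cylinder K).X i) := by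
    intro i hi hi'
    dsimp [HomologicalComplex.cylinder]
    refine HomologicalComplex.homotopyCofiber.isZero_X _ _ ?_ hi'
    refine IsZero.of_iso ?_ ((HomologicalComplex.eval C (.up ℤ) i).mapBiprod _ _)
    simpa using hi
  refine ⟨a - 1, b, ?_, ?_⟩
  · rw [CochainComplex.isStrictlyGE_iff]
    intro i hi
    refine h i (K.isZero_of_isStrictlyGE a i (by lia)) fun j hj => ?_
    have : i + 1 = j := hj
    exact K.isZero_of_isStrictlyGE a j (by lia)
  · rw [CochainComplex.isStrictlyLE_iff]
    intro i hi
    refine h i (K.isZero_of_isStrictlyLE b i (by lia)) fun j hj => ?_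
    have : i + 1 = j := hj
    exact K.isZero_of_isStrictlyLE b j (by lia)

theorem isBounded_shift (K : CochainComplex C ℤ) (hK : isBounded C K) (n : ℤ) :
    isBounded C (K⟦n⟧) := by
  obtain ⟨a, b, _, _⟩ := hK
  exact ⟨a - n, b - n, K.isStrictlyGE_shift a n _ (by lia), K.isStrictlyLE_shift b n _ (by lia)⟩

instance : (isBounded C).IsStableUnderShift ℤ where
  isStableUnderShiftBy n := ⟨fun K hK => isBounded_shift K hK n⟩

theorem homotopyBounded_quotient (K : CochainComplex.Plus C) (hK : isBounded C K.obj) :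
    homotopyBounded C ((HomotopyCategory.Plus.quotient C).obj K) :=
  ⟨K.obj, hK, ⟨Iso.refl _⟩⟩

instance : (homotopyBounded C).ContainsZero where
  exists_zero := by
    refine ⟨(HomotopyCategory.Plus.quotient C).obj ⟨0, 0, inferInstance⟩, ?_,
      homotopyBounded_quotient _ ⟨0, 0, inferInstance, inferInstance⟩⟩
    rw [IsZero.iff_id_eq_zero]
    ext
    exact (Functor.map_isZero (HomotopyCategory.quotient C (.up ℤ)) (isZero_zero _)).eq_of_src _ _

instance : (homotopyBounded C).IsStableUnderShift ℤ where
  isStableUnderShiftBy n :=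
    { le_shift := by
        rintro K ⟨L, hL, ⟨e⟩⟩
        exact ⟨L⟦n⟧, isBounded_shift L hL n,
          ⟨((HomotopyCategory.quotient C (.up ℤ)).commShiftIso n).app L ≪≫
            (shiftFunctor _ n).mapIso e ≪≫
            ((HomotopyCategory.Plus.ι C).commShiftIso n).symm.app K⟩⟩ }

instance : (homotopyBounded C).IsTriangulatedClosed₃ where
  ext₃' T hT := by
    rintro ⟨K, hK, ⟨e⟩⟩ ⟨L, hL, ⟨e'⟩⟩
    obtain ⟨f, hf⟩ := (HomotopyCategory.quotient _ _).map_surjective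
      (e.hom ≫ T.mor₁.hom ≫ e'.inv)
    refine ObjectProperty.le_isoClosure _ _
      ⟨_, isBounded_mappingCone f hK hL, ⟨Triangle.π₃.mapIso
      (isoTriangleOfIso₁₂ _ ((HomotopyCategory.Plus.ι C).mapTriangle.obj T)
      (HomotopyCategory.mappingCone_triangleh_distinguished f)
      ((HomotopyCategory.Plus.ι C).map_distinguished _ hT) e e' ?_)⟩⟩
    refine (congrArg (· ≫ e'.hom) hf).trans ?_
    simp only [Category.assoc, Iso.inv_hom_id, Category.comp_id]
    rfl

instance : (homotopyBounded C).IsTriangulated where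
  toIsTriangulatedClosed₂ := .of_isTriangulatedClosed₃

instance : (homotopyBounded C).IsVerdierLeftLocalizing
    (HomotopyCategory.Plus.subcategoryAcyclic C) where
  fac {K L} φ hK hL := by
    obtain ⟨K', ⟨c, n, hc, hn⟩, ⟨e⟩⟩ := hK
    obtain ⟨L, rfl⟩ := HomotopyCategory.Plus.quotient_obj_surjective L
    obtain ⟨ψ, hψ⟩ := (HomotopyCategory.quotient _ _).map_surjective (X := K') (Y := L.obj)
      (e.hom ≫ φ.hom)
    have hL : L.obj.Acyclic := by
      rw [← HomotopyCategory.quotient_obj_mem_subcategoryAcyclic_iff_acyclic]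
      exact hL
    obtain ⟨a, _⟩ := L.property
    refine ⟨(HomotopyCategory.Plus.quotient C).obj ⟨L.obj.truncLE n, ⟨a, inferInstance⟩⟩,
      ObjectProperty.homMk (e.inv ≫ (HomotopyCategory.quotient _ _).map
        (inv (K'.ιTruncLE n) ≫ CochainComplex.truncLEMap ψ n)),
      (HomotopyCategory.Plus.quotient C).map (ObjectProperty.homMk (L.obj.ιTruncLE n)),
      homotopyBounded_quotient _ ⟨a, n, inferInstance, inferInstance⟩, ?_, ?_⟩
    · refine (HomotopyCategory.quotient_obj_mem_subcategoryAcyclic_iff_acyclic _).2 ?_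
      exact hL.truncLE _
    · ext
      change (e.inv ≫ (HomotopyCategory.quotient _ _).map _) ≫
        (HomotopyCategory.quotient _ _).map (L.obj.ιTruncLE n) = φ.hom
      rw [Category.assoc, ← Functor.map_comp]
      refine (Iso.inv_comp_eq e).2 (Eq.trans ?_ hψ)
      congr 1
      simp

variable (C) in
/-- The functor from bounded complexes to the bounded homotopy category. -/
def quotientB : ComB C ⥤ (homotopyBounded C).FullSubcategory :=
  ObjectProperty.lift _
    (ObjectProperty.lift _ ((isBounded C).ι ⋙ HomotopyCategory.quotient C (.up ℤ)) (by
      rintro ⟨K, a, b, h, h'⟩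
      exact (HomotopyCategory.plus_quotient_obj_iff K).2 ⟨a, h⟩))
    fun K => ⟨K.obj, K.property, ⟨Iso.refl _⟩⟩

instance : (quotientB C).EssSurj where
  mem_essImage := by
    rintro ⟨K, L, hL, ⟨e⟩⟩
    exact ⟨⟨L, hL⟩, ⟨((homotopyBounded C).ι ⋙ HomotopyCategory.Plus.ι C).preimageIso e⟩⟩

instance : (quotientB C).Full where
  map_surjective f := by
    obtain ⟨g, hg⟩ := (HomotopyCategory.quotient C (.up ℤ)).map_surjective f.hom.hom
    exact ⟨ObjectProperty.homMk g, ObjectProperty.hom_ext _ (ObjectProperty.hom_ext _ hg)⟩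

theorem quotientB_isLocalization : (quotientB C).IsLocalization
    ((HomologicalComplex.homotopyEquivalences C (.up ℤ)).inverseImage (isBounded C).ι) := by
  refine Functor.isLocalization_of_essSurj_of_full_of_exists_cylinders _ _ (fun _ _ f hf => ?_) ?_
  · rw [← isIso_iff_of_reflects_iso _ (homotopyBounded C).ι,
      ← isIso_iff_of_reflects_iso _ (HomotopyCategory.Plus.ι C)]
    rw [← HomotopyCategory.inverseImage_quotient_isomorphisms] at hf
    exact hf
  · intro K L f₀ f₁ hf
    obtain ⟨f₀, rfl⟩ := ObjectProperty.homMk_surjective f₀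
    obtain ⟨f₁, rfl⟩ := ObjectProperty.homMk_surjective f₁
    replace hf := HomotopyCategory.homotopyOfEq f₀ f₁
      (((homotopyBounded C).ι ⋙ HomotopyCategory.Plus.ι _).congr_map hf)
    exact ⟨K.obj.precylinder.toFullSubcategory (isBounded_cylinder K.obj K.property),
      Precylinder.LeftHomotopy.fullSubcategoryEquiv.symm
      { h := HomologicalComplex.cylinder.desc _ _ hf,
        h₀ := HomologicalComplex.cylinder.ι₀_desc _ _ hf,
        h₁ := HomologicalComplex.cylinder.ι₁_desc _ _ hf },
      ⟨HomologicalComplex.cylinder.homotopyEquiv _ (fun n => ⟨n - 1, by simp⟩), rfl⟩⟩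

variable (C) in
/-- The quasi-isomorphisms between bounded complexes. -/
def qisB : MorphismProperty (ComB C) :=
  (HomologicalComplex.quasiIso C (ComplexShape.up ℤ)).inverseImage (isBounded C).ι

variable [HasDerivedCategory.{w} C]

variable (C) in
/-- The functor from the bounded homotopy category to the bounded derived category. -/
def QhB : (homotopyBounded C).FullSubcategory ⥤ DerivedCategory.Bounded C :=
  ObjectProperty.lift _ ((homotopyBounded C).ι ⋙ HomotopyCategory.Plus.ι C ⋙ DerivedCategory.Qh)
    (by
      rintro ⟨K, L, hL, ⟨e⟩⟩
      exact ObjectProperty.prop_of_iso _ ((DerivedCategory.quotientCompQhIso C).symm.app L ≪≫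
        DerivedCategory.Qh.mapIso e) (bounded_Q ⟨L, hL⟩))

instance : (QB C).EssSurj where
  mem_essImage X := by
    obtain ⟨X, ⟨a, ha⟩, ⟨b, hb⟩⟩ := X
    have : X.IsGE a := ha
    have : X.IsLE b := hb
    obtain ⟨K, h, h', ⟨e⟩⟩ := DerivedCategory.exists_iso_Q_obj_of_isGE_of_isLE X a b
    exact ⟨⟨K, a, b, h, h'⟩, ⟨DerivedCategory.Bounded.ι.preimageIso e.symm⟩⟩

variable (C) in
/-- The functor `QhB` is induced by `Qh`. -/
def quotientBCompQhBIso : quotientB C ⋙ QhB C ≅ QB C :=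
  ((ObjectProperty.fullyFaithfulι _).whiskeringRight _).preimageIso
    (Functor.isoWhiskerLeft (isBounded C).ι (DerivedCategory.quotientCompQhIso C))

instance : (QhB C).EssSurj where
  mem_essImage X := ⟨(quotientB C).obj ((QB C).objPreimage X),
    ⟨(quotientBCompQhBIso C).app _ ≪≫ (QB C).objObjPreimageIso X⟩⟩

variable (C) in
/-- The inclusion of the bounded derived category in the bounded below derived category. -/
def boundedToPlus : DerivedCategory.Bounded C ⥤ DerivedCategory.Plus C :=
  ObjectProperty.ιOfLE (fun _ h => h.1)

instance : (boundedToPlus C).Full := by dsimp [boundedToPlus]; infer_instance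
instance : (boundedToPlus C).Faithful := by dsimp [boundedToPlus]; infer_instance

instance : (QhB C).IsLocalization
    ((HomotopyCategory.Plus.subcategoryAcyclic C).inverseImage (homotopyBounded C).ι).trW :=
  ((homotopyBounded C).triangulatedLocalizerMorphism
    (HomotopyCategory.Plus.subcategoryAcyclic C)).isLocalization_of_isLocalizedFullyFaithful
      (L₂ := DerivedCategory.Plus.Qh) (F := boundedToPlus C) (Iso.refl _)

theorem isIso_QB_map_iff {K L : ComB C} (f : K ⟶ L) : IsIso ((QB C).map f) ↔ qisB C f := by
  rw [← isIso_iff_of_reflects_iso _ DerivedCategory.Bounded.ι]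
  exact DerivedCategory.isIso_Q_map_iff_quasiIso C f.hom

instance QB_isLocalization : (QB C).IsLocalization (qisB C) := by
  have := quotientB_isLocalization (C := C)
  have h : (qisB C).IsInvertedBy (QB C) := fun _ _ f hf => (isIso_QB_map_iff f).2 hf
  have : (quotientB C ⋙ QhB C).IsLocalization (qisB C) := by
    refine Functor.IsLocalization.comp _ _
      ((HomologicalComplex.homotopyEquivalences C (.up ℤ)).inverseImage (isBounded C).ι)
      ((HomotopyCategory.Plus.subcategoryAcyclic C).inverseImage (homotopyBounded C).ι).trW
      (qisB C) ?_ ?_ ?_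
    · exact (MorphismProperty.IsInvertedBy.iff_of_iso _ (quotientBCompQhBIso C)).2 h
    · exact fun _ _ f hf => homotopyEquivalences_le_quasiIso _ _ _ hf
    · intro K L f hf
      let e := (quotientB C).objObjPreimageIso K
      let e' := (quotientB C).objObjPreimageIso L
      obtain ⟨g, hg⟩ := (quotientB C).map_surjective (e.hom ≫ f ≫ e'.inv)
      have hg' : Arrow.mk ((quotientB C).map g) ≅ Arrow.mk f :=
        Arrow.isoMk e e' (by simp [hg])
      refine (((qisB C).map (quotientB C)).arrow_mk_iso_iff hg').1
        (MorphismProperty.map_mem_map _ _ _ ((isIso_QB_map_iff g).1 ?_))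
      have := Localization.inverts (QhB C) _ _ hf
      refine (NatIso.isIso_map_iff (quotientBCompQhBIso C) g).1 ?_
      change IsIso ((QhB C).map ((quotientB C).map g))
      rw [hg, Functor.map_comp, Functor.map_comp]
      infer_instance
  exact Functor.IsLocalization.of_iso (qisB C) (quotientBCompQhBIso C)

end BoundedLocalization

open CochainComplex CochainComplex.HomComplex

section UnshiftCochain

variable {C : Type*} [Category* C] [Preadditive C]

/-- The tautological cochain of degree `n` from `Y⟦n⟧` to `Y`. -/
def unsh (Y : CochainComplex C ℤ) (n : ℤ) : Cochain (Y⟦n⟧) Y n :=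
  Cochain.mk fun p q h => (Y.shiftFunctorObjXIso n p q h.symm).hom

/-- The tautological cochain of degree `-n` from `Y` to `Y⟦n⟧`. -/
def tosh (Y : CochainComplex C ℤ) (n : ℤ) : Cochain Y (Y⟦n⟧) (-n) :=
  Cochain.mk fun p q h => (Y.shiftFunctorObjXIso n q p (by lia)).inv

theorem unsh_v (Y : CochainComplex C ℤ) (n p q : ℤ) (h : p + n = q) :
    (unsh Y n).v p q h = (Y.shiftFunctorObjXIso n p q h.symm).hom := rfl

theorem tosh_v (Y : CochainComplex C ℤ) (n p q : ℤ) (h : p + -n = q) :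
    (tosh Y n).v p q h = (Y.shiftFunctorObjXIso n q p (by lia)).inv := rfl

theorem unsh_eq (Y : CochainComplex C ℤ) (n : ℤ) :
    unsh Y n = (Cochain.ofHom (𝟙 (Y⟦n⟧))).rightUnshift n (zero_add n) := by
  ext p q h
  rw [unsh_v, Cochain.rightUnshift_v _ _ _ p q h p (by lia)]
  simp

theorem δ_unsh (Y : CochainComplex C ℤ) (n m : ℤ) : δ n m (unsh Y n) = 0 := by
  by_cases h : n + 1 = m
  · rw [unsh_eq, Cochain.δ_rightUnshift _ _ _ m 1 (by lia)]
    simp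
  · exact δ_shape _ _ h _

theorem unsh_tosh (Y : CochainComplex C ℤ) (n : ℤ) :
    (unsh Y n).comp (tosh Y n) (add_neg_cancel n) = Cochain.ofHom (𝟙 _) := by
  ext p
  rw [Cochain.comp_v _ _ _ p (p + n) p rfl (by lia), unsh_v, tosh_v]
  simp

theorem tosh_unsh (Y : CochainComplex C ℤ) (n : ℤ) :
    (tosh Y n).comp (unsh Y n) (neg_add_cancel n) = Cochain.ofHom (𝟙 _) := by
  ext p
  rw [Cochain.comp_v _ _ _ p (p + -n) p rfl (by lia), unsh_v, tosh_v]
  simp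

theorem map_unsh {X Y : CochainComplex C ℤ} (f : X ⟶ Y) (n : ℤ) :
    (Cochain.ofHom (f⟦n⟧')).comp (unsh Y n) (zero_add n) =
      (unsh X n).comp (Cochain.ofHom f) (add_zero n) := by
  ext p q rfl
  simp [unsh_v, shiftFunctorObjXIso]

theorem unsh_zero (Y : CochainComplex C ℤ) :
    unsh Y 0 = Cochain.ofHom ((shiftFunctorZero _ ℤ).hom.app Y) := by
  ext p
  simp [unsh_v, shiftFunctorZero_hom_app_f, shiftFunctorObjXIso]

theorem unsh_add (Y : CochainComplex C ℤ) (a b : ℤ) :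
    unsh Y (a + b) = (Cochain.ofHom ((shiftFunctorAdd _ a b).hom.app Y)).comp
      ((unsh (Y⟦a⟧) b).comp (unsh Y a) (add_comm b a)) (zero_add _) := by
  ext p q h
  rw [Cochain.zero_cochain_comp_v, Cochain.ofHom_v, Cochain.comp_v _ _ _ p (p + b) q rfl (by lia)]
  simp [unsh_v, shiftFunctorAdd_hom_app_f, shiftFunctorObjXIso]

theorem eq_of_comp_unsh {X Y : CochainComplex C ℤ} {n : ℤ} {f g : X ⟶ Y⟦n⟧}
    (h : (Cochain.ofHom f).comp (unsh Y n) (zero_add n) =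
      (Cochain.ofHom g).comp (unsh Y n) (zero_add n)) : f = g := by
  refine Cochain.ofHom_injective ?_
  have := congrArg (fun z => Cochain.comp z (tosh Y n) (add_neg_cancel n)) h
  simpa only [Cochain.comp_assoc_of_first_is_zero_cochain, unsh_tosh, Cochain.comp_id] using this

end UnshiftCochain

section BoundedShift

variable {C : Type*} [Category* C] [Abelian C]

/-- The underlying complex of a shifted bounded complex. -/
def shιIso (n : ℤ) (K : ComB C) : (K⟦n⟧).obj ≅ K.obj⟦n⟧ := ((isBounded C).ι.commShiftIso n).app K

theorem shιIso_naturality (n : ℤ) {K L : ComB C} (f : K ⟶ L) :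
    (f⟦n⟧').hom ≫ (shιIso n L).hom = (shιIso n K).hom ≫ f.hom⟦n⟧' :=
  (isBounded C).ι.commShiftIso_hom_naturality f n

theorem shιIso_zero (K : ComB C) : (shιIso 0 K).hom ≫ (shiftFunctorZero _ ℤ).hom.app K.obj =
    ((shiftFunctorZero _ ℤ).hom.app K).hom := by
  dsimp [shιIso]
  rw [Functor.commShiftIso_zero]
  simp

theorem shιIso_add (K : ComB C) (a b : ℤ) :
    (shιIso (a + b) K).hom ≫ (shiftFunctorAdd _ a b).hom.app K.obj =
      ((shiftFunctorAdd _ a b).hom.app K).hom ≫ (shιIso b (K⟦a⟧)).hom ≫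
        (shιIso a K).hom⟦b⟧' := by
  dsimp [shιIso]
  rw [Functor.commShiftIso_add]
  simp

/-- The tautological cochain of degree `n` from the bounded complex `K⟦n⟧` to `K`. -/
def unshB (K : ComB C) (n : ℤ) : Cochain (K⟦n⟧).obj K.obj n :=
  (Cochain.ofHom (shιIso n K).hom).comp (unsh K.obj n) (zero_add n)

/-- The tautological cochain of degree `-n` from the bounded complex `K` to `K⟦n⟧`. -/
def toshB (K : ComB C) (n : ℤ) : Cochain K.obj (K⟦n⟧).obj (-n) :=
  (tosh K.obj n).comp (Cochain.ofHom (shιIso n K).inv) (add_zero _)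

theorem δ_unshB (K : ComB C) (n m : ℤ) : δ n m (unshB K n) = 0 := by
  by_cases h : n + 1 = m
  · rw [unshB, δ_ofHom_comp, δ_unsh, Cochain.comp_zero]
  · exact δ_shape _ _ h _

theorem unshB_toshB (K : ComB C) (n : ℤ) :
    (unshB K n).comp (toshB K n) (add_neg_cancel n) = Cochain.ofHom (𝟙 _) := by
  rw [unshB, toshB, Cochain.comp_assoc_of_first_is_zero_cochain,
    ← Cochain.comp_assoc_of_third_is_zero_cochain, unsh_tosh, ← Cochain.ofHom_comp,
    ← Cochain.ofHom_comp, Category.id_comp, Iso.hom_inv_id]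

theorem toshB_unshB (K : ComB C) (n : ℤ) :
    (toshB K n).comp (unshB K n) (neg_add_cancel n) = Cochain.ofHom (𝟙 _) := by
  rw [unshB, toshB, Cochain.comp_assoc_of_second_is_zero_cochain,
    ← Cochain.comp_assoc_of_first_is_zero_cochain, ← Cochain.ofHom_comp, Iso.inv_hom_id,
    Cochain.id_comp, tosh_unsh]

theorem map_unshB {K L : ComB C} (f : K ⟶ L) (n : ℤ) :
    (Cochain.ofHom (f⟦n⟧').hom).comp (unshB L n) (zero_add n) =
      (unshB K n).comp (Cochain.ofHom f.hom) (add_zero n) := by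
  rw [unshB, unshB, ← Cochain.comp_assoc_of_first_is_zero_cochain, ← Cochain.ofHom_comp,
    shιIso_naturality, Cochain.ofHom_comp, Cochain.comp_assoc_of_first_is_zero_cochain,
    Cochain.comp_assoc_of_first_is_zero_cochain, ← map_unsh]

theorem unshB_zero (K : ComB C) :
    unshB K 0 = Cochain.ofHom ((shiftFunctorZero _ ℤ).hom.app K).hom := by
  rw [unshB, unsh_zero, ← Cochain.ofHom_comp, shιIso_zero]

theorem unshB_add (K : ComB C) (a b : ℤ) :
    unshB K (a + b) = (Cochain.ofHom ((shiftFunctorAdd _ a b).hom.app K).hom).comp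
      ((unshB (K⟦a⟧) b).comp (unshB K a) (add_comm b a)) (zero_add _) := by
  have h : (unsh (K⟦a⟧).obj b).comp (unshB K a) (add_comm b a) =
      (Cochain.ofHom ((shιIso a K).hom⟦b⟧')).comp
        ((unsh (K.obj⟦a⟧) b).comp (unsh K.obj a) (add_comm b a)) (zero_add _) := by
    rw [unshB, ← Cochain.comp_assoc_of_first_is_zero_cochain, map_unsh,
      Cochain.comp_assoc_of_second_is_zero_cochain]
  rw [unshB, unshB, unsh_add, Cochain.comp_assoc_of_first_is_zero_cochain, h,
    ← Cochain.comp_assoc_of_first_is_zero_cochain, ← Cochain.ofHom_comp, shιIso_add,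
    Cochain.ofHom_comp, Cochain.ofHom_comp, Cochain.comp_assoc_of_first_is_zero_cochain,
    Cochain.comp_assoc_of_first_is_zero_cochain]

end BoundedShift

section DGFunctor

variable {C : Type*} [Category* C] [Abelian C] {D : Type*} [Category* D] [Abelian D]

/-- The extension of a functor to cochains of all degrees, compatibly with composition and
differentials. -/
structure DGFunctor (F : ComB C ⥤ CochainComplex D ℤ) where
  map {K L : ComB C} {n : ℤ} : Cochain K.obj L.obj n →+ Cochain (F.obj K) (F.obj L) n
  map_ofHom {K L : ComB C} (f : K ⟶ L) : map (Cochain.ofHom f.hom) = Cochain.ofHom (F.map f)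
  map_comp {K L M : ComB C} {a b c : ℤ} (z : Cochain K.obj L.obj a) (z' : Cochain L.obj M.obj b)
    (h : a + b = c) : map (z.comp z' h) = (map z).comp (map z') h
  map_δ {K L : ComB C} {n m : ℤ} (h : n + 1 = m) (z : Cochain K.obj L.obj n) :
    map (δ n m z) = δ n m (map z)

namespace DGFunctor

variable {F : ComB C ⥤ CochainComplex D ℤ} (Φ : DGFunctor F)

theorem map_id (K : ComB C) : Φ.map (Cochain.ofHom (𝟙 K.obj)) = Cochain.ofHom (𝟙 (F.obj K)) := by
  rw [← F.map_id, ← Φ.map_ofHom]; rfl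

/-- A morphism to the shifted complex from a cocycle. -/
def homShift {X Y : CochainComplex D ℤ} {n : ℤ} (z : Cochain X Y n) (hz : δ n (n + 1) z = 0) :
    X ⟶ Y⟦n⟧ :=
  Cocycle.homOf ((Cocycle.mk z _ rfl hz).rightShift n 0 (zero_add n))

theorem homShift_unsh {X Y : CochainComplex D ℤ} {n : ℤ} (z : Cochain X Y n)
    (hz : δ n (n + 1) z = 0) :
    (Cochain.ofHom (homShift z hz)).comp (unsh Y n) (zero_add n) = z := by
  ext p q h
  simp only [homShift, Cocycle.cochain_ofHom_homOf_eq_coe, Cocycle.rightShift_coe, Cocycle.mk_coe]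
  rw [Cochain.zero_cochain_comp_v, Cochain.rightShift_v _ n 0 _ p p _ q h, unsh_v]
  exact (Category.assoc _ _ _).trans
    ((congrArg (_ ≫ ·) (Iso.inv_hom_id _)).trans (Category.comp_id _))

theorem ofHom_homShift {X Y : CochainComplex D ℤ} {n : ℤ} (z : Cochain X Y n)
    (hz : δ n (n + 1) z = 0) :
    Cochain.ofHom (homShift z hz) = z.comp (tosh Y n) (add_neg_cancel n) := by
  conv_rhs => rw [← homShift_unsh z hz]
  rw [Cochain.comp_assoc_of_first_is_zero_cochain, unsh_tosh, Cochain.comp_id]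

/-- The compatibility of a DG functor with the shift by `n`. -/
def shiftHom (n : ℤ) (K : ComB C) : F.obj (K⟦n⟧) ⟶ (F.obj K)⟦n⟧ :=
  homShift (Φ.map (unshB K n)) (by rw [← Φ.map_δ rfl, δ_unshB, _root_.map_zero])

theorem shiftHom_unsh (n : ℤ) (K : ComB C) :
    (Cochain.ofHom (Φ.shiftHom n K)).comp (unsh _ n) (zero_add n) = Φ.map (unshB K n) :=
  homShift_unsh _ _

theorem ofHom_shiftHom (n : ℤ) (K : ComB C) :
    Cochain.ofHom (Φ.shiftHom n K) = (Φ.map (unshB K n)).comp (tosh _ n) (add_neg_cancel n) :=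
  ofHom_homShift _ _

theorem isIso_of_cochain {X Y : CochainComplex D ℤ} (f : X ⟶ Y) (z : Cochain Y X 0)
    (h : (Cochain.ofHom f).comp z (zero_add 0) = Cochain.ofHom (𝟙 _))
    (h' : z.comp (Cochain.ofHom f) (zero_add 0) = Cochain.ofHom (𝟙 _)) : IsIso f := by
  have : ∀ i, IsIso (f.f i) := fun i => ⟨z.v i i (add_zero i), by
    simpa using Cochain.congr_v h i i (add_zero i),
    by simpa using Cochain.congr_v h' i i (add_zero i)⟩
  exact HomologicalComplex.Hom.isIso_of_components f

instance (n : ℤ) (K : ComB C) : IsIso (Φ.shiftHom n K) := by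
  refine isIso_of_cochain _ ((unsh _ n).comp (Φ.map (toshB K n)) (add_neg_cancel n)) ?_ ?_
  · rw [← Cochain.comp_assoc_of_first_is_zero_cochain, shiftHom_unsh, ← Φ.map_comp, unshB_toshB,
      Φ.map_id]
  · rw [ofHom_shiftHom, Cochain.comp_assoc (n₁₂ := 0) (n₂₃ := -n) (n₁₂₃ := 0) _ _ _ _
        (show -n + 0 = -n by lia) (by lia),
      ← Cochain.comp_assoc (n₁₂ := 0) (n₂₃ := 0) (n₁₂₃ := -n) _ _ _ (by lia) _ (by lia),
      ← Φ.map_comp, toshB_unshB, Φ.map_id, Cochain.id_comp, unsh_tosh]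

theorem shiftHom_naturality (n : ℤ) {K L : ComB C} (f : K ⟶ L) :
    F.map (f⟦n⟧') ≫ Φ.shiftHom n L = Φ.shiftHom n K ≫ (F.map f)⟦n⟧' := by
  refine eq_of_comp_unsh ?_
  rw [Cochain.ofHom_comp, Cochain.ofHom_comp, Cochain.comp_assoc_of_first_is_zero_cochain,
    Cochain.comp_assoc_of_first_is_zero_cochain, shiftHom_unsh, map_unsh,
    ← Cochain.comp_assoc_of_first_is_zero_cochain, shiftHom_unsh, ← Φ.map_ofHom, ← Φ.map_comp,
    ← Φ.map_ofHom, ← Φ.map_comp, map_unshB]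

theorem shiftHom_zero (K : ComB C) : Φ.shiftHom 0 K =
    F.map ((shiftFunctorZero _ ℤ).hom.app K) ≫ (shiftFunctorZero _ ℤ).inv.app (F.obj K) := by
  refine eq_of_comp_unsh ?_
  rw [shiftHom_unsh, unshB_zero, Φ.map_ofHom, unsh_zero, ← Cochain.ofHom_comp, Category.assoc,
    Iso.inv_hom_id_app]
  exact congrArg _ (Category.comp_id _).symm

theorem shiftHom_add (a b : ℤ) (K : ComB C) : Φ.shiftHom (a + b) K =
    F.map ((shiftFunctorAdd _ a b).hom.app K) ≫ Φ.shiftHom b (K⟦a⟧) ≫ (Φ.shiftHom a K)⟦b⟧' ≫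
      (shiftFunctorAdd _ a b).inv.app (F.obj K) := by
  refine eq_of_comp_unsh ?_
  rw [shiftHom_unsh, unsh_add, ← Cochain.comp_assoc_of_first_is_zero_cochain,
    ← Cochain.ofHom_comp, Category.assoc, Category.assoc, Category.assoc, Iso.inv_hom_id_app]
  erw [Category.comp_id]
  rw [Cochain.ofHom_comp, Cochain.ofHom_comp, Cochain.comp_assoc_of_first_is_zero_cochain,
    Cochain.comp_assoc_of_first_is_zero_cochain, ← Cochain.comp_assoc_of_first_is_zero_cochain
      (Cochain.ofHom ((Φ.shiftHom a K)⟦b⟧')), map_unsh, Cochain.comp_assoc_of_second_is_zero_cochain,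
    shiftHom_unsh, ← Cochain.comp_assoc_of_first_is_zero_cochain (Cochain.ofHom (Φ.shiftHom b _)),
    shiftHom_unsh, ← Φ.map_comp, ← Φ.map_ofHom, ← Φ.map_comp, unshB_add]

/-- A DG functor commutes with shifts. -/
@[reducible]
def commShift : F.CommShift ℤ where
  commShiftIso n := NatIso.ofComponents (fun K => asIso (Φ.shiftHom n K))
    fun f => Φ.shiftHom_naturality n f
  commShiftIso_zero := by
    ext K : 3
    rw [Functor.CommShift.isoZero_hom_app]
    exact Φ.shiftHom_zero K
  commShiftIso_add a b := by
    ext K : 3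
    rw [Functor.CommShift.isoAdd_hom_app]
    exact Φ.shiftHom_add a b K

open Pretriangulated

/-- The mapping cone of a morphism of bounded complexes. -/
abbrev coneB {K L : ComB C} (φ : K ⟶ L) : ComB C :=
  ⟨mappingCone φ.hom, isBounded_mappingCone _ K.property L.property⟩

variable {K L : ComB C} (φ : K ⟶ L)

/-- The inclusion in the mapping cone. -/
abbrev inrB : L ⟶ coneB φ := ObjectProperty.homMk (mappingCone.inr φ.hom)

/-- The comparison morphism from the image of a mapping cone to the mapping cone of the image. -/
def coneHom : F.obj (coneB φ) ⟶ mappingCone (F.map φ) :=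
  mappingCone.lift (F.map φ)
    (Cocycle.mk (Φ.map (K := coneB φ) (mappingCone.fst φ.hom).1) 2 rfl
      (by
        rw [← Φ.map_δ (K := coneB φ) (show (1 : ℤ) + 1 = 2 from rfl), Cocycle.δ_eq_zero,
          _root_.map_zero]))
    (Φ.map (K := coneB φ) (mappingCone.snd φ.hom)) (by
      rw [← Φ.map_δ (zero_add 1), mappingCone.δ_snd, Cocycle.mk_coe, ← Φ.map_ofHom, ← Φ.map_comp,
        _root_.map_neg]
      exact neg_add_cancel _)

theorem ofHom_coneHom : Cochain.ofHom (Φ.coneHom φ) =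
    mappingCone.liftCochain (F.map φ) (Φ.map (K := coneB φ) (mappingCone.fst φ.hom).1)
      (Φ.map (K := coneB φ) (mappingCone.snd φ.hom)) (zero_add 1) :=
  mappingCone.ofHom_lift _ _ _ _

theorem coneHom_fst : (Cochain.ofHom (Φ.coneHom φ)).comp (mappingCone.fst (F.map φ)).1 (zero_add 1)
    = Φ.map (K := coneB φ) (mappingCone.fst φ.hom).1 := by
  rw [ofHom_coneHom, mappingCone.liftCochain_fst]

theorem map_inrB_comp {M : ComB C} {a : ℤ} (z : Cochain (coneB φ).obj M.obj a) :
    (Cochain.ofHom (F.map (inrB φ))).comp (Φ.map z) (zero_add a) =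
      Φ.map (K := L) ((Cochain.ofHom (mappingCone.inr φ.hom)).comp z (zero_add a)) := by
  rw [← Φ.map_ofHom, ← Φ.map_comp]
  rfl

theorem inr_coneHom : F.map (inrB φ) ≫ Φ.coneHom φ = mappingCone.inr (F.map φ) := by
  refine Cochain.ofHom_injective ?_
  rw [Cochain.ofHom_comp, mappingCone.ext_cochain_to_iff (F.map φ) 0 1 (zero_add 1)]
  rw [Cochain.comp_assoc_of_first_is_zero_cochain, Cochain.comp_assoc_of_first_is_zero_cochain,
    coneHom_fst, ofHom_coneHom, mappingCone.liftCochain_snd, map_inrB_comp, map_inrB_comp,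
    mappingCone.inr_fst, mappingCone.inr_fst, mappingCone.inr_snd, mappingCone.inr_snd,
    _root_.map_zero, Φ.map_id]
  exact ⟨rfl, rfl⟩

instance : IsIso (Φ.coneHom φ) := by
  refine isIso_of_cochain _ (mappingCone.descCochain (F.map φ) (Φ.map (L := coneB φ)
    (mappingCone.inl φ.hom)) (Cochain.ofHom (F.map (inrB φ))) (neg_add_cancel 1)) ?_ ?_
  · rw [ofHom_coneHom, mappingCone.liftCochain_descCochain, ← Φ.map_ofHom, ← Φ.map_comp,
      ← Φ.map_comp, ← _root_.map_add]
    exact (congrArg _ (mappingCone.id φ.hom)).trans (Φ.map_id _)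
  · rw [mappingCone.ext_cochain_from_iff (F.map φ) (-1) 0 (neg_add_cancel 1)]
    constructor
    · rw [← Cochain.comp_assoc_of_third_is_zero_cochain, mappingCone.inl_descCochain,
        Cochain.comp_id, mappingCone.ext_cochain_to_iff (F.map φ) (-1) 0 (neg_add_cancel 1)]
      rw [ofHom_coneHom]
      constructor
      · rw [Cochain.comp_assoc (n₁₂ := -1) (n₂₃ := 1) (n₁₂₃ := 0) _ _ _ (by lia) (by lia) (by lia),
          mappingCone.liftCochain_fst, ← Φ.map_comp]
        simp [Φ.map_id]
      · rw [Cochain.comp_assoc_of_third_is_zero_cochain,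
          mappingCone.liftCochain_snd, ← Φ.map_comp]
        simp
    · rw [← Cochain.comp_assoc_of_third_is_zero_cochain, mappingCone.inr_descCochain,
        Cochain.comp_id, ← Cochain.ofHom_comp, inr_coneHom]

end DGFunctor
end DGFunctor

section ConeTriangle

open Pretriangulated

/-- The third morphism of the triangle attached to a mapping cone. -/
def coneδ {C : Type*} [Category* C] [Abelian C]
    {K L : CochainComplex C ℤ} (φ : K ⟶ L) : mappingCone φ ⟶ K⟦(1 : ℤ)⟧ :=
  (mappingCone.triangle φ).mor₃

theorem coneδ_unsh {C : Type*} [Category* C] [Abelian C]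
    {K L : CochainComplex C ℤ} (φ : K ⟶ L) :
    (Cochain.ofHom (coneδ φ)).comp (unsh K 1) (zero_add 1) = -(mappingCone.fst φ).1 := by
  have h : coneδ φ = DGFunctor.homShift (-(mappingCone.fst φ).1)
      (by rw [δ_neg, Cocycle.δ_eq_zero, neg_zero]) := rfl
  rw [h, DGFunctor.homShift_unsh]

variable {C : Type*} [Category* C] [Abelian C] {K L : ComB C} (φ : K ⟶ L)

/-- The third morphism of the triangle attached to a mapping cone. -/
def coneδB : DGFunctor.coneB φ ⟶ K⟦(1 : ℤ)⟧ :=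
  ObjectProperty.homMk (coneδ φ.hom ≫ (shιIso 1 K).inv)

/-- The triangle of bounded complexes attached to a mapping cone. -/
def triangleB : Triangle (ComB C) := Triangle.mk φ (DGFunctor.inrB φ) (coneδB φ)

theorem coneδB_shιIso : (coneδB φ).hom ≫ (shιIso 1 K).hom = coneδ φ.hom := by
  exact ((Category.assoc _ _ _).trans (congrArg _ (Iso.inv_hom_id _))).trans (Category.comp_id _)

theorem coneδB_unshB :
    (Cochain.ofHom (coneδB φ).hom).comp (unshB K 1) (zero_add 1) = -(mappingCone.fst φ.hom).1 := by
  rw [unshB, ← Cochain.comp_assoc_of_first_is_zero_cochain, ← Cochain.ofHom_comp,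
    ← coneδ_unsh φ.hom, coneδB_shιIso]

/-- The underlying triangle of `triangleB φ`. -/
def ιTriangleBIso : (isBounded C).ι.mapTriangle.obj (triangleB φ) ≅ mappingCone.triangle φ.hom :=
  Triangle.isoMk _ _ (Iso.refl _) (Iso.refl _) (Iso.refl _)
    ((Category.comp_id _).trans (Category.id_comp _).symm)
    ((Category.comp_id _).trans (Category.id_comp _).symm)
    ((((congrArg _ (CategoryTheory.Functor.map_id _ _)).trans (Category.comp_id _)).trans
      (coneδB_shιIso φ)).trans (Category.id_comp _).symm)

end ConeTriangle

section DGFunctor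

open Pretriangulated ZeroObject

variable {C : Type*} [Category* C] [Abelian C] {D : Type*} [Category* D] [Abelian D]

namespace DGFunctor

variable {F : ComB C ⥤ CochainComplex D ℤ} (Φ : DGFunctor F) {K L : ComB C} (φ : K ⟶ L)

theorem coneHom_coneδ : Φ.coneHom φ ≫ coneδ (F.map φ) = F.map (coneδB φ) ≫ Φ.shiftHom 1 K := by
  refine eq_of_comp_unsh ?_
  rw [Cochain.ofHom_comp, Cochain.ofHom_comp, Cochain.comp_assoc_of_first_is_zero_cochain,
    Cochain.comp_assoc_of_first_is_zero_cochain, shiftHom_unsh, coneδ_unsh,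
    Cochain.comp_neg, coneHom_fst, ← Φ.map_ofHom, ← Φ.map_comp, coneδB_unshB, _root_.map_neg]

/-- A DG functor maps the triangle of a mapping cone to the triangle of a mapping cone. -/
def mapTriangleBIso : letI := Φ.commShift
    F.mapTriangle.obj (triangleB φ) ≅ mappingCone.triangle (F.map φ) :=
  letI := Φ.commShift
  Triangle.isoMk _ _ (Iso.refl _) (Iso.refl _)
    (@asIso _ _ (F.obj (coneB φ)) (mappingCone (F.map φ)) (Φ.coneHom φ) _)
    ((Category.comp_id _).trans (Category.id_comp _).symm)
    ((Φ.inr_coneHom φ).trans (Category.id_comp _).symm)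
    (((congrArg _ (CategoryTheory.Functor.map_id _ _)).trans (Category.comp_id _)).trans
      (Φ.coneHom_coneδ φ).symm)

end DGFunctor

theorem isZero_Q_obj_iff [HasDerivedCategory.{w} D] (K : CochainComplex D ℤ) :
    IsZero (DerivedCategory.Q.obj K) ↔ K.Acyclic := by
  have h (n : ℤ) := (DerivedCategory.homologyFunctorFactors D n).app K
  constructor
  · intro hK n
    rw [HomologicalComplex.exactAt_iff_isZero_homology]
    exact ((DerivedCategory.homologyFunctor D n).map_isZero hK).of_iso (h n).symm
  · intro hK
    have : QuasiIso (0 : K ⟶ 0) := ⟨fun i => by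
      rw [quasiIsoAt_iff_exactAt _ _ (hK i)]
      exact HomologicalComplex.acyclic_of_isZero _ (isZero_zero _) i⟩
    exact (DerivedCategory.Q.map_isZero (isZero_zero _)).of_iso
      (asIso (DerivedCategory.Q.map (0 : K ⟶ 0)))

theorem quasiIso_iff_acyclic_mappingCone {K L : CochainComplex D ℤ} (f : K ⟶ L) :
    QuasiIso f ↔ (mappingCone f).Acyclic := by
  let := HasDerivedCategory.standard D
  rw [← DerivedCategory.isIso_Q_map_iff_quasiIso, ← isZero_Q_obj_iff]
  exact (Triangle.isZero₃_iff_isIso₁ _ (DerivedCategory.mappingCone_triangle_distinguished f)).symm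

theorem acyclic_of_iso {K L : CochainComplex D ℤ} (e : K ≅ L) (h : K.Acyclic) : L.Acyclic :=
  fun i => (h i).of_iso e

theorem DGFunctor.quasiIso_map {F : ComB C ⥤ CochainComplex D ℤ} (Φ : DGFunctor F)
    (hF : ∀ K : ComB C, K.obj.Acyclic → (F.obj K).Acyclic) {K L : ComB C}
    (f : K ⟶ L) (hf : qisB C f) : QuasiIso (F.map f) := by
  rw [quasiIso_iff_acyclic_mappingCone]
  refine acyclic_of_iso (asIso (Φ.coneHom f)) (hF _ ?_)
  exact (quasiIso_iff_acyclic_mappingCone f.hom).1 hf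

end DGFunctor

universe w'

section Induced

open Pretriangulated

variable {C : Type*} [Category* C] [Abelian C] {D : Type*} [Category* D] [Abelian D]

variable [HasDerivedCategory.{w} C]

instance : (QB C).CommShift ℤ := inferInstanceAs ((ObjectProperty.lift _
  ((isBounded C).ι ⋙ DerivedCategory.Q) bounded_Q).CommShift ℤ)

variable (C) in
/-- The compatibility of `QB` with `Q`. -/
def QBιIso : QB C ⋙ DerivedCategory.Bounded.ι ≅ (isBounded C).ι ⋙ DerivedCategory.Q :=
  ObjectProperty.liftCompιIso _ _ _

instance : NatTrans.CommShift (QBιIso C).hom ℤ :=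
  inferInstanceAs (NatTrans.CommShift (ObjectProperty.liftCompιIso _
    ((isBounded C).ι ⋙ DerivedCategory.Q) bounded_Q).hom ℤ)

instance : (quotientB C).mapArrow.EssSurj where
  mem_essImage f := by
    obtain ⟨g, hg⟩ := (quotientB C).map_surjective
      (((quotientB C).objObjPreimageIso f.left).hom ≫ f.hom ≫
        ((quotientB C).objObjPreimageIso f.right).inv)
    exact ⟨Arrow.mk g, ⟨Arrow.isoMk ((quotientB C).objObjPreimageIso f.left)
      ((quotientB C).objObjPreimageIso f.right)
      ((congrArg (· ≫ ((quotientB C).objObjPreimageIso f.right).hom) hg).trans (by simp; rfl)).symm⟩⟩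

instance : (QB C).mapArrow.EssSurj where
  mem_essImage f := by
    have := Localization.essSurj_mapArrow (QhB C)
      ((HomotopyCategory.Plus.subcategoryAcyclic C).inverseImage (homotopyBounded C).ι).trW
    let g := (QhB C).mapArrow.objPreimage f
    let h := (quotientB C).mapArrow.objPreimage g
    refine ⟨h, ⟨?_ ≪≫ (QhB C).mapArrow.mapIso ((quotientB C).mapArrow.objObjPreimageIso g) ≪≫
      (QhB C).mapArrow.objObjPreimageIso f⟩⟩
    exact Arrow.isoMk ((quotientBCompQhBIso C).symm.app _) ((quotientBCompQhBIso C).symm.app _)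
      ((quotientBCompQhBIso C).inv.naturality h.hom).symm

theorem QB_triangleB_distinguished {K L : ComB C} (φ : K ⟶ L) :
    (QB C).mapTriangle.obj (triangleB φ) ∈ distTriang _ := by
  rw [← Functor.map_distinguished_iff DerivedCategory.Bounded.ι]
  refine isomorphic_distinguished _ (DerivedCategory.mappingCone_triangle_distinguished φ.hom) _ ?_
  exact (Functor.mapTriangleCompIso (QB C) DerivedCategory.Bounded.ι).symm.app _ ≪≫
    (Functor.mapTriangleIso (QBιIso C)).app _ ≪≫
    (Functor.mapTriangleCompIso (isBounded C).ι DerivedCategory.Q).app _ ≪≫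
    DerivedCategory.Q.mapTriangle.mapIso (ιTriangleBIso φ)

theorem exists_iso_triangleB (T : Triangle (DerivedCategory.Bounded C)) (hT : T ∈ distTriang _) :
    ∃ (K L : ComB C) (φ : K ⟶ L), Nonempty (T ≅ (QB C).mapTriangle.obj (triangleB φ)) := by
  let f := (QB C).mapArrow.objPreimage T.mor₁
  obtain ⟨e, -⟩ := exists_iso_of_arrow_iso T _ hT (QB_triangleB_distinguished f.hom)
    ((QB C).mapArrow.objObjPreimageIso T.mor₁).symm
  exact ⟨_, _, f.hom, ⟨e⟩⟩

/-- A functor on the bounded derived category induced by a DG functor which preserves quasi-isos. -/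
theorem isTriangulated_of_DGFunctor {F : ComB C ⥤ CochainComplex D ℤ} (Φ : DGFunctor F)
    [HasDerivedCategory.{w'} D] (G : DerivedCategory.Bounded C ⥤ DerivedCategory D)
    (e : QB C ⋙ G ≅ F ⋙ DerivedCategory.Q) :
    ∃ (_ : G.CommShift ℤ), G.IsTriangulated := by
  let : F.CommShift ℤ := Φ.commShift
  let : Localization.Lifting (QB C) (qisB C) (F ⋙ DerivedCategory.Q) G := ⟨e⟩
  let : G.CommShift ℤ := Functor.commShiftOfLocalization (QB C) (qisB C) ℤ
    (F ⋙ DerivedCategory.Q) G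
  have he : NatTrans.CommShift e.hom ℤ :=
    NatTrans.commShift_iso_hom_of_localization (QB C) (qisB C) ℤ (F ⋙ DerivedCategory.Q) G
  refine ⟨inferInstance, ⟨fun T hT => ?_⟩⟩
  obtain ⟨K, L, φ, ⟨e'⟩⟩ := exists_iso_triangleB T hT
  refine isomorphic_distinguished _ (DerivedCategory.mappingCone_triangle_distinguished (F.map φ)) _
    (G.mapTriangle.mapIso e' ≪≫ (Functor.mapTriangleCompIso (QB C) G).symm.app _ ≪≫
    (Functor.mapTriangleIso e).app _ ≪≫
    (Functor.mapTriangleCompIso F DerivedCategory.Q).app _ ≪≫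
    DerivedCategory.Q.mapTriangle.mapIso (Φ.mapTriangleBIso φ))

end Induced

section Signs

theorem two_mul_choose_two (m : ℤ) : 2 * (m * (m - 1) / 2) = m * (m - 1) := by
  have := Int.even_mul_pred_self m
  exact Int.mul_ediv_cancel' this.two_dvd

/-- The sign of the action of a cochain of degree `m` in cohomological degree `i`. -/
def usign (m i : ℤ) : ℤˣ := (m * i + m * (m - 1) / 2).negOnePow

theorem usign_zero (i : ℤ) : usign 0 i = 1 := by simp [usign]

theorem usign_one (i : ℤ) : usign 1 i = i.negOnePow := by simp [usign]

theorem usign_add (m m' i : ℤ) : usign m i * usign m' (i + m) = usign (m + m') i := by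
  rw [usign, usign, usign, ← Int.negOnePow_add]
  congr 1
  have h1 := two_mul_choose_two m
  have h2 := two_mul_choose_two m'
  have h3 := two_mul_choose_two (m + m')
  linarith

theorem usign_succ_right (m i : ℤ) : usign m (i + 1) = m.negOnePow * usign m i := by
  rw [usign, usign, ← Int.negOnePow_add]
  congr 1
  ring

theorem usign_succ_left (m i : ℤ) : usign (m + 1) i = (i + m).negOnePow * usign m i := by
  rw [← usign_add, usign_one, mul_comm]

theorem usign_rel₁ {m m' i i₂ : ℤ} (hm : m + 1 = m') (h₂ : i + 1 = i₂) :
    m'.negOnePow * usign m i₂ = -usign m i := by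
  rw [← hm, ← h₂, usign_succ_right, Int.negOnePow_succ, ← mul_assoc, neg_mul,
    ← Int.negOnePow_add, neg_mul, Int.negOnePow_even _ ⟨m, rfl⟩, one_mul]

theorem usign_rel₂ {m m' i i₁ : ℤ} (hm : m + 1 = m') (h₁ : i + m = i₁) :
    usign m i * i₁.negOnePow = usign m' i := by
  rw [← hm, ← h₁, usign_succ_left, mul_comm]

theorem usign_rel₃ {m m' i i₂ : ℤ} (hm : m + 1 = m') (h₂ : i + 1 = i₂) :
    usign m' i * m'.negOnePow = m'.negOnePow * (i.negOnePow * usign m i₂) := by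
  rw [← hm, ← h₂, usign_succ_left, usign_succ_right, Int.negOnePow_add]
  ac_rfl

end Signs

section GrModLin

variable {k : Type u} [Field k] {A : Type u} [Ring A] [Algebra k A] {ι : Type v} [AddCommGroup ι]
  [DecidableEq ι] {𝒜 : ι → Submodule k A}

theorem GrMod.neg_lin {M N : GrMod 𝒜} (f : M ⟶ N) : (-f).lin = -f.lin := rfl

theorem GrMod.zsmul_lin {M N : GrMod 𝒜} (c : ℤ) (f : M ⟶ N) : (c • f).lin = c • f.lin := by
  let φ : (M ⟶ N) →+ (M →ₗ[A] N) := ⟨⟨fun f => f.lin, rfl⟩, fun _ _ => rfl⟩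
  exact map_zsmul φ c f

theorem GrMod.units_smul_lin {M N : GrMod 𝒜} (c : ℤˣ) (f : M ⟶ N) :
    (c • f).lin = (c : ℤ) • f.lin := GrMod.zsmul_lin (c : ℤ) f

theorem δ_lin {N N' : CochainComplex (GrMod 𝒜) ℤ} {m m' : ℤ} (hm : m + 1 = m')
    (z : Cochain N N' m) (j j' : ℤ) (hj : j + m' = j') (q₁ q₂ : ℤ) (h₁ : j + m = q₁)
    (h₂ : j + 1 = q₂) (y : N.X j) :
    ((δ m m' z).v j j' hj).lin y = (N'.d q₁ j').lin ((z.v j q₁ h₁).lin y) +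
      (m'.negOnePow : ℤ) • (z.v q₂ j' (by lia)).lin ((N.d j q₂).lin y) := by
  rw [δ_v m m' hm z j j' hj q₁ q₂ (by lia) h₂, GrMod.add_lin, GrMod.units_smul_lin]
  rfl

end GrModLin

variable {k : Type u} [Field k] {n : ℕ}

section L

theorem SymTensor.tmul_add {V : Type u} [AddCommGroup V] [Module k V] (s : Sym k n) (v w : V) :
    SymTensor.tmul s (v + w) = SymTensor.tmul s v + SymTensor.tmul s w :=
  TensorProduct.tmul_add (R := k) s v w

theorem SymTensor.tmul_zsmul {V : Type u} [AddCommGroup V] [Module k V] (s : Sym k n) (c : ℤ)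
    (v : V) : SymTensor.tmul s (c • v) = c • SymTensor.tmul s v :=
  map_zsmul (TensorProduct.mk k (Sym k n) V s) c v

theorem LIdx.cochain {i i' j j' m : ℤ} {a : Fin n → ℤ} (hp : j - deg a = i) (h : i + m = i')
    (hj : j + m = j') : j' - deg a = i' := by
  lia

variable {N N' N'' : CochainComplex (GrE k n) ℤ}

/-- The action of a cochain on the components of `L`. -/
def LCoLin {m : ℤ} (z : Cochain N N' m) (i i' : ℤ) (h : i + m = i') :
    LSum N i →ₗ[Sym k n] LSum N' i' :=
  Ldesc N fun j a hp => (usign m i : ℤ) • (Llof N' (j + m) a (LIdx.cochain hp h rfl) ∘ₗ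
    SymTensor.map 1 (grMap (z.v j (j + m) rfl) a))

theorem LCoLin_lof {m : ℤ} (z : Cochain N N' m) (i i' : ℤ) (h : i + m = i') (j : ℤ)
    (a : Fin n → ℤ) (hp : j - deg a = i) (s : Sym k n) (y : (N.X j).gr a) (j' : ℤ)
    (hj : j + m = j') :
    LCoLin z i i' h (Llof N j a hp (SymTensor.tmul s y)) =
      (usign m i : ℤ) • Llof N' j' a (LIdx.cochain hp h hj)
        (SymTensor.tmul s (grMap (z.v j j' hj) a y)) := by
  subst hj
  rw [LCoLin, Ldesc_lof, LinearMap.smul_apply, LinearMap.comp_apply, SymTensor.map_tmul, one_mul]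

theorem Llof_mem_LSumGr {i : ℤ} (j : ℤ) (a : Fin n → ℤ) (hp : j - deg a = i) (b : Fin n → ℤ)
    {z : SymTensor k n ((N.X j).gr a)} (hz : z ∈ SymTensor.gr k n _ a b) :
    Llof N j a hp z ∈ LSumGr N i b :=
  lof_mem_sumGr (R := Sym k n) (fun p : LIdx n i => LSummandGr N p) b ⟨(j, a), hp⟩ hz

theorem LCoLin_mem {m : ℤ} (z : Cochain N N' m) (i i' : ℤ) (h : i + m = i') (b : Fin n → ℤ)
    (F : LSum N i) (hF : F ∈ LSumGr N i b) : LCoLin z i i' h F ∈ LSumGr N' i' b := by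
  refine toModule_mem _ _ b _ (fun p z hz => ?_) F hF
  exact zsmul_mem' _ _ (Llof_mem_LSumGr _ _ _ _ (SymTensor.map_one_mem_gr _ hz))

theorem LCoLin_add {m : ℤ} (z z' : Cochain N N' m) (i i' : ℤ) (h : i + m = i') :
    LCoLin (z + z') i i' h = LCoLin z i i' h + LCoLin z' i i' h := by
  refine Lhom_ext N fun j a hp s y => ?_
  rw [LinearMap.add_apply]
  simp only [LCoLin_lof _ i i' h j a hp s y _ rfl]
  rw [← smul_add, ← map_add, ← SymTensor.tmul_add]
  rfl

theorem LCoLin_comp {m m' m'' : ℤ} (z : Cochain N N' m) (z' : Cochain N' N'' m') (h : m + m' = m'')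
    (i i' i'' : ℤ) (hi : i + m = i') (hi' : i' + m' = i'') (F : LSum N i) :
    LCoLin (z.comp z' h) i i'' (by lia) F = LCoLin z' i' i'' hi' (LCoLin z i i' hi F) := by
  suffices LCoLin (z.comp z' h) i i'' (by lia) = LCoLin z' i' i'' hi' ∘ₗ LCoLin z i i' hi from
    LinearMap.congr_fun this F
  refine Lhom_ext N fun j a hp s y => ?_
  rw [LinearMap.comp_apply, LCoLin_lof z _ _ _ _ _ _ _ _ _ rfl, map_zsmul,
    LCoLin_lof z' _ _ _ _ _ _ _ _ (j + m'') (by lia), LCoLin_lof _ _ _ _ _ _ _ _ _ _ rfl,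
    smul_smul, ← Units.val_mul,
    show usign m i * usign m' i' = usign m'' i by rw [← hi, usign_add, h]]
  refine congrArg _ (Llof_congr _ rfl _ _ _ _ rfl _ _ ?_)
  rw [coe_grMap, Cochain.comp_v z z' h j (j + m) (j + m'') rfl (by lia)]
  rfl

theorem LCoLin_ofHom (φ : N ⟶ N') (i : ℤ) : LCoLin (Cochain.ofHom φ) i i (add_zero i) =
    LMapLin φ i := by
  refine Lhom_ext N fun j a hp s y => ?_
  rw [LMapLin_lof, LCoLin_lof _ _ _ _ _ _ _ _ _ j (add_zero j), usign_zero, Cochain.ofHom_v]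
  exact one_zsmul _

theorem LCoLin_δ {m m' : ℤ} (hm : m + 1 = m') (z : Cochain N N' m) (i i' i₁ i₂ : ℤ)
    (h : i + m' = i') (h₁ : i + m = i₁) (h₂ : i + 1 = i₂) (F : LSum N i) :
    LCoLin (δ m m' z) i i' h F = LdLin N' i₁ i' (by lia) (LCoLin z i i₁ h₁ F) +
      (m'.negOnePow : ℤ) • LCoLin z i₂ i' (by lia) (LdLin N i i₂ h₂ F) := by
  suffices LCoLin (δ m m' z) i i' h = LdLin N' i₁ i' (by lia) ∘ₗ LCoLin z i i₁ h₁ +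
      (m'.negOnePow : ℤ) • LCoLin z i₂ i' (by lia) ∘ₗ LdLin N i i₂ h₂ from
    LinearMap.congr_fun this F
  refine Lhom_ext N fun j a hp s y => ?_
  rw [LinearMap.add_apply, LinearMap.smul_apply, LinearMap.comp_apply, LinearMap.comp_apply,
    LCoLin_lof _ _ _ _ _ _ _ _ _ (j + m + 1) (by lia), LCoLin_lof _ _ _ _ _ _ _ _ _ _ rfl,
    map_zsmul, LdLin_lof, LdLin_lof, map_add, map_sum, map_zsmul,
    LCoLin_lof _ _ _ _ _ _ _ _ _ (j + m + 1) (by lia)]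
  simp only [LCoLin_lof z i₂ i' _ j _ _ _ _ (j + m) rfl]
  have h3 : ∀ t : Fin n, Llof N' (j + m) (a - ε t) (LIdx.cochain (LIdx.down hp h₂ t)
        (show i₂ + m = i' by lia) rfl)
      (SymTensor.tmul (x k t * s) (grMap (z.v j (j + m) rfl) (a - ε t)
        (grSmul (N.X j) (e_mem k t) (neg_add_eq_sub (ε t) a) y))) =
      Llof N' (j + m) (a - ε t) (LIdx.down (LIdx.cochain hp h₁ rfl) (show i₁ + 1 = i' by lia) t)
      (SymTensor.tmul (x k t * s) (grSmul (N'.X (j + m)) (e_mem k t) (neg_add_eq_sub (ε t) a)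
        (grMap (z.v j (j + m) rfl) a y))) := by
    intro t
    refine Llof_congr N' rfl _ _ _ _ rfl _ _ ?_
    exact ((z.v j (j + m) rfl).lin).map_smul (e k t) _
  have h4 : grMap ((δ m m' z).v j (j + m + 1) (by lia)) a y =
      grMap (N'.d (j + m) (j + m + 1)) a (grMap (z.v j (j + m) rfl) a y) +
      (m'.negOnePow : ℤ) • grMap (z.v (j + 1) (j + m + 1) (by lia)) a
        (grMap (N.d j (j + 1)) a y) :=
    Subtype.ext (δ_lin hm z j (j + m + 1) (by lia) _ _ rfl rfl y)
  rw [h4, SymTensor.tmul_add, SymTensor.tmul_zsmul, map_add, map_zsmul]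
  simp only [Finset.sum_congr rfl fun t _ => congrArg _ (h3 t)]
  rw [← Finset.smul_sum]
  simp only [smul_add, smul_smul, ← Units.val_mul]
  rw [usign_rel₁ hm h₂, usign_rel₂ hm h₁, usign_rel₃ hm h₂, Units.val_neg, neg_smul]
  abel

variable (k n) in
/-- The functor `L` extends to cochains of all degrees. -/
def dgL : DGFunctor (functorL k n ⋙ (isBounded _).ι) where
  map {N N' m} :=
    { toFun z := Cochain.mk fun i i' h => ⟨LCoLin z i i' h, LCoLin_mem z i i' h⟩
      map_zero' := by
        ext i i' h F
        have := LCoLin_add (0 : Cochain N.obj N'.obj m) 0 i i' h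
        rw [add_zero, left_eq_add] at this
        exact LinearMap.congr_fun this F
      map_add' z z' := by
        ext i i' h F
        exact LinearMap.congr_fun (LCoLin_add z z' i i' h) F }
  map_ofHom φ := by
    ext i F
    exact LinearMap.congr_fun (LCoLin_ofHom φ.hom i) F
  map_comp z z' h := by
    ext i i' hi F
    rw [Cochain.comp_v _ _ h i (i + _) i' rfl (by lia)]
    exact LCoLin_comp z z' h i _ i' rfl (by lia) F
  map_δ {N N' m m'} hm z := by
    ext i i' hi F
    rw [δ_lin hm _ i i' hi _ _ rfl rfl]
    have e1 : ((functorL k n ⋙ (isBounded _).ι).obj N').d (i + m) i' =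
      ⟨_, LdLin_mem N'.obj (i + m) i' (by lia)⟩ := Ld_eq N' _ _ (by lia)
    have e2 : ((functorL k n ⋙ (isBounded _).ι).obj N).d i (i + 1) =
      ⟨_, LdLin_mem N.obj i (i + 1) rfl⟩ := Ld_eq N _ _ rfl
    rw [e1, e2]
    exact LCoLin_δ hm z i i' _ _ hi rfl rfl F

end L

section R

theorem RIdx.cochain {i i' j j' m : ℤ} {a : Fin n → ℤ} (hp : j + deg a = i) (h : i + m = i')
    (hj : j + m = j') : j' + deg a = i' := by
  lia

variable {M M' M'' : CochainComplex (GrS k n) ℤ}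

/-- The action of a cochain on the components of `R`. -/
def RCoLin {m : ℤ} (z : Cochain M M' m) (i i' : ℤ) (h : i + m = i') :
    RSum M i →ₗ[Ext k n] RSum M' i' :=
  Rdesc M fun j a hp => (usign m i : ℤ) • (Rlof M' (j + m) a (RIdx.cochain hp h rfl) ∘ₗ
    ExtHom.map (grMap (z.v j (j + m) rfl) a))

theorem RCoLin_lof {m : ℤ} (z : Cochain M M' m) (i i' : ℤ) (h : i + m = i') (j : ℤ)
    (a : Fin n → ℤ) (hp : j + deg a = i) (f : ExtHom k n ((M.X j).gr a)) (j' : ℤ)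
    (hj : j + m = j') :
    RCoLin z i i' h (Rlof M j a hp f) = (usign m i : ℤ) • Rlof M' j' a (RIdx.cochain hp h hj)
        (ExtHom.map (grMap (z.v j j' hj) a) f) := by
  subst hj
  rw [RCoLin, Rdesc_lof, LinearMap.smul_apply, LinearMap.comp_apply]

theorem Rlof_mem_RSumGr {i : ℤ} (j : ℤ) (a : Fin n → ℤ) (hp : j + deg a = i) (b : Fin n → ℤ)
    {f : ExtHom k n ((M.X j).gr a)} (hf : f ∈ ExtHom.gr k n _ a b) :
    Rlof M j a hp f ∈ RSumGr M i b :=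
  lof_mem_sumGr (R := Ext k n) (fun p : RIdx n i => RSummandGr M p) b ⟨(j, a), hp⟩ hf

theorem RCoLin_mem {m : ℤ} (z : Cochain M M' m) (i i' : ℤ) (h : i + m = i') (b : Fin n → ℤ)
    (F : RSum M i) (hF : F ∈ RSumGr M i b) : RCoLin z i i' h F ∈ RSumGr M' i' b := by
  refine toModule_mem _ _ b _ (fun p f hf => ?_) F hF
  exact zsmul_mem' _ _ (Rlof_mem_RSumGr _ _ _ _ (ExtHom.map_mem_gr _ hf))

theorem RCoLin_add {m : ℤ} (z z' : Cochain M M' m) (i i' : ℤ) (h : i + m = i') :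
    RCoLin (z + z') i i' h = RCoLin z i i' h + RCoLin z' i i' h := by
  refine Rhom_ext M fun j a hp f => ?_
  rw [LinearMap.add_apply]
  simp only [RCoLin_lof _ i i' h j a hp f _ rfl]
  rw [← smul_add, ← map_add]
  rfl

theorem RCoLin_comp {m m' m'' : ℤ} (z : Cochain M M' m) (z' : Cochain M' M'' m') (h : m + m' = m'')
    (i i' i'' : ℤ) (hi : i + m = i') (hi' : i' + m' = i'') (F : RSum M i) :
    RCoLin (z.comp z' h) i i'' (by lia) F = RCoLin z' i' i'' hi' (RCoLin z i i' hi F) := by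
  suffices RCoLin (z.comp z' h) i i'' (by lia) = RCoLin z' i' i'' hi' ∘ₗ RCoLin z i i' hi from
    LinearMap.congr_fun this F
  refine Rhom_ext M fun j a hp f => ?_
  rw [LinearMap.comp_apply, RCoLin_lof z _ _ _ _ _ _ _ _ rfl, map_zsmul,
    RCoLin_lof z' _ _ _ _ _ _ _ (j + m'') (by lia), RCoLin_lof _ _ _ _ _ _ _ _ _ rfl,
    smul_smul, ← Units.val_mul,
    show usign m i * usign m' i' = usign m'' i by rw [← hi, usign_add, h]]
  refine congrArg _ (Rlof_congr _ rfl _ _ _ _ fun y => ?_)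
  rw [ExtHom.map_apply, coe_grMap, Cochain.comp_v z z' h j (j + m) (j + m'') rfl (by lia)]
  rfl

theorem RCoLin_ofHom (φ : M ⟶ M') (i : ℤ) : RCoLin (Cochain.ofHom φ) i i (add_zero i) =
    RMapLin φ i := by
  refine Rhom_ext M fun j a hp f => ?_
  rw [RMapLin_lof, RCoLin_lof _ _ _ _ _ _ _ _ j (add_zero j), usign_zero, Cochain.ofHom_v]
  exact one_zsmul _

set_option maxHeartbeats 1000000 in
theorem RCoLin_δ {m m' : ℤ} (hm : m + 1 = m') (z : Cochain M M' m) (i i' i₁ i₂ : ℤ)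
    (h : i + m' = i') (h₁ : i + m = i₁) (h₂ : i + 1 = i₂) (F : RSum M i) :
    RCoLin (δ m m' z) i i' h F = RdLin M' i₁ i' (by lia) (RCoLin z i i₁ h₁ F) +
      (m'.negOnePow : ℤ) • RCoLin z i₂ i' (by lia) (RdLin M i i₂ h₂ F) := by
  suffices RCoLin (δ m m' z) i i' h = RdLin M' i₁ i' (by lia) ∘ₗ RCoLin z i i₁ h₁ +
      (m'.negOnePow : ℤ) • RCoLin z i₂ i' (by lia) ∘ₗ RdLin M i i₂ h₂ from
    LinearMap.congr_fun this F
  refine Rhom_ext M fun j a hp f => ?_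
  rw [LinearMap.add_apply, LinearMap.smul_apply, LinearMap.comp_apply, LinearMap.comp_apply,
    RCoLin_lof _ _ _ _ _ _ _ _ (j + m + 1) (by lia), RCoLin_lof _ _ _ _ _ _ _ _ _ rfl,
    map_zsmul, RdLin_lof, RdLin_lof, map_add, map_sum, map_zsmul,
    RCoLin_lof _ _ _ _ _ _ _ _ (j + m + 1) (by lia)]
  simp only [RCoLin_lof z i₂ i' _ j _ _ _ (j + m) rfl]
  have h3 : ∀ t : Fin n, Rlof M' (j + m) (a + ε t) (RIdx.cochain (RIdx.up hp h₂ t)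
        (show i₂ + m = i' by lia) rfl)
      (ExtHom.map (grMap (z.v j (j + m) rfl) (a + ε t))
        (ExtHom.map (grSmul (M.X j) (x_mem k t) (add_comm (ε t) a)) (ExtHom.pre t f))) =
      Rlof M' (j + m) (a + ε t) (RIdx.up (RIdx.cochain hp h₁ rfl) (show i₁ + 1 = i' by lia) t)
      (ExtHom.map (grSmul (M'.X (j + m)) (x_mem k t) (add_comm (ε t) a))
        (ExtHom.pre t (ExtHom.map (grMap (z.v j (j + m) rfl) a) f))) := by
    intro t
    refine Rlof_congr M' rfl _ _ _ _ fun y => ?_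
    exact ((z.v j (j + m) rfl).lin).map_smul (x k t) _
  have h4 : ExtHom.map (grMap ((δ m m' z).v j (j + m + 1) (by lia)) a) f =
      ExtHom.map (grMap (M'.d (j + m) (j + m + 1)) a)
        (ExtHom.map (grMap (z.v j (j + m) rfl) a) f) +
      (m'.negOnePow : ℤ) • ExtHom.map (grMap (z.v (j + 1) (j + m + 1) (by lia)) a)
        (ExtHom.map (grMap (M.d j (j + 1)) a) f) :=
    ExtHom.ext fun y => Subtype.ext (δ_lin hm z j (j + m + 1) (by lia) _ _ rfl rfl (f y))
  rw [h4, map_add, map_zsmul]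
  simp only [Finset.sum_congr rfl fun t _ => congrArg _ (h3 t)]
  rw [← Finset.smul_sum]
  simp only [smul_add, smul_smul, ← Units.val_mul]
  rw [usign_rel₁ hm h₂, usign_rel₂ hm h₁, usign_rel₃ hm h₂, Units.val_neg, neg_smul]
  abel

variable (k n) in
/-- The functor `R` extends to cochains of all degrees. -/
def dgR : DGFunctor (functorR k n) where
  map {M M' m} :=
    { toFun z := Cochain.mk fun i i' h => ⟨RCoLin z i i' h, RCoLin_mem z i i' h⟩
      map_zero' := by
        ext i i' h F
        have := RCoLin_add (0 : Cochain M.obj M'.obj m) 0 i i' h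
        rw [add_zero, left_eq_add] at this
        exact LinearMap.congr_fun this F
      map_add' z z' := by
        ext i i' h F
        exact LinearMap.congr_fun (RCoLin_add z z' i i' h) F }
  map_ofHom φ := by
    ext i F
    exact LinearMap.congr_fun (RCoLin_ofHom φ.hom i) F
  map_comp z z' h := by
    ext i i' hi F
    rw [Cochain.comp_v _ _ h i (i + _) i' rfl (by lia)]
    exact RCoLin_comp z z' h i _ i' rfl (by lia) F
  map_δ {M M' m m'} hm z := by
    ext i i' hi F
    rw [δ_lin hm _ i i' hi _ _ rfl rfl]
    have e1 : ((functorR k n).obj M').d (i + m) i' =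
      ⟨_, RdLin_mem M'.obj (i + m) i' (by lia)⟩ := Rd_eq M' _ _ (by lia)
    have e2 : ((functorR k n).obj M).d i (i + 1) =
      ⟨_, RdLin_mem M.obj i (i + 1) rfl⟩ := Rd_eq M _ _ rfl
    rw [e1, e2]
    exact RCoLin_δ hm z i i' _ _ hi rfl rfl F

end R

theorem exists_pseudoInverse {k V W : Type*} [Field k] [AddCommGroup V] [Module k V]
    [AddCommGroup W] [Module k W] (f : V →ₗ[k] W) :
    ∃ g : W →ₗ[k] V, ∀ v, f (g (f v)) = f v := by
  obtain ⟨r, hr⟩ := f.rangeRestrict.exists_rightInverse_of_surjective f.range_rangeRestrict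
  obtain ⟨p, hp⟩ := (LinearMap.range f).subtype.exists_leftInverse_of_injective
    (LinearMap.range f).ker_subtype
  refine ⟨r ∘ₗ p, fun v => ?_⟩
  have h1 : p (f v) = f.rangeRestrict v := LinearMap.congr_fun hp (f.rangeRestrict v)
  have h2 : f.rangeRestrict (r (f.rangeRestrict v)) = f.rangeRestrict v :=
    LinearMap.congr_fun hr (f.rangeRestrict v)
  rw [LinearMap.comp_apply, h1]
  exact congrArg Subtype.val h2

section GrModExact

variable {k : Type u} [Field k] {A : Type u} [Ring A] [Algebra k A] {ι : Type v} [AddCommGroup ι]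
  [DecidableEq ι] {𝒜 : ι → Submodule k A}

theorem GrMod.epi_of_surjective {M N : GrMod 𝒜} (f : M ⟶ N) (hf : Function.Surjective f.lin) :
    Epi f where
  left_cancellation _ _ hgh := GrMod.hom_ext fun y => by
    obtain ⟨x, rfl⟩ := hf y
    exact congrArg (fun t : M ⟶ _ => t.lin x) hgh

theorem GrMod.mono_of_injective {M N : GrMod 𝒜} (f : M ⟶ N) (hf : Function.Injective f.lin) :
    Mono f where
  right_cancellation _ _ hgh := GrMod.hom_ext fun y =>
    hf (congrArg (fun t : _ ⟶ N => t.lin y) hgh)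

variable [IsNoetherianRing A]

theorem GrMod.exact_iff (S : ShortComplex (GrMod 𝒜)) :
    S.Exact ↔ ∀ y : S.X₂, S.g.lin y = 0 → ∃ x : S.X₁, S.f.lin x = y := by
  rw [S.exact_iff_epi_kernel_lift]
  have hι : ∀ x, (kernel.ι S.g).lin ((kernel.lift S.g S.f S.zero).lin x) = S.f.lin x := fun x =>
    congrArg (fun t : S.X₁ ⟶ S.X₂ => t.lin x) (kernel.lift_ι S.g S.f S.zero)
  constructor
  · intro _ y hy
    obtain ⟨x, hx⟩ := GrMod.surjective_of_epi (kernel.lift S.g S.f S.zero)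
      ((kernel.lift S.g (GrMod.kerι S.g) (GrMod.kerι_comp _)).lin ⟨y, hy⟩)
    refine ⟨x, ?_⟩
    rw [← hι, hx]
    exact congrArg (fun t : GrMod.ker S.g ⟶ S.X₂ => t.lin ⟨y, hy⟩)
      (kernel.lift_ι S.g (GrMod.kerι S.g) (GrMod.kerι_comp _))
  · intro h
    refine GrMod.epi_of_surjective _ fun t => ?_
    obtain ⟨x, hx⟩ := h ((kernel.ι S.g).lin t)
      (congrArg (fun s : _ ⟶ S.X₃ => s.lin t) (kernel.condition S.g))
    exact ⟨x, GrMod.injective_of_mono (kernel.ι S.g) ((hι x).trans hx)⟩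

theorem GrMod.exactAt_iff (K : CochainComplex (GrMod 𝒜) ℤ) (i j l : ℤ) (hij : i + 1 = j)
    (hjl : j + 1 = l) :
    K.ExactAt j ↔ ∀ y : K.X j, (K.d j l).lin y = 0 → ∃ x : K.X i, (K.d i j).lin x = y := by
  rw [K.exactAt_iff' i j l (by simp; lia) (by simp [hjl]), GrMod.exact_iff]
  rfl

/-- An acyclic complex of graded modules has a contracting homotopy consisting of linear maps
between homogeneous components. -/
theorem exists_contraction (K : CochainComplex (GrMod 𝒜) ℤ) (hK : K.Acyclic) :
    ∃ h : ∀ (j j' : ℤ) (a : ι), (K.X j).gr a →ₗ[k] (K.X j').gr a,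
      ∀ (j j' j'' : ℤ) (_ : j' + 1 = j) (_ : j + 1 = j'') (a : ι) (y : (K.X j).gr a),
        grMap (K.d j' j) a (h j j' a y) + h j'' j a (grMap (K.d j j'') a y) = y := by
  choose g hg using fun (j j' : ℤ) (a : ι) => exists_pseudoInverse (grMap (K.d j j') a)
  refine ⟨fun j j' a => g j' j a ∘ₗ (LinearMap.id - g j (j + 1) a ∘ₗ grMap (K.d j (j + 1)) a), ?_⟩
  rintro j j' _ hj rfl a y
  have hdd : ∀ i z, grMap (K.d (j + 1) i) a (grMap (K.d j (j + 1)) a z) = 0 := fun i z =>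
    Subtype.ext (lin_d_d K j (j + 1) i z)
  simp only [LinearMap.comp_apply, LinearMap.sub_apply, LinearMap.id_apply, hdd, map_zero, sub_zero]
  set w := y - g j (j + 1) a (grMap (K.d j (j + 1)) a y)
  have hw : grMap (K.d j (j + 1)) a w = 0 := by
    rw [map_sub, hg, sub_self]
  obtain ⟨x, hx⟩ := (GrMod.exactAt_iff K j' j (j + 1) hj rfl).1 (hK j) w
    (congrArg Subtype.val hw)
  have hx' : grMap (K.d j' j) a ⟨_, proj_mem (K.X j').isInternal a x⟩ = w := by
    refine Subtype.ext ((map_proj (K.X j').isInternal (K.X j).isInternal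
      ((K.d j' j).lin.restrictScalars k) (K.d j' j).map_mem a x).trans ?_)
    rw [LinearMap.restrictScalars_apply, hx]
    exact proj_of_mem _ w.2
  rw [← hx', hg, hx']
  exact sub_add_cancel _ _

end GrModExact

theorem negOnePow_mul_self (i : ℤ) : (i.negOnePow : ℤ) * (i.negOnePow : ℤ) = 1 := by
  rw [← Units.val_mul, Int.units_mul_self, Units.val_one]

theorem exists_of_filtration {T : ℤ → Type*} [∀ i, AddCommGroup (T i)]
    (d : ∀ i j, T i →+ T j) (hd : ∀ i j l (F : T i), d j l (d i j F) = 0)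
    {i' i i'' : ℤ} (Fil : ℤ → AddSubgroup (T i)) (h : T i →+ T i') (h' : T i'' →+ T i)
    (hFil : ∀ t, ∀ F ∈ Fil t, d i' i (h F) + h' (d i i'' F) - F ∈ Fil (t - 1))
    (α : ℤ) (h₀ : ∀ F ∈ Fil α, F = 0) (m : ℕ) (F : T i) (hF : F ∈ Fil (α + m))
    (hdF : d i i'' F = 0) : ∃ G : T i', d i' i G = F := by
  induction m generalizing F with
  | zero => exact ⟨0, by rw [map_zero, h₀ F (by simpa using hF)]⟩
  | succ m ih =>
    have h1 := hFil _ F hF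
    rw [hdF, map_zero, add_zero] at h1
    obtain ⟨G, hG⟩ := ih (d i' i (h F) - F) (by
      convert h1 using 2; push_cast; ring) (by rw [map_sub, hd, hdF, sub_zero])
    exact ⟨h F - G, by rw [map_sub, hG, sub_sub_cancel]⟩

variable {k : Type u} [Field k] {n : ℕ}

section L

variable (N : CochainComplex (GrE k n) ℤ)

theorem LdLin_lof' (i i' : ℤ) (h : i + 1 = i') (j j' : ℤ) (a : Fin n → ℤ) (hp : j - deg a = i)
    (hj : j + 1 = j') (s : Sym k n) (y : (N.X j).gr a) :
    LdLin N i i' h (Llof N j a hp (SymTensor.tmul s y)) =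
      (∑ l : Fin n, Llof N j (a - ε l) (LIdx.down hp h l)
        (SymTensor.tmul (x k l * s) (grSmul (N.X j) (e_mem k l) (neg_add_eq_sub (ε l) a) y))) +
      (i.negOnePow : ℤ) • (Llof N j' a (by lia) (SymTensor.tmul s (grMap (N.d j j') a y))) := by
  subst hj
  exact LdLin_lof N i i' h j a hp s y

/-- The elements of `L(N)` in the components with `j ≤ t`. -/
def LFil (i t : ℤ) : AddSubgroup (LSum N i) :=
  AddSubgroup.closure {F | ∃ j a hp s y, j ≤ t ∧ Llof N j a hp (SymTensor.tmul s y) = F}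

theorem Llof_mem_LFil {i t : ℤ} (j : ℤ) (a : Fin n → ℤ) (hp : j - deg a = i) (s : Sym k n)
    (y : (N.X j).gr a) (hj : j ≤ t) : Llof N j a hp (SymTensor.tmul s y) ∈ LFil N i t :=
  AddSubgroup.subset_closure ⟨j, a, hp, s, y, hj, rfl⟩

theorem LSum_induction {i : ℤ} {P : LSum N i → Prop} (F : LSum N i) (zero : P 0)
    (add : ∀ F G, P F → P G → P (F + G))
    (lof : ∀ j a hp s y, P (Llof N j a hp (SymTensor.tmul s y))) : P F := by
  refine DirectSum.induction_on (β := fun p : LIdx n i => LSummand N p) F zero (fun p z => ?_) add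
  induction z using SymTensor.induction_on with
  | zero => rw [map_zero]; exact zero
  | tmul s y => exact lof p.1.1 p.1.2 p.2 s y
  | add z w hz hw => rw [map_add]; exact add _ _ hz hw

theorem mem_LFil (i t : ℤ) [N.IsStrictlyLE t] (F : LSum N i) : F ∈ LFil N i t := by
  induction F using LSum_induction with
  | zero => exact zero_mem _
  | add F G hF hG => exact add_mem hF hG
  | lof j a hp s y =>
    by_cases hj : j ≤ t
    · exact Llof_mem_LFil N j a hp s y hj
    · have := GrMod.subsingleton_of_isZero (N.isZero_of_isStrictlyLE t j (by lia))
      rw [Llof_eq_zero N _ _ _ (Subsingleton.elim _ _)]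
      exact zero_mem _

theorem eq_zero_of_mem_LFil (i t : ℤ) [N.IsStrictlyGE (t + 1)] (F : LSum N i)
    (hF : F ∈ LFil N i t) : F = 0 := by
  induction hF using AddSubgroup.closure_induction with
  | mem F hF =>
    obtain ⟨j, a, hp, s, y, hj, rfl⟩ := hF
    have := GrMod.subsingleton_of_isZero (N.isZero_of_isStrictlyGE (t + 1) j (by lia))
    exact Llof_eq_zero N _ _ _ (Subsingleton.elim _ _)
  | zero => rfl
  | add F G _ _ hF hG => rw [hF, hG, add_zero]
  | neg F _ hF => rw [hF, neg_zero]

variable {N} (h : ∀ (j j' : ℤ) (a : Fin n → ℤ), (N.X j).gr a →ₗ[k] (N.X j').gr a)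

/-- The map on `L(N)` induced by a contracting homotopy. -/
def LContr (i i' : ℤ) (hi : i' + 1 = i) : LSum N i →ₗ[Sym k n] LSum N i' :=
  Ldesc N fun j a hp => (i'.negOnePow : ℤ) • (Llof N (j - 1) a (by lia) ∘ₗ
    SymTensor.map 1 (h j (j - 1) a))

theorem LContr_lof (i i' : ℤ) (hi : i' + 1 = i) (j j' : ℤ) (a : Fin n → ℤ) (hp : j - deg a = i)
    (hj : j' + 1 = j) (s : Sym k n) (y : (N.X j).gr a) :
    LContr h i i' hi (Llof N j a hp (SymTensor.tmul s y)) =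
      (i'.negOnePow : ℤ) • Llof N j' a (by lia) (SymTensor.tmul s (h j j' a y)) := by
  obtain rfl : j' = j - 1 := by lia
  rw [LContr, Ldesc_lof, LinearMap.smul_apply, LinearMap.comp_apply, SymTensor.map_tmul, one_mul]

theorem LContr_mem
    (hh : ∀ (j j' j'' : ℤ) (_ : j' + 1 = j) (_ : j + 1 = j'') (a : Fin n → ℤ) (y : (N.X j).gr a),
      grMap (N.d j' j) a (h j j' a y) + h j'' j a (grMap (N.d j j'') a y) = y)
    (i' i i'' : ℤ) (hi : i' + 1 = i) (hi' : i + 1 = i'') (t : ℤ) (F : LSum N i)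
    (hF : F ∈ LFil N i t) :
    LdLin N i' i hi (LContr h i i' hi F) + LContr h i'' i hi' (LdLin N i i'' hi' F) - F ∈
      LFil N i (t - 1) := by
  induction hF using AddSubgroup.closure_induction with
  | mem F hF =>
    obtain ⟨j, a, hp, s, y, hj, rfl⟩ := hF
    have hj' : j - 1 + 1 = j := by lia
    have hl : Llof N j a hp (SymTensor.tmul s y) =
        Llof N j a hp (SymTensor.tmul s (grMap (N.d (j - 1) j) a (h j (j - 1) a y))) +
        Llof N j a hp (SymTensor.tmul s (h (j + 1) j a (grMap (N.d j (j + 1)) a y))) := by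
      rw [← map_add, ← SymTensor.tmul_add, hh j (j - 1) (j + 1) hj' rfl a y]
    rw [LContr_lof h i i' hi j (j - 1) a hp hj', map_zsmul, LdLin_lof' N _ _ _ _ _ _ _ hj',
      LdLin_lof, map_add, map_sum, map_zsmul, LContr_lof h i'' i hi' (j + 1) j a _ rfl,
      hl, smul_add, smul_smul, smul_smul, negOnePow_mul_self, negOnePow_mul_self, one_zsmul,
      one_zsmul, add_add_add_comm, add_sub_cancel_right]
    refine add_mem (zsmul_mem (sum_mem fun l _ => ?_) _) (sum_mem fun l _ => ?_)
    · exact Llof_mem_LFil N _ _ _ _ _ (by lia)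
    · rw [LContr_lof h i'' i hi' j (j - 1) _ _ hj']
      exact zsmul_mem (Llof_mem_LFil N _ _ _ _ _ (by lia)) _
  | zero => simp [zero_mem]
  | add F G _ _ hF hG =>
    have := add_mem hF hG
    simp only [map_add]
    convert this using 1
    abel
  | neg F _ hF =>
    have := neg_mem hF
    simp only [map_neg]
    convert this using 1
    abel

theorem acyclic_functorL (N : ComB (GrE k n)) (hN : N.obj.Acyclic) :
    ((functorL k n).obj N).obj.Acyclic := by
  intro i
  rw [GrMod.exactAt_iff _ (i - 1) i (i + 1) (by lia) rfl]
  obtain ⟨h, hh⟩ := exists_contraction N.obj hN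
  obtain ⟨α, β, hα, hβ⟩ := N.property
  intro F hF
  obtain ⟨G, hG⟩ := exists_of_filtration (T := LSum N.obj)
    (fun i j => show LSum N.obj i →+ LSum N.obj j from LinearMap.toAddMonoidHom ((LObj N).d i j).lin)
    (fun i j l F => lin_d_d (LObj N) i j l F)
    (i' := i - 1) (i := i) (i'' := i + 1) (fun t => LFil N.obj i t)
    (LContr h i (i - 1) (by lia)).toAddMonoidHom (LContr h (i + 1) i rfl).toAddMonoidHom
    (fun t F hF => by
      have := LContr_mem h hh (i - 1) i (i + 1) (by lia) rfl t F hF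
      convert this using 4
      · exact congrArg (fun f : LX N (i - 1) ⟶ LX N i => f.lin _) (Ld_eq N _ _ (by lia))
      · exact congrArg (fun f : LX N i ⟶ LX N (i + 1) => LContr h (i + 1) i rfl (f.lin F)) (Ld_eq N _ _ rfl))
    (α - 1) (fun F hF => by
      have : N.obj.IsStrictlyGE (α - 1 + 1) := by rwa [sub_add_cancel]
      exact eq_zero_of_mem_LFil N.obj i (α - 1) F hF)
    (β - (α - 1)).toNat F (by
      have : N.obj.IsStrictlyLE (α - 1 + (β - (α - 1)).toNat) :=
        N.obj.isStrictlyLE_of_le β _ (by lia)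
      exact mem_LFil N.obj i _ F) hF
  exact ⟨G, hG⟩

end L

section R

variable (M : CochainComplex (GrS k n) ℤ)

theorem RdLin_lof' (i i' : ℤ) (h : i + 1 = i') (j j' : ℤ) (a : Fin n → ℤ) (hp : j + deg a = i)
    (hj : j + 1 = j') (f : ExtHom k n ((M.X j).gr a)) :
    RdLin M i i' h (Rlof M j a hp f) =
      (∑ l : Fin n, Rlof M j (a + ε l) (RIdx.up hp h l)
        (ExtHom.map (grSmul (M.X j) (x_mem k l) (add_comm (ε l) a)) (ExtHom.pre l f))) +
      (i.negOnePow : ℤ) • (Rlof M j' a (by lia) (ExtHom.map (grMap (M.d j j') a) f)) := by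
  subst hj
  exact RdLin_lof M i i' h j a hp f

/-- The elements of `R(M)` in the components with `j ≤ t`. -/
def RFil (i t : ℤ) : AddSubgroup (RSum M i) :=
  AddSubgroup.closure {F | ∃ j a hp f, j ≤ t ∧ Rlof M j a hp f = F}

theorem Rlof_mem_RFil {i t : ℤ} (j : ℤ) (a : Fin n → ℤ) (hp : j + deg a = i)
    (f : ExtHom k n ((M.X j).gr a)) (hj : j ≤ t) : Rlof M j a hp f ∈ RFil M i t :=
  AddSubgroup.subset_closure ⟨j, a, hp, f, hj, rfl⟩

theorem RSum_induction {i : ℤ} {P : RSum M i → Prop} (F : RSum M i) (zero : P 0)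
    (add : ∀ F G, P F → P G → P (F + G)) (lof : ∀ j a hp f, P (Rlof M j a hp f)) : P F :=
  DirectSum.induction_on (β := fun p : RIdx n i => RSummand M p) F zero
    (fun p f => lof p.1.1 p.1.2 p.2 f) add

theorem mem_RFil (i t : ℤ) [M.IsStrictlyLE t] (F : RSum M i) : F ∈ RFil M i t := by
  induction F using RSum_induction with
  | zero => exact zero_mem _
  | add F G hF hG => exact add_mem hF hG
  | lof j a hp f =>
    by_cases hj : j ≤ t
    · exact Rlof_mem_RFil M j a hp f hj
    · have := GrMod.subsingleton_of_isZero (M.isZero_of_isStrictlyLE t j (by lia))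
      rw [Rlof_eq_zero M _ _ fun y => Subsingleton.elim _ _]
      exact zero_mem _

theorem eq_zero_of_mem_RFil (i t : ℤ) [M.IsStrictlyGE (t + 1)] (F : RSum M i)
    (hF : F ∈ RFil M i t) : F = 0 := by
  induction hF using AddSubgroup.closure_induction with
  | mem F hF =>
    obtain ⟨j, a, hp, f, hj, rfl⟩ := hF
    have := GrMod.subsingleton_of_isZero (M.isZero_of_isStrictlyGE (t + 1) j (by lia))
    exact Rlof_eq_zero M _ _ fun y => Subsingleton.elim _ _
  | zero => rfl
  | add F G _ _ hF hG => rw [hF, hG, add_zero]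
  | neg F _ hF => rw [hF, neg_zero]

variable {M} (h : ∀ (j j' : ℤ) (a : Fin n → ℤ), (M.X j).gr a →ₗ[k] (M.X j').gr a)

/-- The map on `R(M)` induced by a contracting homotopy. -/
def RContr (i i' : ℤ) (hi : i' + 1 = i) : RSum M i →ₗ[Ext k n] RSum M i' :=
  Rdesc M fun j a hp => (i'.negOnePow : ℤ) • (Rlof M (j - 1) a (by lia) ∘ₗ
    ExtHom.map (h j (j - 1) a))

theorem RContr_lof (i i' : ℤ) (hi : i' + 1 = i) (j j' : ℤ) (a : Fin n → ℤ) (hp : j + deg a = i)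
    (hj : j' + 1 = j) (f : ExtHom k n ((M.X j).gr a)) :
    RContr h i i' hi (Rlof M j a hp f) =
      (i'.negOnePow : ℤ) • Rlof M j' a (by lia) (ExtHom.map (h j j' a) f) := by
  obtain rfl : j' = j - 1 := by lia
  rw [RContr, Rdesc_lof, LinearMap.smul_apply, LinearMap.comp_apply]

theorem RContr_mem
    (hh : ∀ (j j' j'' : ℤ) (_ : j' + 1 = j) (_ : j + 1 = j'') (a : Fin n → ℤ) (y : (M.X j).gr a),
      grMap (M.d j' j) a (h j j' a y) + h j'' j a (grMap (M.d j j'') a y) = y)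
    (i' i i'' : ℤ) (hi : i' + 1 = i) (hi' : i + 1 = i'') (t : ℤ) (F : RSum M i)
    (hF : F ∈ RFil M i t) :
    RdLin M i' i hi (RContr h i i' hi F) + RContr h i'' i hi' (RdLin M i i'' hi' F) - F ∈
      RFil M i (t - 1) := by
  induction hF using AddSubgroup.closure_induction with
  | mem F hF =>
    obtain ⟨j, a, hp, f, hj, rfl⟩ := hF
    have hj' : j - 1 + 1 = j := by lia
    have hf : f = ExtHom.map (grMap (M.d (j - 1) j) a) (ExtHom.map (h j (j - 1) a) f) +
        ExtHom.map (h (j + 1) j a) (ExtHom.map (grMap (M.d j (j + 1)) a) f) :=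
      ExtHom.ext fun y => (hh j (j - 1) (j + 1) hj' rfl a (f y)).symm
    have hl : Rlof M j a hp f = _ := (congrArg (Rlof M j a hp) hf).trans (map_add _ _ _)
    rw [RContr_lof h i i' hi j (j - 1) a hp hj', map_zsmul, RdLin_lof' M _ _ _ _ _ _ _ hj',
      RdLin_lof, map_add, map_sum, map_zsmul, RContr_lof h i'' i hi' (j + 1) j a _ rfl,
      hl, smul_add, smul_smul,
      smul_smul, negOnePow_mul_self, negOnePow_mul_self, one_zsmul, one_zsmul,
      add_add_add_comm, add_sub_cancel_right]
    refine add_mem (zsmul_mem (sum_mem fun l _ => ?_) _) (sum_mem fun l _ => ?_)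
    · exact Rlof_mem_RFil M _ _ _ _ (by lia)
    · rw [RContr_lof h i'' i hi' j (j - 1) _ _ hj']
      exact zsmul_mem (Rlof_mem_RFil M _ _ _ _ (by lia)) _
  | zero => simp [zero_mem]
  | add F G _ _ hF hG =>
    have := add_mem hF hG
    simp only [map_add]
    convert this using 1
    abel
  | neg F _ hF =>
    have := neg_mem hF
    simp only [map_neg]
    convert this using 1
    abel

theorem acyclic_functorR (M : ComB (GrS k n)) (hM : M.obj.Acyclic) :
    ((functorR k n).obj M).Acyclic := by
  intro i
  rw [GrMod.exactAt_iff _ (i - 1) i (i + 1) (by lia) rfl]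
  obtain ⟨h, hh⟩ := exists_contraction M.obj hM
  obtain ⟨α, β, hα, hβ⟩ := M.property
  intro F hF
  obtain ⟨G, hG⟩ := exists_of_filtration (T := RSum M.obj)
    (fun i j => show RSum M.obj i →+ RSum M.obj j from LinearMap.toAddMonoidHom ((RObj M).d i j).lin)
    (fun i j l F => lin_d_d (RObj M) i j l F)
    (i' := i - 1) (i := i) (i'' := i + 1) (fun t => RFil M.obj i t)
    (RContr h i (i - 1) (by lia)).toAddMonoidHom (RContr h (i + 1) i rfl).toAddMonoidHom
    (fun t F hF => by
      have := RContr_mem h hh (i - 1) i (i + 1) (by lia) rfl t F hF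
      convert this using 4
      · exact congrArg (fun f : RX M (i - 1) ⟶ RX M i => f.lin _) (Rd_eq M _ _ (by lia))
      · exact congrArg (fun f : RX M i ⟶ RX M (i + 1) => RContr h (i + 1) i rfl (f.lin F)) (Rd_eq M _ _ rfl))
    (α - 1) (fun F hF => by
      have : M.obj.IsStrictlyGE (α - 1 + 1) := by rwa [sub_add_cancel]
      exact eq_zero_of_mem_RFil M.obj i (α - 1) F hF)
    (β - (α - 1)).toNat F (by
      have : M.obj.IsStrictlyLE (α - 1 + (β - (α - 1)).toNat) :=
        M.obj.isStrictlyLE_of_le β _ (by lia)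
      exact mem_RFil M.obj i _ F) hF
  exact ⟨G, hG⟩

end R

section ExtContraction

variable {k : Type u} [Field k] {n : ℕ}

/-- Contraction with the `l`-th coordinate functional. -/
def contr (l : Fin n) : Ext k n →ₗ[k] Ext k n :=
  (CliffordAlgebra.contractLeft (Q := (0 : QuadraticForm k (Fin n → k))) (LinearMap.proj l) :
    ExteriorAlgebra k (Fin n → k) →ₗ[k] ExteriorAlgebra k (Fin n → k))

theorem contr_one (l : Fin n) : contr l (1 : Ext k n) = 0 :=
  CliffordAlgebra.contractLeft_one (Q := (0 : QuadraticForm k (Fin n → k))) _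

theorem contr_e_mul (l m : Fin n) (y : Ext k n) :
    contr l (e k m * y) = (Pi.single m 1 : Fin n → k) l • y - e k m * contr l y :=
  CliffordAlgebra.contractLeft_ι_mul (Q := (0 : QuadraticForm k (Fin n → k)))
    (d := LinearMap.proj l) (Pi.single m 1) y

theorem contr_e_mul_self (l : Fin n) (y : Ext k n) :
    contr l (e k l * y) = y - e k l * contr l y := by
  rw [contr_e_mul, Pi.single_eq_same, one_smul]

theorem contr_e_mul_of_ne {l m : Fin n} (h : l ≠ m) (y : Ext k n) :
    contr l (e k m * y) = -(e k m * contr l y) := by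
  rw [contr_e_mul, Pi.single_eq_of_ne h, zero_smul, zero_sub]

/-- The algebra endomorphism `e_l ↦ 0` (as a linear map), iterated over a list. -/
def killE : List (Fin n) → Ext k n →ₗ[k] Ext k n
  | [] => LinearMap.id
  | l :: ls => killE ls ∘ₗ contr l ∘ₗ LinearMap.mulLeft k (e k l)

theorem killE_cons (l : Fin n) (ls : List (Fin n)) (y : Ext k n) :
    killE (l :: ls) y = killE ls (contr l (e k l * y)) := rfl

theorem killE_one (ls : List (Fin n)) : killE ls (1 : Ext k n) = 1 := by
  induction ls with
  | nil => rfl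
  | cons l ls ih => rw [killE_cons, contr_e_mul_self, contr_one, mul_zero, sub_zero, ih]

theorem killE_e_mul {ls : List (Fin n)} {m : Fin n} (h : m ∈ ls) (y : Ext k n) :
    killE ls (e k m * y) = 0 := by
  induction ls generalizing y with
  | nil => simp at h
  | cons l ls ih =>
    rw [killE_cons]
    by_cases hl : l = m
    · subst hl
      rw [← mul_assoc, e_mul_self, zero_mul, map_zero, map_zero]
    · have h1 : e k l * (e k m * y) = -(e k m * (e k l * y)) := by
        rw [← mul_assoc, ← mul_assoc, ← neg_mul, ← eq_neg_of_add_eq_zero_left (e_mul_add_swap k l m)]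
      rw [h1, map_neg, contr_e_mul_of_ne hl, neg_neg]
      exact ih ((List.mem_cons.1 h).resolve_left (Ne.symm hl)) _

theorem Ext.span_prod : Submodule.span k {y : Ext k n | ∃ l : List (Fin n), (l.map (e k)).prod = y}
    = ⊤ := by
  rw [eq_top_iff, ← (extGr_isInternal k (n := n)).submodule_iSup_eq_top]
  refine iSup_le fun a => Submodule.span_mono ?_
  rintro y ⟨l, -, rfl⟩
  exact ⟨l, rfl⟩

theorem exists_killE {ls : List (Fin n)} (h : ∀ l, l ∈ ls) (y : Ext k n) :
    ∃ r : k, killE ls y = r • (1 : Ext k n) := by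
  have hy : y ∈ Submodule.span k {y : Ext k n | ∃ l : List (Fin n), (l.map (e k)).prod = y} := by
    rw [Ext.span_prod]; trivial
  induction hy using Submodule.span_induction with
  | mem y hy =>
    obtain ⟨l, rfl⟩ := hy
    cases l with
    | nil => exact ⟨1, (killE_one ls).trans (one_smul _ _).symm⟩
    | cons m l => exact ⟨0, by rw [List.map_cons, List.prod_cons, killE_e_mul (h m), zero_smul]⟩
  | zero => exact ⟨0, by rw [map_zero, zero_smul]⟩
  | add y z _ _ hy hz =>
    obtain ⟨r, hr⟩ := hy
    obtain ⟨r', hr'⟩ := hz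
    exact ⟨r + r', by rw [map_add, hr, hr', add_smul]⟩
  | smul c y _ hy =>
    obtain ⟨r, hr⟩ := hy
    exact ⟨c * r, by rw [map_smul, hr, smul_smul]⟩

end ExtContraction

section Koszul

variable {k : Type u} [Field k] {n : ℕ}

/-- The map `f ↦ φ ∘ f ∘ θ` -/
def ExtHom.bicomp {V W : Type u} [AddCommGroup V] [Module k V] [AddCommGroup W] [Module k W]
    (φ : V →ₗ[k] W) (θ : Ext k n →ₗ[k] Ext k n) : ExtHom k n V →ₗ[k] ExtHom k n W where
  toFun f := LinearMap.comp φ (LinearMap.comp f θ)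
  map_add' f g := ExtHom.ext fun y => map_add φ (f (θ y)) (g (θ y))
  map_smul' c f := ExtHom.ext fun y => map_smul φ c (f (θ y))

theorem ExtHom.bicomp_apply {V W : Type u} [AddCommGroup V] [Module k V] [AddCommGroup W]
    [Module k W] (φ : V →ₗ[k] W) (θ : Ext k n →ₗ[k] Ext k n) (f : ExtHom k n V) (y : Ext k n) :
    ExtHom.bicomp φ θ f y = φ (f (θ y)) := rfl

variable (M : CochainComplex (GrS k n) ℤ)

/-- The elements of `R(M)` in the components with `t ≤ j`. -/
def RCofil (i t : ℤ) : AddSubgroup (RSum M i) :=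
  AddSubgroup.closure {F | ∃ j a hp f, t ≤ j ∧ Rlof M j a hp f = F}

theorem Rlof_mem_RCofil {i t : ℤ} (j : ℤ) (a : Fin n → ℤ) (hp : j + deg a = i)
    (f : ExtHom k n ((M.X j).gr a)) (hj : t ≤ j) : Rlof M j a hp f ∈ RCofil M i t :=
  AddSubgroup.subset_closure ⟨j, a, hp, f, hj, rfl⟩

theorem mem_RCofil (i t : ℤ) [M.IsStrictlyGE t] (F : RSum M i) : F ∈ RCofil M i t := by
  induction F using RSum_induction with
  | zero => exact zero_mem _
  | add F G hF hG => exact add_mem hF hG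
  | lof j a hp f =>
    by_cases hj : t ≤ j
    · exact Rlof_mem_RCofil M j a hp f hj
    · have := GrMod.subsingleton_of_isZero (M.isZero_of_isStrictlyGE t j (by lia))
      rw [Rlof_eq_zero M _ _ fun y => Subsingleton.elim _ _]
      exact zero_mem _

theorem eq_zero_of_mem_RCofil (i t t' : ℤ) [M.IsStrictlyLE t] (ht : t < t') (F : RSum M i)
    (hF : F ∈ RCofil M i t') : F = 0 := by
  induction hF using AddSubgroup.closure_induction with
  | mem F hF =>
    obtain ⟨j, a, hp, f, hj, rfl⟩ := hF
    have := GrMod.subsingleton_of_isZero (M.isZero_of_isStrictlyLE t j (by lia))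
    exact Rlof_eq_zero M _ _ fun y => Subsingleton.elim _ _
  | zero => rfl
  | add F G _ _ hF hG => rw [hF, hG, add_zero]
  | neg F _ hF => rw [hF, neg_zero]

variable {M}
variable (ξ : ∀ (j : ℤ) (_ : Fin n), M.X j →ₗ[k] M.X j)
  (hξ : ∀ j l a, ∀ m ∈ (M.X j).gr a, ξ j l m ∈ (M.X j).gr (a - ε l))

/-- The division operator on components. -/
def divGr (j : ℤ) (l : Fin n) (a : Fin n → ℤ) : (M.X j).gr a →ₗ[k] (M.X j).gr (a - ε l) :=
  (ξ j l).restrict (hξ j l a)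

/-- The remainder of division by `x_l`. -/
def remGr (j : ℤ) (l : Fin n) (a : Fin n → ℤ) : (M.X j).gr a →ₗ[k] (M.X j).gr a :=
  LinearMap.id - grSmul (M.X j) (x_mem k l) (add_sub_cancel (ε l) a) ∘ₗ divGr ξ hξ j l a

/-- The contraction of the Koszul differential in direction `l`. -/
def kosContr (l : Fin n) (i i' : ℤ) (hi : i' + 1 = i) : RSum M i →ₗ[k] RSum M i' :=
  DirectSum.toModule k (RIdx n i) _ fun p =>
    (Rlof M p.1.1 (p.1.2 - ε l) (by have := p.2; rw [deg_sub_ε]; lia)).restrictScalars k ∘ₗ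
      ExtHom.bicomp (divGr ξ hξ p.1.1 l p.1.2) (contr l)

theorem kosContr_lof (l : Fin n) (i i' : ℤ) (hi : i' + 1 = i) (j : ℤ) (a : Fin n → ℤ)
    (hp : j + deg a = i) (f : ExtHom k n ((M.X j).gr a)) :
    kosContr ξ hξ l i i' hi (Rlof M j a hp f) = Rlof M j (a - ε l) (by rw [deg_sub_ε]; lia)
      (ExtHom.bicomp (divGr ξ hξ j l a) (contr l) f) :=
  DirectSum.toModule_lof k (ι := RIdx n i) (M := RSummand M) (⟨(j, a), hp⟩ : RIdx n i) f

/-- The projection to the `x_l`-free and `e_l`-free part. -/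
def kosProj (l : Fin n) (i : ℤ) : RSum M i →ₗ[k] RSum M i :=
  DirectSum.lmap fun p : RIdx n i => ExtHom.bicomp (remGr ξ hξ p.1.1 l p.1.2)
    (contr l ∘ₗ LinearMap.mulLeft k (e k l))

theorem kosProj_lof (l : Fin n) (i : ℤ) (j : ℤ) (a : Fin n → ℤ)
    (hp : j + deg a = i) (f : ExtHom k n ((M.X j).gr a)) :
    kosProj ξ hξ l i (Rlof M j a hp f) = Rlof M j a hp
      (ExtHom.bicomp (remGr ξ hξ j l a) (contr l ∘ₗ LinearMap.mulLeft k (e k l)) f) :=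
  DirectSum.lmap_lof (R := k) (ι := RIdx n i) (M := RSummand M) (N := RSummand M)
    (fun p : RIdx n i => ExtHom.bicomp (remGr ξ hξ p.1.1 l p.1.2)
    (contr l ∘ₗ LinearMap.mulLeft k (e k l))) (⟨(j, a), hp⟩ : RIdx n i) f

theorem kosProj_mem (l : Fin n) (i t : ℤ) (F : RSum M i) (hF : F ∈ RCofil M i t) :
    kosProj ξ hξ l i F ∈ RCofil M i t := by
  induction hF using AddSubgroup.closure_induction with
  | mem F hF =>
    obtain ⟨j, a, hp, f, hj, rfl⟩ := hF
    rw [kosProj_lof]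
    exact Rlof_mem_RCofil M _ _ _ _ hj
  | zero => rw [map_zero]; exact zero_mem _
  | add F G _ _ hF hG => rw [map_add]; exact add_mem hF hG
  | neg F _ hF => rw [map_neg]; exact neg_mem hF

variable (hx : ∀ j l m, ξ j l (x k l • m) = m)
  (hx' : ∀ j l l' m, l ≠ l' → ξ j l (x k l' • m) = x k l' • ξ j l m)

include hx hx' in
theorem kosContr_homotopy (l : Fin n) (i' i i'' : ℤ) (hi : i' + 1 = i) (hi' : i + 1 = i'')
    (j : ℤ) (a : Fin n → ℤ) (hp : j + deg a = i) (f : ExtHom k n ((M.X j).gr a)) :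
    ∑ m, (Rlof M j (a - ε l + ε m) (by rw [deg_add_ε, deg_sub_ε]; lia)
      (ExtHom.map (grSmul (M.X j) (x_mem k m) (add_comm (ε m) _)) (ExtHom.pre m
        (ExtHom.bicomp (divGr ξ hξ j l a) (contr l) f))) +
      Rlof M j (a + ε m - ε l) (by rw [deg_sub_ε, deg_add_ε]; lia)
        (ExtHom.bicomp (divGr ξ hξ j l (a + ε m)) (contr l)
          (ExtHom.map (grSmul (M.X j) (x_mem k m) (add_comm (ε m) a)) (ExtHom.pre m f)))) =
      Rlof M j a hp f - kosProj ξ hξ l i (Rlof M j a hp f) := by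
  rw [Finset.sum_eq_single l]
  · rw [kosProj_lof, ← map_sub, Rlof_congr M (sub_add_cancel a (ε l)) _ hp _
      (ExtHom.map (grSmul (M.X j) (x_mem k l) (add_sub_cancel (ε l) a)) (ExtHom.pre l
        (ExtHom.bicomp (divGr ξ hξ j l a) (contr l) f))) (fun y => rfl),
      Rlof_congr M (add_sub_cancel_right a (ε l)) _ hp
        (ExtHom.bicomp (divGr ξ hξ j l (a + ε l)) (contr l)
          (ExtHom.map (grSmul (M.X j) (x_mem k l) (add_comm (ε l) a)) (ExtHom.pre l f)))
        (ExtHom.bicomp LinearMap.id (LinearMap.mulLeft k (e k l) ∘ₗ contr l) f)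
        (fun y => hx j l _), ← map_add]
    refine congrArg _ (ExtHom.ext fun y => Subtype.ext ?_)
    have h1 : (f y : M.X j) = f (contr l (e k l * y)) + f (e k l * contr l y) := by
      rw [← Submodule.coe_add, ← map_add, contr_e_mul_self, sub_add_cancel]
    change x k l • ξ j l (f (contr l (e k l * y))) + (f (e k l * contr l y) : M.X j) =
      f y - (f (contr l (e k l * y)) - x k l • ξ j l (f (contr l (e k l * y))))
    rw [h1]
    abel
  · intro m _ hm
    rw [add_eq_zero_iff_eq_neg, ← map_neg]
    refine Rlof_congr M (by abel) _ _ _ _ fun y => ?_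
    change x k m • ξ j l (f (contr l (e k m * y))) =
      -(ξ j l (x k m • (f (e k m * contr l y) : M.X j)))
    rw [hx' j l m _ hm.symm, contr_e_mul_of_ne hm.symm, map_neg, Submodule.coe_neg, map_neg, smul_neg]
  · simp

include hx hx' in
theorem kosContr_mem (l : Fin n) (i' i i'' : ℤ) (hi : i' + 1 = i) (hi' : i + 1 = i'')
    (t : ℤ) (F : RSum M i) (hF : F ∈ RCofil M i t) :
    F - RdLin M i' i hi (kosContr ξ hξ l i i' hi F) -
      kosContr ξ hξ l i'' i hi' (RdLin M i i'' hi' F) - kosProj ξ hξ l i F ∈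
      RCofil M i (t + 1) := by
  induction hF using AddSubgroup.closure_induction with
  | mem F hF =>
    obtain ⟨j, a, hp, f, hj, rfl⟩ := hF
    have h := kosContr_homotopy ξ hξ hx hx' l i' i i'' hi hi' j a hp f
    rw [Finset.sum_add_distrib] at h
    rw [show ∀ A B C D : RSum M i, A - B - C - D = A - D - B - C from
      fun A B C D => by abel, ← h, kosContr_lof, RdLin_lof, RdLin_lof, map_add, map_sum,
      map_zsmul, kosContr_lof]
    simp only [kosContr_lof]
    rw [show ∀ A B C D : RSum M i, A + B - (A + C) - (B + D) = -C - D from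
      fun A B C D => by abel]
    refine sub_mem (neg_mem (zsmul_mem ?_ _)) (zsmul_mem ?_ _)
    · exact Rlof_mem_RCofil M _ _ _ _ (by lia)
    · exact Rlof_mem_RCofil M _ _ _ _ (by lia)
  | zero => simp [zero_mem]
  | add F G _ _ hF hG =>
    have := add_mem hF hG
    simp only [map_add]
    convert this using 1
    abel
  | neg F _ hF =>
    have := neg_mem hF
    simp only [map_neg]
    convert this using 1
    abel

/-- The iterated projection. -/
def kosProjs (i : ℤ) : List (Fin n) → RSum M i →ₗ[k] RSum M i
  | [] => LinearMap.id
  | l :: ls => kosProj ξ hξ l i ∘ₗ kosProjs i ls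

/-- The iterated remainder. -/
def remGrs (j : ℤ) (a : Fin n → ℤ) : List (Fin n) → (M.X j).gr a →ₗ[k] (M.X j).gr a
  | [] => LinearMap.id
  | l :: ls => remGr ξ hξ j l a ∘ₗ remGrs j a ls

include hx hx' in
theorem exists_sub_kosProjs_mem (i' i i'' : ℤ) (hi : i' + 1 = i) (hi' : i + 1 = i'')
    (ls : List (Fin n)) (P : AddSubgroup (RSum M i'))
    (hP : ∀ l F, kosContr ξ hξ l i i' hi F ∈ P)
    (t : ℤ) (F : RSum M i) (hF : F ∈ RCofil M i t) (hdF : RdLin M i i'' hi' F = 0) :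
    ∃ G ∈ P, F - RdLin M i' i hi G ∈ RCofil M i t ∧
      F - RdLin M i' i hi G - kosProjs ξ hξ i ls F ∈ RCofil M i (t + 1) := by
  induction ls with
  | nil => exact ⟨0, zero_mem _, by simpa using hF, by
      rw [map_zero, sub_zero]; exact (sub_self F).symm ▸ zero_mem _⟩
  | cons l ls ih =>
    obtain ⟨G, hG, hG₁, hG₂⟩ := ih
    set F₁ := F - RdLin M i' i hi G with hF₁
    have hdF₁ : RdLin M i i'' hi' F₁ = 0 := by
      rw [hF₁, map_sub, hdF, RdLin_RdLin, sub_zero]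
    have h1 := kosContr_mem ξ hξ hx hx' l i' i i'' hi hi' t F₁ hG₁
    rw [hdF₁, map_zero, sub_zero] at h1
    have hle : RCofil M i (t + 1) ≤ RCofil M i t := by
      refine AddSubgroup.closure_mono ?_
      rintro _ ⟨j, a, hp, f, hj, rfl⟩
      exact ⟨j, a, hp, f, by lia, rfl⟩
    have h2 := kosProj_mem ξ hξ l i _ _ hG₂
    rw [map_sub] at h2
    refine ⟨G + kosContr ξ hξ l i i' hi F₁, add_mem hG (hP _ _), ?_, ?_⟩
    · rw [map_add, ← sub_sub]
      have := add_mem (hle h1) (kosProj_mem ξ hξ l i _ _ hG₁)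
      rwa [sub_add_cancel] at this
    · rw [map_add, ← sub_sub]
      have := add_mem h1 h2
      rwa [sub_add_sub_cancel] at this

end Koszul

section Division

variable {k : Type u} [Field k] {n : ℕ}

/-- The coefficient of a monomial. -/
def coeffS (t : Fin n →₀ ℕ) : Sym k n →ₗ[k] k := MvPolynomial.lcoeff k t

theorem sym_ext {s s' : Sym k n} (h : ∀ t, coeffS t s = coeffS t s') : s = s' :=
  MvPolynomial.ext _ _ h

/-- Division by the variable `x_l`, for multivariate polynomials. -/
def divXMv (l : Fin n) : MvPolynomial (Fin n) k →ₗ[k] MvPolynomial (Fin n) k where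
  toFun s := MvPolynomial.divMonomial s (Finsupp.single l 1)
  map_add' s t := MvPolynomial.add_divMonomial s t (Finsupp.single l 1)
  map_smul' c s := MvPolynomial.ext _ _ fun t => by
    rw [MvPolynomial.coeff_divMonomial, MvPolynomial.coeff_smul, MvPolynomial.coeff_smul,
      MvPolynomial.coeff_divMonomial, RingHom.id_apply]

/-- Division by the variable `x_l` -/
def divX (l : Fin n) : Sym k n →ₗ[k] Sym k n := divXMv (k := k) l

theorem coeffS_divX (l : Fin n) (t : Fin n →₀ ℕ) (s : Sym k n) :
    coeffS t (divX l s) = coeffS (Finsupp.single l 1 + t) s :=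
  MvPolynomial.coeff_divMonomial _ _ _

theorem coeffS_x_mul (l : Fin n) (t : Fin n →₀ ℕ) (s : Sym k n) :
    coeffS t (x k l * s) = if t l = 0 then 0 else coeffS (t - Finsupp.single l 1) s := by
  refine (MvPolynomial.coeff_X_mul' (R := k) t l s).trans ?_
  by_cases h : t l = 0
  · simp [h]
  · simp [h]
    rfl

theorem divX_x_mul (l : Fin n) (s : Sym k n) : divX l (x k l * s) = s :=
  MvPolynomial.X_mul_divMonomial l s

theorem divX_x_mul_of_ne {l m : Fin n} (h : l ≠ m) (s : Sym k n) :
    divX l (x k m * s) = x k m * divX l s := by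
  refine sym_ext fun t => ?_
  rw [coeffS_divX, coeffS_x_mul, coeffS_x_mul, coeffS_divX]
  have h1 : (Finsupp.single l 1 + t : Fin n →₀ ℕ) m = t m := by simp [Finsupp.single_eq_of_ne h.symm]
  rw [h1]
  split_ifs with h2
  · rfl
  · refine congrArg (fun u : Fin n →₀ ℕ => coeffS u s) (Finsupp.ext fun i => ?_)
    simp only [Finsupp.coe_tsub, Finsupp.coe_add, Pi.sub_apply, Pi.add_apply]
    by_cases hi : i = m
    · subst hi
      simp [Finsupp.single_eq_of_ne h.symm]
    · simp [Finsupp.single_eq_of_ne hi]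

theorem mem_symGr_iff {a : Fin n → ℤ} {s : Sym k n} :
    s ∈ symGr k n a ↔ ∀ t, coeffS t s ≠ 0 → (fun i => (t i : ℤ)) = a := by
  have h : ∀ t : Fin n →₀ ℕ, (Finsupp.weight ε t : Fin n → ℤ) = fun i => (t i : ℤ) := fun t =>
    funext fun i => weight_ε t i
  refine ⟨fun hs t ht => (h t).symm.trans (hs ht), fun hs t ht => (h t).trans (hs t ht)⟩

theorem divX_mem (l : Fin n) {a : Fin n → ℤ} {s : Sym k n} (hs : s ∈ symGr k n a) :
    divX l s ∈ symGr k n (a - ε l) := by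
  rw [mem_symGr_iff] at hs ⊢
  intro t ht
  rw [coeffS_divX] at ht
  rw [← hs _ ht]
  funext i
  by_cases hi : i = l
  · subst hi; simp [ε]
  · simp [ε, Finsupp.single_eq_of_ne hi, hi]

/-- The iterated remainder of division by variables. -/
def remX : List (Fin n) → Sym k n →ₗ[k] Sym k n
  | [] => LinearMap.id
  | l :: ls => (LinearMap.id - LinearMap.mulLeft k (x k l) ∘ₗ divX l) ∘ₗ remX ls

theorem coeffS_remX (ls : List (Fin n)) (t : Fin n →₀ ℕ) (s : Sym k n) :
    coeffS t (remX ls s) = if ∀ l ∈ ls, t l = 0 then coeffS t s else 0 := by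
  induction ls with
  | nil => simp [remX]
  | cons l ls ih =>
    have h1 : coeffS t (remX (l :: ls) s) = coeffS t (remX ls s) -
      coeffS t (x k l * divX l (remX ls s)) := map_sub (coeffS t) _ _
    rw [h1, coeffS_x_mul, coeffS_divX]
    by_cases h : t l = 0
    · rw [if_pos h, sub_zero, ih]
      simp [h]
    · have h2 : Finsupp.single l 1 + (t - Finsupp.single l 1) = t :=
        add_tsub_cancel_of_le (Finsupp.single_le_iff.2 (Nat.one_le_iff_ne_zero.2 h))
      rw [if_neg h, h2, sub_self]
      simp [h]

theorem remX_all {ls : List (Fin n)} (h : ∀ l, l ∈ ls) (s : Sym k n) :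
    remX ls s = coeffS 0 s • (1 : Sym k n) := by
  refine sym_ext fun t => ?_
  rw [coeffS_remX]
  have h1 : coeffS t (coeffS 0 s • (1 : Sym k n)) = coeffS 0 s * if 0 = t then 1 else 0 :=
    (map_smul (coeffS t) _ _).trans (congrArg _ (MvPolynomial.coeff_one (R := k) t))
  rw [h1]
  by_cases ht : 0 = t
  · subst ht; simp
  · rw [if_neg ht, if_neg, mul_zero]
    intro h'
    exact ht (Finsupp.ext fun i => (h' i (h i)).symm)

theorem coeffS_zero_eq_zero {a : Fin n → ℤ} (ha : a ≠ 0) {s : Sym k n} (hs : s ∈ symGr k n a) :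
    coeffS 0 s = 0 := by
  by_contra h
  exact ha ((mem_symGr_iff.1 hs 0 h).symm.trans (funext fun i => by simp))

theorem coeffS_zero_x_mul (l : Fin n) (s : Sym k n) : coeffS 0 (x k l * s) = 0 := by
  rw [coeffS_x_mul]; simp

theorem smul_one_tmul {V : Type u} [AddCommGroup V] [Module k V] (c : k) (s : Sym k n) (v : V) :
    SymTensor.tmul (c • s) v = SymTensor.tmul s (c • v) :=
  TensorProduct.smul_tmul (R := k) c s v

/-- The map `s ⊗ v ↦ φ(s) ⊗ v`. -/
def SymTensor.mapLeft {V : Type u} [AddCommGroup V] [Module k V] (φ : Sym k n →ₗ[k] Sym k n) :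
    SymTensor k n V →ₗ[k] SymTensor k n V := TensorProduct.map φ LinearMap.id

/-- The map `s ⊗ v ↦ s_0 v`. -/
def SymTensor.constCoeff {V : Type u} [AddCommGroup V] [Module k V] : SymTensor k n V →ₗ[k] V :=
  TensorProduct.lid k V ∘ₗ TensorProduct.map (coeffS 0) LinearMap.id

end Division

section LDivision

variable {k : Type u} [Field k] {n : ℕ} (N : CochainComplex (GrE k n) ℤ)

/-- Division by `x_l` on `L(N)`. -/
def Ldiv (i : ℤ) (l : Fin n) : LSum N i →ₗ[k] LSum N i :=
  DirectSum.lmap fun _ : LIdx n i => SymTensor.mapLeft (divX l)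

theorem Ldiv_lof (i : ℤ) (l : Fin n) (j : ℤ) (a : Fin n → ℤ) (hp : j - deg a = i) (s : Sym k n)
    (y : (N.X j).gr a) :
    Ldiv N i l (Llof N j a hp (SymTensor.tmul s y)) = Llof N j a hp (SymTensor.tmul (divX l s) y) :=
  DirectSum.lmap_lof (R := k) (ι := LIdx n i) (M := LSummand N) (N := LSummand N)
    (fun _ : LIdx n i => SymTensor.mapLeft (divX l)) (⟨(j, a), hp⟩ : LIdx n i) _

theorem smul_Llof {i : ℤ} (r : Sym k n) (j : ℤ) (a : Fin n → ℤ) (hp : j - deg a = i) (s : Sym k n)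
    (y : (N.X j).gr a) : r • Llof N j a hp (SymTensor.tmul s y) =
      Llof N j a hp (SymTensor.tmul (r * s) y) := by
  rw [← map_smul, SymTensor.smul_tmul]

theorem LSumGr_induction {i : ℤ} {b : Fin n → ℤ} {P : LSum N i → Prop} {F : LSum N i}
    (hF : F ∈ LSumGr N i b) (zero : P 0) (add : ∀ F G, P F → P G → P (F + G))
    (lof : ∀ j a hp, ∀ s ∈ symGr k n (b - one - a), ∀ y,
      P (Llof N j a hp (SymTensor.tmul s y))) : P F := by
  classical
  let F' : ⨁ p : LIdx n i, LSummand N p := F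
  have h1 : F = ∑ p ∈ DFinsupp.support F', Llof N p.1.1 p.1.2 p.2 (F' p) :=
    (DirectSum.sum_support_of (β := fun p : LIdx n i => LSummand N p) F').symm
  rw [h1]
  refine Finset.sum_induction _ P add zero fun p _ => ?_
  have hz : F' p ∈ LSummandGr N p b := hF p
  generalize F' p = z at hz
  suffices ∀ c : k, P (Llof N p.1.1 p.1.2 p.2 (c • z)) by simpa using this 1
  induction hz using Submodule.span_induction with
  | mem z hz =>
    intro c
    obtain ⟨s, hs, y, rfl⟩ := hz
    exact lof _ _ p.2 (c • s) (Submodule.smul_mem _ c hs) y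
  | zero => intro c; rw [smul_zero, map_zero]; exact zero
  | add z w _ _ hz hw => intro c; rw [smul_add, map_add]; exact add _ _ (hz c) (hw c)
  | smul c' z _ hz => intro c; rw [smul_smul]; exact hz _

theorem Llof_tmul_mem {i : ℤ} {b : Fin n → ℤ} (j : ℤ) (a : Fin n → ℤ) (hp : j - deg a = i)
    {s : Sym k n} (hs : s ∈ symGr k n (b - one - a)) (y : (N.X j).gr a) :
    Llof N j a hp (SymTensor.tmul s y) ∈ LSumGr N i b :=
  lof_mem_sumGr (R := Sym k n) (fun p : LIdx n i => LSummandGr N p) b ⟨(j, a), hp⟩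
    (SymTensor.tmul_mem_gr hs y)

theorem Ldiv_mem (i : ℤ) (l : Fin n) (b : Fin n → ℤ) (F : LSum N i) (hF : F ∈ LSumGr N i b) :
    Ldiv N i l F ∈ LSumGr N i (b - ε l) := by
  refine LSumGr_induction N (P := fun F => Ldiv N i l F ∈ LSumGr N i (b - ε l)) hF ?_ ?_ ?_
  · rw [map_zero]; exact zero_mem _
  · intro F G hF hG; rw [map_add]; exact add_mem hF hG
  · intro j a hp s hs y
    rw [Ldiv_lof]
    refine Llof_tmul_mem N j a hp ?_ y
    have := divX_mem l hs
    rwa [show b - one - a - ε l = b - ε l - one - a by abel] at this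

theorem Ldiv_smul (i : ℤ) (l : Fin n) (F : LSum N i) : Ldiv N i l (x k l • F) = F := by
  induction F using LSum_induction with
  | zero => simp
  | add F G hF hG => rw [smul_add, map_add, hF, hG]
  | lof j a hp s y => rw [smul_Llof, Ldiv_lof, divX_x_mul]

theorem Ldiv_smul_of_ne (i : ℤ) (l l' : Fin n) (F : LSum N i) (h : l ≠ l') :
    Ldiv N i l (x k l' • F) = x k l' • Ldiv N i l F := by
  induction F using LSum_induction with
  | zero => simp
  | add F G hF hG => rw [smul_add, map_add, hF, hG, map_add, smul_add]
  | lof j a hp s y => rw [smul_Llof, Ldiv_lof, divX_x_mul_of_ne h, Ldiv_lof, smul_Llof]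

/-- The part of an element of `L(N)` which is free of the variables, in cohomological
degree `q` of `N`. -/
def Lconst (i q : ℤ) : LSum N i →ₗ[k] N.X q :=
  DirectSum.toModule k (LIdx n i) _ fun p => if h : p.1.1 = q then
    h ▸ ((N.X p.1.1).gr p.1.2).subtype ∘ₗ SymTensor.constCoeff else 0

theorem Lconst_lof (i q : ℤ) (a : Fin n → ℤ) (hp : q - deg a = i) (s : Sym k n)
    (y : (N.X q).gr a) :
    Lconst N i q (Llof N q a hp (SymTensor.tmul s y)) = coeffS 0 s • (y : N.X q) := by
  refine (DirectSum.toModule_lof k (ι := LIdx n i) (M := LSummand N)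
    (⟨(q, a), hp⟩ : LIdx n i) _).trans ?_
  rw [dif_pos rfl]
  rfl

theorem Lconst_lof_of_ne (i q j : ℤ) (a : Fin n → ℤ) (hp : j - deg a = i) (hj : j ≠ q)
    (z : SymTensor k n ((N.X j).gr a)) :
    Lconst N i q (Llof N j a hp z) = 0 := by
  refine (DirectSum.toModule_lof k (ι := LIdx n i) (M := LSummand N)
    (⟨(j, a), hp⟩ : LIdx n i) _).trans ?_
  rw [dif_neg hj]
  rfl

theorem Lconst_smul (i q : ℤ) (l : Fin n) (F : LSum N i) : Lconst N i q (x k l • F) = 0 := by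
  induction F using LSum_induction with
  | zero => simp
  | add F G hF hG => rw [smul_add, map_add, hF, hG, add_zero]
  | lof j a hp s y =>
    rw [smul_Llof]
    by_cases hj : j = q
    · subst hj
      rw [Lconst_lof, coeffS_zero_x_mul, zero_smul]
    · rw [Lconst_lof_of_ne N i q j a hp hj]

theorem Lconst_LdLin (i i' q q' : ℤ) (hi : i + 1 = i') (hq : q + 1 = q') (F : LSum N i) :
    Lconst N i' q' (LdLin N i i' hi F) = (i.negOnePow : ℤ) • (N.d q q').lin (Lconst N i q F) := by
  induction F using LSum_induction with
  | zero => simp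
  | add F G hF hG => rw [map_add, map_add, hF, hG, map_add, map_add, smul_add]
  | lof j a hp s y =>
    have h0 : ∀ l, Lconst N i' q' (Llof N j (a - ε l) (LIdx.down hp hi l)
        (SymTensor.tmul (x k l * s) (grSmul (N.X j) (e_mem k l) (neg_add_eq_sub (ε l) a) y))) = 0 :=
      fun l => by rw [← smul_Llof, Lconst_smul]
    rw [LdLin_lof, map_add, map_sum, Finset.sum_eq_zero fun l _ => h0 l, zero_add, map_zsmul]
    by_cases hj : j = q
    · subst hj hq
      rw [Lconst_lof, Lconst_lof]
      congr 1
      exact (((N.d j (j + 1)).lin.restrictScalars k).map_smul _ _).symm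
    · rw [Lconst_lof_of_ne N i q j a hp hj, Lconst_lof_of_ne N i' q' (j + 1) a _ (by lia),
        map_zero]

theorem Lconst_mem (i q : ℤ) (b : Fin n → ℤ) (F : LSum N i) (hF : F ∈ LSumGr N i b) :
    Lconst N i q F ∈ (N.X q).gr (b - one) := by
  refine LSumGr_induction N (P := fun F => Lconst N i q F ∈ (N.X q).gr (b - one)) hF ?_ ?_ ?_
  · rw [map_zero]; exact zero_mem _
  · intro F G hF hG; rw [map_add]; exact add_mem hF hG
  · intro j a hp s hs y
    by_cases hj : j = q
    · subst hj
      rw [Lconst_lof]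
      by_cases ha : b - one - a = 0
      · rw [sub_eq_zero.1 ha]
        exact Submodule.smul_mem _ _ y.2
      · rw [coeffS_zero_eq_zero ha hs, zero_smul]; exact zero_mem _
    · rw [Lconst_lof_of_ne N i q j a hp hj]; exact zero_mem _

end LDivision

section Unit

variable {k : Type u} [Field k] {n : ℕ}

theorem sum_eq_sum_of_equiv {σ τ A : Type*} [AddCommMonoid A] (e : σ ≃ τ) (B : Finset σ)
    (B' : Finset τ) (G : σ → A) (H : τ → A) (hG : ∀ b, b ∉ B → G b = 0)
    (hH : ∀ b, b ∉ B' → H b = 0) (h : ∀ b, G b = H (e b)) : ∑ b ∈ B, G b = ∑ b ∈ B', H b := by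
  have h1 : Function.support G ⊆ B := fun b hb => by
    by_contra h; exact hb (hG b h)
  have h2 : Function.support H ⊆ B' := fun b hb => by
    by_contra h; exact hb (hH b h)
  rw [← finsum_eq_sum_of_support_subset G h1, ← finsum_eq_sum_of_support_subset H h2,
    ← finsum_comp_equiv e]
  exact finsum_congr h

theorem deg_one : deg (one : Fin n → ℤ) = n := by simp [deg, one]

theorem deg_sub_one (a : Fin n → ℤ) : deg (a - one) = deg a - n := by
  have := deg_add (a - one) one
  rw [sub_add_cancel, deg_one] at this
  lia

/-- The degrees in which a graded module over the exterior algebra is nonzero. -/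
def degs (N : GrE k n) : Finset (Fin n → ℤ) := N.finite_ext.toFinset

theorem subsingleton_of_notMem_degs (N : GrE k n) {a : Fin n → ℤ} (h : a ∉ degs N) :
    Subsingleton (N.gr a) := by
  simpa [degs] using h

theorem proj_eq_zero_of_notMem_degs (N : GrE k n) {a : Fin n → ℤ} (h : a ∉ degs N) (y : N) :
    proj N.isInternal a y = 0 := by
  have := subsingleton_of_notMem_degs N h
  exact congrArg Subtype.val (Subsingleton.elim (⟨_, proj_mem N.isInternal a y⟩ : N.gr a) 0)

theorem sum_proj_degs (N : GrE k n) (y : N) : ∑ a ∈ degs N, proj N.isInternal a y = y := by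
  classical
  let := N.isInternal.chooseDecomposition
  refine Eq.trans ?_ (DirectSum.sum_support_decompose N.gr y)
  symm
  refine Finset.sum_subset (fun a ha => ?_) fun a _ ha => ?_
  · by_contra h
    exact (DFinsupp.mem_support_iff.1 ha) (Subtype.ext (proj_eq_zero_of_notMem_degs N h y))
  · rw [DFinsupp.notMem_support_iff] at ha
    exact congrArg Subtype.val ha

theorem e_smul_proj (N : GrE k n) (l : Fin n) (a : Fin n → ℤ) (y : N) :
    e k l • proj N.isInternal a y = proj N.isInternal (a - ε l) (e k l • y) := by
  have hm := mem_iSup_of_isInternal N.isInternal y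
  induction hm using Submodule.iSup_induction' with
  | mem b y hy =>
    have h1 : e k l • y ∈ N.gr (b - ε l) := neg_add_eq_sub (ε l) b ▸ N.smul_mem (e_mem k l) hy
    by_cases hb : b = a
    · subst hb
      rw [proj_of_mem _ hy, proj_of_mem _ h1]
    · rw [proj_of_mem_ne _ hy hb, proj_of_mem_ne _ h1 fun h => hb (sub_left_injective h), smul_zero]
  | zero => simp
  | add y z _ _ hy hz => simp only [map_add, smul_add, hy, hz]

theorem one_mem_symGr_sub (b : Fin n → ℤ) : (1 : Sym k n) ∈ symGr k n (b + one - one - b) := by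
  rw [add_sub_cancel_right, sub_self]
  exact SetLike.GradedOne.one_mem

section

variable (N : ComB (GrE k n))

/-- The component of the unit with values in `1 ⊗ N^q_b`. -/
def unitComp (q j : ℤ) (b : Fin n → ℤ) (hj : q - deg b = j) :
    N.obj.X q →ₗ[Ext k n] ExtHom k n (((LObj N).X j).gr (b + one)) where
  toFun z := ({
    toFun := fun y => ⟨Llof N.obj q b hj
      (SymTensor.tmul 1 ⟨proj (N.obj.X q).isInternal b (y • z), proj_mem _ _ _⟩),
      Llof_tmul_mem N.obj q b hj (one_mem_symGr_sub b) _⟩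
    map_add' := fun y y' => Subtype.ext (by
      refine Eq.trans ?_ (map_add (Llof N.obj q b hj) _ _)
      rw [← SymTensor.tmul_add]
      refine Llof_congr N.obj rfl _ _ _ _ rfl _ _ ?_
      change proj _ b ((y + y') • z) = proj _ b (y • z) + proj _ b (y' • z)
      rw [add_smul, map_add])
    map_smul' := fun c y => Subtype.ext (by
      refine Eq.trans ?_ (LinearMap.map_smul_of_tower (Llof N.obj q b hj) c _)
      have h1 : ∀ v : (N.obj.X q).gr b, c • SymTensor.tmul (1 : Sym k n) v =
        SymTensor.tmul 1 (c • v) := fun v => smul_one_tmul c 1 v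
      rw [h1]
      refine Llof_congr N.obj rfl _ _ _ _ rfl _ _ ?_
      change proj _ b ((c • y) • z) = c • proj _ b (y • z)
      rw [smul_assoc, map_smul]) } : Ext k n →ₗ[k] ((LObj N).X j).gr (b + one))
  map_add' z z' := ExtHom.ext fun y => Subtype.ext (by
    refine Eq.trans ?_ (map_add (Llof N.obj q b hj) _ _)
    rw [← SymTensor.tmul_add]
    refine Llof_congr N.obj rfl _ _ _ _ rfl _ _ ?_
    change proj _ b (y • (z + z')) = proj _ b (y • z) + proj _ b (y • z')
    rw [smul_add, map_add])
  map_smul' c z := ExtHom.ext fun y => Subtype.ext (by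
    refine Llof_congr N.obj rfl _ _ _ _ rfl _ _ ?_
    change proj _ b (y • c • z) = proj _ b ((y * c) • z)
    rw [mul_smul])

theorem unitComp_apply (q j : ℤ) (b : Fin n → ℤ) (hj : q - deg b = j) (z : N.obj.X q)
    (y : Ext k n) : (unitComp N q j b hj z y : (LObj N).X j) = (show LSum N.obj j from
      Llof N.obj q b hj (SymTensor.tmul 1
        ⟨proj (N.obj.X q).isInternal b (y • z), proj_mem _ _ _⟩)) := rfl

theorem unitComp_eq_zero (q j : ℤ) (b : Fin n → ℤ) (hj : q - deg b = j) (z : N.obj.X q)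
    (h : b ∉ degs (N.obj.X q)) : unitComp N q j b hj z = 0 :=
  ExtHom.ext fun y => Subtype.ext (Llof_eq_zero N.obj _ _ _ (proj_eq_zero_of_notMem_degs _ h _))

theorem unit_deg {q i : ℤ} (hq : q + n = i) (b : Fin n → ℤ) : q - deg b + deg (b + one) = i := by
  rw [deg_add, deg_one]; lia

/-- The summands of the unit. -/
def unitTerm (q i : ℤ) (hq : q + n = i) (b : Fin n → ℤ) :
    N.obj.X q →ₗ[Ext k n] RSum (LObj N) i :=
  (((i + 1) * deg b).negOnePow : ℤ) • (Rlof (LObj N) (q - deg b) (b + one) (unit_deg hq b) ∘ₗ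
    unitComp N q (q - deg b) b rfl)

theorem unitTerm_apply (q i : ℤ) (hq : q + n = i) (b : Fin n → ℤ) (z : N.obj.X q) :
    unitTerm N q i hq b z = (((i + 1) * deg b).negOnePow : ℤ) •
      Rlof (LObj N) (q - deg b) (b + one) (unit_deg hq b) (unitComp N q (q - deg b) b rfl z) := rfl

theorem unitTerm_eq_zero (q i : ℤ) (hq : q + n = i) (b : Fin n → ℤ) (z : N.obj.X q)
    (h : b ∉ degs (N.obj.X q)) : unitTerm N q i hq b z = 0 := by
  rw [unitTerm_apply, unitComp_eq_zero _ _ _ _ _ _ h, map_zero, smul_zero]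

/-- The unit `N[-n] ⟶ R(L(N))` in cohomological degree `i`. -/
def unitLin (q i : ℤ) (hq : q + n = i) : N.obj.X q →ₗ[Ext k n] RSum (LObj N) i :=
  ∑ b ∈ degs (N.obj.X q), unitTerm N q i hq b

theorem unitLin_apply (q i : ℤ) (hq : q + n = i) (z : N.obj.X q) :
    unitLin N q i hq z = ∑ b ∈ degs (N.obj.X q), unitTerm N q i hq b z :=
  LinearMap.sum_apply _ _ _

theorem unitLin_mem (q i : ℤ) (hq : q + n = i) (c : Fin n → ℤ) (z : N.obj.X q)
    (hz : z ∈ (N.obj.X q).gr c) : unitLin N q i hq z ∈ RSumGr (LObj N) i c := by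
  rw [unitLin_apply]
  refine Submodule.sum_mem _ fun b _ => zsmul_mem' _ _ ?_
  refine lof_mem_sumGr (R := Ext k n) (fun p : RIdx n i => RSummandGr (LObj N) p) c
    ⟨(q - deg b, b + one), unit_deg hq b⟩ ?_
  intro c' hc' y hy
  refine Subtype.ext (Llof_eq_zero N.obj _ _ _ ?_)
  refine proj_of_mem_ne _ ((N.obj.X q).smul_mem hy hz) fun h => hc' ?_
  rw [← h]; ring

theorem unitTerm_naturality {N N' : ComB (GrE k n)} (φ : N ⟶ N') (q i : ℤ) (hq : q + n = i)
    (b : Fin n → ℤ) (z : N.obj.X q) :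
    RMapLin (LMap φ) i (unitTerm N q i hq b z) = unitTerm N' q i hq b ((φ.hom.f q).lin z) := by
  rw [unitTerm_apply, unitTerm_apply, map_zsmul, RMapLin_lof]
  congr 2
  refine ExtHom.ext fun y => Subtype.ext ?_
  refine (LMapLin_lof φ.hom _ _ _ _ _ _).trans ?_
  refine Llof_congr N'.obj rfl _ _ _ _ rfl _ _ ?_
  have h1 := map_proj (N.obj.X q).isInternal (N'.obj.X q).isInternal
    ((φ.hom.f q).lin.restrictScalars k) (φ.hom.f q).map_mem b (y • z)
  refine h1.trans (congrArg (proj _ b) ?_)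
  exact (φ.hom.f q).lin.map_smul y z

theorem unitLin_naturality {N N' : ComB (GrE k n)} (φ : N ⟶ N') (q i : ℤ) (hq : q + n = i)
    (z : N.obj.X q) :
    RMapLin (LMap φ) i (unitLin N q i hq z) = unitLin N' q i hq ((φ.hom.f q).lin z) := by
  rw [unitLin_apply, unitLin_apply, map_sum]
  refine sum_eq_sum_of_equiv (Equiv.refl _) _ _ _ _ (fun b hb => ?_) (fun b hb => ?_)
    fun b => unitTerm_naturality φ q i hq b z
  · rw [unitTerm_eq_zero N q i hq b z hb, map_zero]
  · exact unitTerm_eq_zero N' q i hq b _ hb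

end

end Unit

section QuasiIso

variable {k : Type u} [Field k] {A : Type u} [Ring A] [Algebra k A] {ι : Type v} [AddCommGroup ι]
  [DecidableEq ι] {𝒜 : ι → Submodule k A}

theorem GrMod.sub_lin {M N : GrMod 𝒜} (f g : M ⟶ N) : (f - g).lin = f.lin - g.lin := by
  rw [sub_eq_add_neg, GrMod.add_lin, GrMod.neg_lin, sub_eq_add_neg]

theorem quasiIso_of_elements [IsNoetherianRing A] {K L : CochainComplex (GrMod 𝒜) ℤ} (f : K ⟶ L)
    (h : ∀ (i j l : ℤ) (_ : i + 1 = j) (_ : j + 1 = l) (z : K.X l) (F : L.X j),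
      (K.d l (l + 1)).lin z = 0 → (f.f l).lin z + (L.d j l).lin F = 0 →
      ∃ (z' : K.X j) (F' : L.X i), (K.d j l).lin z' = -z ∧ (f.f j).lin z' + (L.d i j).lin F' = F) :
    QuasiIso f := by
  rw [quasiIso_iff_acyclic_mappingCone]
  intro j
  rw [GrMod.exactAt_iff _ (j - 1) j (j + 1) (by lia) rfl]
  intro y hy
  have h1 : (K.d (j + 1) (j + 1 + 1)).lin (((mappingCone.fst f).1.v j (j + 1) rfl).lin y) = 0 := by
    have := congrArg (fun t : (mappingCone f).X j ⟶ K.X (j + 1 + 1) => t.lin y)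
      (mappingCone.d_fst_v f j (j + 1) (j + 1 + 1) rfl rfl)
    rw [GrMod.neg_lin, GrMod.comp_lin, GrMod.comp_lin, LinearMap.neg_apply, LinearMap.comp_apply,
      LinearMap.comp_apply, hy, map_zero] at this
    exact neg_eq_zero.1 this.symm
  have h2 : (f.f (j + 1)).lin (((mappingCone.fst f).1.v j (j + 1) rfl).lin y) +
      (L.d j (j + 1)).lin (((mappingCone.snd f).v j j (add_zero j)).lin y) = 0 := by
    have := congrArg (fun t : (mappingCone f).X j ⟶ L.X (j + 1) => t.lin y)
      (mappingCone.d_snd_v f j (j + 1) rfl)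
    rw [GrMod.add_lin, GrMod.comp_lin, GrMod.comp_lin, GrMod.comp_lin, LinearMap.add_apply,
      LinearMap.comp_apply, LinearMap.comp_apply, LinearMap.comp_apply, hy, map_zero] at this
    exact this.symm
  obtain ⟨z', F', h3, h4⟩ := h (j - 1) j (j + 1) (by lia) rfl _ _ h1 h2
  refine ⟨((mappingCone.inl f).v j (j - 1) (by lia)).lin z' + ((mappingCone.inr f).f (j - 1)).lin F',
    ?_⟩
  have h5 := congrArg (fun t : K.X j ⟶ (mappingCone f).X j => t.lin z')
    (mappingCone.inl_v_d f j (j - 1) (j + 1) (by lia) (by lia))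
  rw [GrMod.sub_lin, GrMod.comp_lin, GrMod.comp_lin, GrMod.comp_lin, LinearMap.sub_apply,
      LinearMap.comp_apply, LinearMap.comp_apply, LinearMap.comp_apply, h3] at h5
  have h6 := congrArg (fun t : L.X (j - 1) ⟶ (mappingCone f).X j => t.lin F')
    (mappingCone.inr_f_d f (j - 1) j)
  rw [GrMod.comp_lin, GrMod.comp_lin, LinearMap.comp_apply, LinearMap.comp_apply] at h6
  have h7 := congrArg (fun t : (mappingCone f).X j ⟶ (mappingCone f).X j => t.lin y)
    (mappingCone.id_X f j (j + 1) rfl)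
  rw [GrMod.add_lin, GrMod.comp_lin, GrMod.comp_lin, LinearMap.add_apply,
      LinearMap.comp_apply, LinearMap.comp_apply, ← h4] at h7
  refine Eq.trans ?_ h7
  rw [map_add, h5, h6, map_add, map_neg]
  abel

end QuasiIso

section Unit

variable {k : Type u} [Field k] {n : ℕ}

variable (N : ComB (GrE k n))

theorem LObj_d_lin (j j' : ℤ) (h : j + 1 = j') (F : LSum N.obj j) :
    ((LObj N).d j j').lin F = LdLin N.obj j j' h F :=
  congrArg (fun f : LX N j ⟶ LX N j' => f.lin F) (Ld_eq N j j' h)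

theorem RObj_d_lin (M : ComB (GrS k n)) (j j' : ℤ) (h : j + 1 = j') (F : RSum M.obj j) :
    ((RObj M).d j j').lin F = RdLin M.obj j j' h F :=
  congrArg (fun f : RX M j ⟶ RX M j' => f.lin F) (Rd_eq M j j' h)

theorem negOnePow_add_mul (a b : ℤ) :
    ((a + b).negOnePow : ℤ) = (a.negOnePow : ℤ) * (b.negOnePow : ℤ) := by
  rw [Int.negOnePow_add, Units.val_mul]

theorem negOnePow_congr {a b : ℤ} (h : Even (a - b)) : (a.negOnePow : ℤ) = (b.negOnePow : ℤ) :=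
  congrArg Units.val ((Int.negOnePow_eq_iff a b).2 h)

theorem map_proj_smul {M M' : GrE k n} (f : M ⟶ M') (b : Fin n → ℤ) (y : Ext k n) (z : M) :
    f.lin (proj M.isInternal b (y • z)) = proj M'.isInternal b (y • f.lin z) :=
  (map_proj M.isInternal M'.isInternal (f.lin.restrictScalars k) f.map_mem b (y • z)).trans
    (congrArg (proj _ b) (f.lin.map_smul y z))

/-- Evaluation of the elements of `Hom_k(E, M_a)`. -/
def ExtHom.evalCoe {A : Type u} [AddCommGroup A] [Module k A] (V : Submodule k A) (y : Ext k n) :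
    ExtHom k n V →+ A where
  toFun f := (f y : A)
  map_zero' := rfl
  map_add' _ _ := rfl

theorem unitTerm_apply' (q j i : ℤ) (hq : q + n = i) (b : Fin n → ℤ) (hj : q - deg b = j)
    (hp : j + deg (b + one) = i) (z : N.obj.X q) :
    unitTerm N q i hq b z = (((i + 1) * deg b).negOnePow : ℤ) •
      Rlof (LObj N) j (b + one) hp (unitComp N q j b hj z) := by
  subst hj
  rfl

/-- The Koszul part of the differential of a summand of the unit. -/
def unitKos (q i' : ℤ) (hq : q + n + 1 = i') (l : Fin n) (b : Fin n → ℤ)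
    (z : N.obj.X q) : RSum (LObj N) i' :=
  ((i' * deg b).negOnePow : ℤ) •
    Rlof (LObj N) (q - deg b) (b + one + ε l) (by rw [deg_add_ε, ← add_assoc, unit_deg rfl, hq])
      (ExtHom.map (grSmul ((LObj N).X (q - deg b)) (x_mem k l) (add_comm (ε l) _))
        (ExtHom.pre l (unitComp N q (q - deg b) b rfl z)))

theorem unitKos_eq (q j i' : ℤ) (hq : q + n + 1 = i') (l : Fin n) (b : Fin n → ℤ)
    (hj : q - deg b = j) (hp : j + deg (b + one + ε l) = i') (z : N.obj.X q) :
    unitKos N q i' hq l b z = ((i' * deg b).negOnePow : ℤ) •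
    Rlof (LObj N) j (b + one + ε l) hp
      (ExtHom.map (grSmul ((LObj N).X j) (x_mem k l) (add_comm (ε l) _))
        (ExtHom.pre l (unitComp N q j b hj z))) := by
  subst hj
  rfl

theorem unitKos_eq_zero (q i' : ℤ) (hq : q + n + 1 = i') (l : Fin n) (b : Fin n → ℤ)
    (z : N.obj.X q) (hb : b ∉ degs (N.obj.X q)) : unitKos N q i' hq l b z = 0 := by
  rw [unitKos, unitComp_eq_zero _ _ _ _ _ _ hb, map_zero, map_zero, map_zero, smul_zero]

theorem unitKos_sub_eq_zero (q i' : ℤ) (hq : q + n + 1 = i') (l : Fin n) (b : Fin n → ℤ)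
    (z : N.obj.X q) (hb : b ∉ degs (N.obj.X q)) : unitKos N q i' hq l (b - ε l) z = 0 := by
  have h : ExtHom.pre l (unitComp N q (q - deg (b - ε l)) (b - ε l) rfl z) = 0 := by
    refine ExtHom.ext fun y => Subtype.ext (Llof_eq_zero N.obj _ _ _ ?_)
    change proj _ (b - ε l) ((e k l * y) • z) = 0
    rw [mul_smul, ← e_smul_proj, proj_eq_zero_of_notMem_degs _ hb, smul_zero]
  rw [unitKos, h, map_zero, map_zero, smul_zero]

theorem Rlof_d_eq (K : CochainComplex (GrS k n) ℤ) (j j' i' : ℤ) (a : Fin n → ℤ)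
    (hp : j' + deg a = i') (c : Fin n → Fin n → ℤ) (hc : ∀ l, c l + ε l = a)
    (f : ExtHom k n ((K.X j).gr a)) (g : ∀ l, ExtHom k n ((K.X j').gr (c l)))
    (h : ExtHom k n ((K.X j').gr a)) (r : ℤ)
    (H : ∀ y, (K.d j j').lin (f y) = ∑ l, x k l • (g l (e k l * y) : K.X j') + r • (h y : K.X j')) :
    Rlof K j' a hp (ExtHom.map (grMap (K.d j j') a) f) =
      (∑ l, Rlof K j' (c l + ε l) (by rw [hc, hp])
        (ExtHom.map (grSmul (K.X j') (x_mem k l) (add_comm (ε l) _)) (ExtHom.pre l (g l)))) +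
      r • Rlof K j' a hp h := by
  have hl : ∀ l, ε l + c l = a := fun l => by rw [add_comm, hc]
  have h1 : (∑ l, Rlof K j' (c l + ε l) (by rw [hc, hp])
        (ExtHom.map (grSmul (K.X j') (x_mem k l) (add_comm (ε l) _)) (ExtHom.pre l (g l)))) =
      Rlof K j' a hp (∑ l, ExtHom.map (grSmul (K.X j') (x_mem k l) (hl l))
        (ExtHom.pre l (g l))) := by
    rw [map_sum]
    exact Finset.sum_congr rfl fun l _ => Rlof_congr K (hc l) _ _ _ _ fun y => rfl
  rw [h1, ← map_zsmul, ← map_add]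
  refine congrArg _ (ExtHom.ext fun y => Subtype.ext ((H y).trans ?_))
  refine Eq.trans ?_ ((map_add (ExtHom.evalCoe ((K.X j').gr a) y)
    (∑ l, ExtHom.map (grSmul (K.X j') (x_mem k l) (hl l)) (ExtHom.pre l (g l))) (r • h)).trans
    (congrArg₂ (· + ·) (map_sum (ExtHom.evalCoe ((K.X j').gr a) y) _ _)
      (map_zsmul (ExtHom.evalCoe ((K.X j').gr a) y) r h))).symm
  rfl

theorem d_unitComp_apply (q j j' : ℤ) (b : Fin n → ℤ)
    (hj : q - deg b = j) (hj' : j + 1 = j') (z : N.obj.X q) (y : Ext k n) :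
    ((LObj N).d j j').lin (unitComp N q j b hj z y) =
      ∑ l, x k l • (unitComp N q j' (b - ε l) (by rw [deg_sub_ε]; lia) z (e k l * y) :
        (LObj N).X j') +
      (j.negOnePow : ℤ) •
        (unitComp N (q + 1) j' b (by lia) ((N.obj.d q (q + 1)).lin z) y : (LObj N).X j') := by
  rw [unitComp_apply, unitComp_apply, LObj_d_lin N j j' hj']
  refine (LdLin_lof N.obj j j' hj' q b hj 1 _).trans ?_
  refine congrArg₂ (fun v w : LSum N.obj j' => v + w)
    (Finset.sum_congr rfl fun l _ => ?_) (congrArg _ ?_)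
  · rw [unitComp_apply]
    refine Eq.trans ?_ (smul_Llof N.obj (x k l) q (b - ε l) _ 1 _).symm
    refine Llof_congr N.obj rfl _ _ _ _ rfl _ _ ?_
    change e k l • proj _ b (y • z) = proj _ (b - ε l) ((e k l * y) • z)
    rw [e_smul_proj, mul_smul]
  · refine Llof_congr N.obj rfl _ _ _ _ rfl _ _ ?_
    exact map_proj_smul _ _ _ _

theorem Rlof_d_unitComp (q j j' i' : ℤ) (b : Fin n → ℤ)
    (hj : q - deg b = j) (hj' : j + 1 = j') (hp : j' + deg (b + one) = i') (z : N.obj.X q) :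
    Rlof (LObj N) j' (b + one) hp
      (ExtHom.map (grMap ((LObj N).d j j') (b + one)) (unitComp N q j b hj z)) =
      (∑ l, Rlof (LObj N) j' (b - ε l + one + ε l) (by
        rw [deg_add_ε, ← hp, deg_add, deg_add, deg_sub_ε]; ring)
        (ExtHom.map (grSmul ((LObj N).X j') (x_mem k l) (add_comm (ε l) _))
        (ExtHom.pre l (unitComp N q j' (b - ε l) (by rw [deg_sub_ε]; lia) z)))) +
      (j.negOnePow : ℤ) • Rlof (LObj N) j' (b + one) hp
        (unitComp N (q + 1) j' b (by lia) ((N.obj.d q (q + 1)).lin z)) :=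
  Rlof_d_eq (LObj N) j j' i' (b + one) hp (fun l => b - ε l + one) (fun l => by abel) _
    (fun l => unitComp N q j' (b - ε l) (by rw [deg_sub_ε]; lia) z) _ _
    (d_unitComp_apply N q j j' b hj hj' z)

theorem RdLin_unitTerm (q q' i i' : ℤ) (hq : q + n = i) (hq' : q' + n = i') (hi : i + 1 = i')
    (b : Fin n → ℤ) (z : N.obj.X q) :
    RdLin (LObj N) i i' hi (unitTerm N q i hq b z) =
      (∑ l, (unitKos N q i' (hq.symm ▸ hi) l b z - unitKos N q i' (hq.symm ▸ hi) l (b - ε l) z)) +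
      ((n : ℤ).negOnePow : ℤ) • unitTerm N q' i' hq' b ((N.obj.d q q').lin z) := by
  obtain rfl : q' = q + 1 := by lia
  subst hi
  rw [unitTerm_apply, map_zsmul, RdLin_lof, smul_add, Finset.smul_sum, Finset.sum_sub_distrib,
    sub_eq_add_neg (∑ l, unitKos N q (i + 1) _ l b z), add_assoc]
  congr 1
  rw [Rlof_d_unitComp N q (q - deg b) (q - deg b + 1) (i + 1) b rfl rfl _ z, smul_add,
    smul_add, smul_smul, smul_smul, smul_smul,
    unitTerm_apply' N (q + 1) (q - deg b + 1) (i + 1) hq' b (by ring) (by rw [deg_add, deg_one]; lia),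
    smul_smul, Finset.smul_sum, ← Finset.sum_neg_distrib]
  refine congrArg₂ (· + ·) (Finset.sum_congr rfl fun l _ => ?_) (congrArg (· • _) ?_)
  · rw [unitKos_eq N q (q - deg b + 1) (i + 1) _ l (b - ε l) (by rw [deg_sub_ε]; ring), ← neg_smul]
    refine congrArg (· • _) ?_
    rw [← negOnePow_add_mul, ← Units.val_neg, ← Int.negOnePow_succ]
    refine negOnePow_congr ⟨i, ?_⟩
    rw [deg_sub_ε]
    ring
  · rw [← negOnePow_add_mul, ← negOnePow_add_mul, ← negOnePow_add_mul]
    refine negOnePow_congr ⟨q - deg b, ?_⟩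
    rw [← hq]
    ring

theorem RdLin_unitLin (q q' i i' : ℤ) (hq : q + n = i) (hq' : q' + n = i') (hi : i + 1 = i')
    (z : N.obj.X q) :
    RdLin (LObj N) i i' hi (unitLin N q i hq z) =
      ((n : ℤ).negOnePow : ℤ) • unitLin N q' i' hq' ((N.obj.d q q').lin z) := by
  rw [unitLin_apply, map_sum, unitLin_apply,
    Finset.sum_congr rfl fun b _ => RdLin_unitTerm N q q' i i' hq hq' hi b z,
    Finset.sum_add_distrib, ← Finset.smul_sum, Finset.sum_comm, Finset.sum_eq_zero, zero_add]
  · refine congrArg _ (sum_eq_sum_of_equiv (Equiv.refl _) _ _ _ _ (fun b hb => ?_)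
      (fun b hb => unitTerm_eq_zero N q' i' hq' b _ hb) fun b => rfl)
    rw [unitTerm_apply, Rlof_eq_zero, smul_zero]
    intro y
    refine Llof_eq_zero N.obj _ _ _ ?_
    refine (map_proj_smul (N.obj.d q q') b y z).symm.trans ?_
    rw [proj_eq_zero_of_notMem_degs _ hb, map_zero]
  · intro l _
    rw [Finset.sum_sub_distrib, sub_eq_zero]
    refine (sum_eq_sum_of_equiv (Equiv.subRight (ε l)) _ _ _ _ (fun b hb => ?_) (fun b hb => ?_)
      fun b => rfl).symm
    · exact unitKos_sub_eq_zero N q i' _ l b z hb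
    · exact unitKos_eq_zero N q i' _ l b z hb

/-- Evaluation at `y`, followed by the inclusion of the homogeneous component. -/
def ExtHom.evalLin {A : Type u} [AddCommGroup A] [Module k A] (V : Submodule k A) (y : Ext k n) :
    ExtHom k n V →ₗ[k] A where
  toFun f := (f y : A)
  map_add' _ _ := rfl
  map_smul' _ _ := rfl

/-- `Ldiv` as an operator on the components of the complex `L(N)`. -/
def LXdiv (j : ℤ) (l : Fin n) : (LObj N).X j →ₗ[k] (LObj N).X j := Ldiv N.obj j l

theorem LXdiv_mem (j l a) (m : (LObj N).X j) (hm : m ∈ ((LObj N).X j).gr a) :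
    LXdiv N j l m ∈ ((LObj N).X j).gr (a - ε l) := Ldiv_mem N.obj j l a m hm

theorem LXdiv_smul (j l) (m : (LObj N).X j) : LXdiv N j l (x k l • m) = m :=
  Ldiv_smul N.obj j l m

theorem LXdiv_smul_of_ne (j l l') (m : (LObj N).X j) (h : l ≠ l') :
    LXdiv N j l (x k l' • m) = x k l' • LXdiv N j l m :=
  Ldiv_smul_of_ne N.obj j l l' m h

/-- `Lconst` as a map on the components of the complex `L(N)`. -/
def LXconst (j q : ℤ) : (LObj N).X j →ₗ[k] N.obj.X q := Lconst N.obj j q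

theorem LXconst_smul (j q : ℤ) (l : Fin n) (m : (LObj N).X j) : LXconst N j q (x k l • m) = 0 :=
  Lconst_smul N.obj j q l m

theorem LXconst_d (j j' q q' : ℤ) (hj : j + 1 = j') (hq : q + 1 = q') (m : (LObj N).X j) :
    LXconst N j' q' (((LObj N).d j j').lin m) =
      (j.negOnePow : ℤ) • (N.obj.d q q').lin (LXconst N j q m) :=
  (congrArg (Lconst N.obj j' q') (LObj_d_lin N j j' hj m)).trans
    (Lconst_LdLin N.obj j j' q q' hj hq m)

theorem LXconst_mem (j q : ℤ) (a) (m : (LObj N).X j) (hm : m ∈ ((LObj N).X j).gr a) :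
    LXconst N j q m ∈ (N.obj.X q).gr (a - one) := Lconst_mem N.obj j q a m hm

theorem LXconst_unitComp (q j : ℤ) (b : Fin n → ℤ) (hj : q - deg b = j) (z : N.obj.X q)
    (y : Ext k n) : LXconst N j q (unitComp N q j b hj z y : (LObj N).X j) =
      proj (N.obj.X q).isInternal b (y • z) := by
  have h1 : coeffS 0 (1 : Sym k n) = (1 : k) := MvPolynomial.coeff_zero_one
  exact (Lconst_lof N.obj j q b hj 1 _).trans (by rw [h1, one_smul])

/-- The iterated remainder on `L(N)`. -/
def Lrems (N : CochainComplex (GrE k n) ℤ) (j : ℤ) (ls : List (Fin n)) :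
    LSum N j →ₗ[k] LSum N j :=
  DirectSum.lmap fun _ : LIdx n j => SymTensor.mapLeft (remX ls)

theorem Lrems_lof (N : CochainComplex (GrE k n) ℤ) (i : ℤ) (ls : List (Fin n)) (j : ℤ)
    (a : Fin n → ℤ) (hp : j - deg a = i) (s : Sym k n) (y : (N.X j).gr a) :
    Lrems N i ls (Llof N j a hp (SymTensor.tmul s y)) =
      Llof N j a hp (SymTensor.tmul (remX ls s) y) :=
  DirectSum.lmap_lof (R := k) (ι := LIdx n i) (M := LSummand N) (N := LSummand N)
    (fun _ : LIdx n i => SymTensor.mapLeft (remX ls)) (⟨(j, a), hp⟩ : LIdx n i) _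

theorem Lrems_cons (N : CochainComplex (GrE k n) ℤ) (i : ℤ) (l : Fin n) (ls : List (Fin n))
    (F : LSum N i) :
    Lrems N i (l :: ls) F = Lrems N i ls F - x k l • Ldiv N i l (Lrems N i ls F) := by
  induction F using LSum_induction with
  | zero => simp
  | add F G hF hG => simp only [map_add, hF, hG, smul_add]; abel
  | lof j a hp s y =>
    rw [Lrems_lof, Lrems_lof, Ldiv_lof, smul_Llof, ← map_sub]
    refine congrArg _ ?_
    exact TensorProduct.sub_tmul (R := k) _ _ _

theorem coe_remGrs (j : ℤ) (a : Fin n → ℤ) (ls : List (Fin n)) (g : ((LObj N).X j).gr a) :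
    (remGrs (LXdiv N) (LXdiv_mem N) j a ls g : (LObj N).X j) =
      (show LSum N.obj j from Lrems N.obj j ls (g : (LObj N).X j)) := by
  induction ls with
  | nil =>
    refine Eq.symm ?_
    change Lrems N.obj j [] (g : (LObj N).X j) = (g : (LObj N).X j)
    generalize (g : (LObj N).X j) = F
    refine LSum_induction N.obj (P := fun F => Lrems N.obj j [] F = F) F (map_zero _)
      (fun F G hF hG => by rw [map_add, hF, hG]) fun j a hp s y => ?_
    rw [Lrems_lof]
    rfl
  | cons l ls ih =>
    refine Eq.trans ?_ (Lrems_cons N.obj j l ls (g : (LObj N).X j)).symm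
    refine Eq.trans (b := (remGrs (LXdiv N) (LXdiv_mem N) j a ls g : (LObj N).X j) -
      x k l • LXdiv N j l (remGrs (LXdiv N) (LXdiv_mem N) j a ls g : (LObj N).X j)) rfl ?_
    rw [ih]
    rfl

theorem Lrems_eq_zero (j q : ℤ) (a : Fin n → ℤ) (hp : j + deg a = q + n) (ls : List (Fin n))
    (hls : ∀ l, l ∈ ls) (F : LSum N.obj j) (hF : F ∈ LSumGr N.obj j a)
    (h : Lconst N.obj j q F = 0) : Lrems N.obj j ls F = 0 := by
  have hq : q - deg (a - one) = j := by rw [deg_sub_one]; lia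
  have key : Lrems N.obj j ls F = Llof N.obj q (a - one) hq (SymTensor.tmul 1
      ⟨Lconst N.obj j q F, Lconst_mem N.obj j q a F hF⟩) := by
    have key' : Lrems N.obj j ls F = Llof N.obj q (a - one) hq (SymTensor.tmul 1
      ⟨proj (N.obj.X q).isInternal (a - one) (Lconst N.obj j q F), proj_mem _ _ _⟩) := by
      clear h
      refine LSumGr_induction N.obj (P := fun F => Lrems N.obj j ls F =
        Llof N.obj q (a - one) hq (SymTensor.tmul 1
        ⟨proj (N.obj.X q).isInternal (a - one) (Lconst N.obj j q F), proj_mem _ _ _⟩)) hF ?_ ?_ ?_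
      · rw [map_zero]
        refine (Llof_eq_zero N.obj _ _ _ ?_).symm
        change proj _ _ (Lconst N.obj j q 0) = 0
        rw [map_zero, map_zero]
      · intro F G hF hG
        rw [map_add, hF, hG, ← map_add, ← SymTensor.tmul_add]
        refine Llof_congr N.obj rfl _ _ _ _ rfl _ _ ?_
        change proj _ _ (Lconst N.obj j q F) + proj _ _ (Lconst N.obj j q G) =
          proj _ _ (Lconst N.obj j q (F + G))
        rw [map_add, map_add]
      · intro j' a' hp' s hs y
        rw [Lrems_lof, remX_all hls, smul_one_tmul]
        by_cases ha : a - one - a' = 0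
        · obtain rfl : a - one = a' := sub_eq_zero.1 ha
          obtain rfl : j' = q := by lia
          refine Llof_congr N.obj rfl _ _ _ _ rfl _ _ ?_
          change coeffS 0 s • (y : N.obj.X j') = proj _ _ (Lconst N.obj j j' _)
          rw [Lconst_lof, map_smul, proj_of_mem _ y.2]
        · rw [Llof_eq_zero, Llof_eq_zero]
          · change proj _ _ (Lconst N.obj j q _) = 0
            by_cases hj : j' = q
            · subst hj
              rw [Lconst_lof, coeffS_zero_eq_zero ha hs, zero_smul, map_zero]
            · rw [Lconst_lof_of_ne N.obj j q j' a' hp' hj, map_zero]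
          · rw [coeffS_zero_eq_zero ha hs, zero_smul]; rfl
    refine key'.trans (Llof_congr N.obj rfl _ _ _ _ rfl _ _ ?_)
    exact proj_of_mem _ (Lconst_mem N.obj j q a F hF)
  rw [key, Llof_eq_zero N.obj _ _ _ h]

/-- The left inverse of the unit. -/
def counitLin (q i : ℤ) : RSum (LObj N) i →ₗ[k] N.obj.X q :=
  DirectSum.toModule k (RIdx n i) _ fun p => (((i + 1) * (q - p.1.1)).negOnePow : ℤ) •
    (LXconst N p.1.1 q ∘ₗ ExtHom.evalLin (((LObj N).X p.1.1).gr p.1.2) 1)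

theorem counitLin_lof (q i j : ℤ) (a : Fin n → ℤ) (hp : j + deg a = i)
    (f : ExtHom k n (((LObj N).X j).gr a)) :
    counitLin N q i (Rlof (LObj N) j a hp f) = (((i + 1) * (q - j)).negOnePow : ℤ) •
      LXconst N j q (f 1 : (LObj N).X j) :=
  DirectSum.toModule_lof k (ι := RIdx n i) (M := RSummand (LObj N)) (⟨(j, a), hp⟩ : RIdx n i) f

theorem counitLin_RdLin (q q' i i' : ℤ) (hq : q + n = i) (hq' : q' + n = i') (hi : i + 1 = i')
    (F : RSum (LObj N) i) :
    counitLin N q' i' (RdLin (LObj N) i i' hi F) =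
      ((n : ℤ).negOnePow : ℤ) • (N.obj.d q q').lin (counitLin N q i F) := by
  induction F using RSum_induction with
  | zero => simp
  | add F G hF hG => rw [map_add, map_add, hF, hG, map_add, map_add, smul_add]
  | lof j a hp f =>
    have h0 : ∀ l, counitLin N q' i' (Rlof (LObj N) j (a + ε l) (RIdx.up hp hi l)
        (ExtHom.map (grSmul ((LObj N).X j) (x_mem k l) (add_comm (ε l) a)) (ExtHom.pre l f)))
        = 0 := fun l => by
      rw [counitLin_lof, ExtHom.map_apply, coe_grSmul, LXconst_smul, smul_zero]
    rw [RdLin_lof, map_add, map_sum, Finset.sum_eq_zero fun l _ => h0 l, zero_add, map_zsmul,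
      counitLin_lof, counitLin_lof, ExtHom.map_apply, coe_grMap,
      LXconst_d N j (j + 1) q q' rfl (by lia), map_zsmul, smul_smul, smul_smul, smul_smul,
      ← negOnePow_add_mul, ← negOnePow_add_mul, ← negOnePow_add_mul]
    refine congrArg (· • _) (negOnePow_congr ⟨q, ?_⟩)
    obtain rfl : q' = q + 1 := by lia
    rw [← hi, ← hq]
    ring

theorem counitLin_unitLin (q i : ℤ) (hq : q + n = i) (z : N.obj.X q) :
    counitLin N q i (unitLin N q i hq z) = z := by
  refine Eq.trans ?_ (sum_proj_degs (N.obj.X q) z)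
  rw [unitLin_apply, map_sum]
  refine Finset.sum_congr rfl fun b _ => ?_
  rw [unitTerm_apply, map_zsmul, counitLin_lof, LXconst_unitComp, smul_smul,
    ← negOnePow_add_mul, one_smul, negOnePow_congr (b := 0) ⟨(i + 1) * deg b, by ring⟩]
  simp

theorem counitLin_kosContr (q : ℤ) (l : Fin n) (i i' : ℤ) (hi : i' + 1 = i)
    (F : RSum (LObj N) i) :
    counitLin N q i' (kosContr (LXdiv N) (LXdiv_mem N) l i i' hi F) = 0 := by
  induction F using RSum_induction with
  | zero => simp
  | add F G hF hG => rw [map_add, map_add, hF, hG, add_zero]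
  | lof j a hp f =>
    rw [kosContr_lof, counitLin_lof, ExtHom.bicomp_apply, contr_one, map_zero, map_zero,
      Submodule.coe_zero, map_zero, smul_zero]

/-- The component of an element of `R(M)`. -/
def RComp {M : CochainComplex (GrS k n) ℤ} {i : ℤ} (p : RIdx n i) :
    RSum M i →ₗ[k] RSummand M p :=
  DirectSum.component k (RIdx n i) (RSummand M) p

theorem RComp_lof_same {M : CochainComplex (GrS k n) ℤ} {i : ℤ} (p : RIdx n i)
    (f : RSummand M p) : RComp p (Rlof M p.1.1 p.1.2 p.2 f) = f :=
  DirectSum.of_eq_same (β := RSummand M) p f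

theorem RComp_lof_of_ne {M : CochainComplex (GrS k n) ℤ} {i : ℤ} (p p' : RIdx n i) (h : p' ≠ p)
    (f : RSummand M p') : RComp p (Rlof M p'.1.1 p'.1.2 p'.2 f) = 0 :=
  DirectSum.of_eq_of_ne (β := RSummand M) p' p f h.symm

theorem LXconst_RComp (q i : ℤ) (p : RIdx n i) (F : RSum (LObj N) i) :
    LXconst N p.1.1 q (RComp p F 1 : (LObj N).X p.1.1) =
      (((i + 1) * (q - p.1.1)).negOnePow : ℤ) •
        proj (N.obj.X q).isInternal (p.1.2 - one) (counitLin N q i F) := by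
  induction F using RSum_induction with
  | zero =>
    rw [map_zero, map_zero, ExtHom.zero_apply, Submodule.coe_zero, map_zero, map_zero, smul_zero]
  | add F G hF hG =>
    rw [map_add, map_add, ExtHom.add_apply, Submodule.coe_add, map_add, map_add, hF, hG, smul_add]
  | lof j a hp f =>
    rw [counitLin_lof, map_zsmul, smul_smul]
    by_cases h : (⟨(j, a), hp⟩ : RIdx n i) = p
    · subst h
      have h1 := RComp_lof_same (⟨(j, a), hp⟩ : RIdx n i) f
      dsimp only at h1 ⊢
      rw [h1, negOnePow_mul_self, one_smul,
        proj_of_mem _ (LXconst_mem N j q a _ (f 1).2)]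
    · have h1 := RComp_lof_of_ne p (⟨(j, a), hp⟩ : RIdx n i) h f
      dsimp only at h1
      rw [h1, ExtHom.zero_apply, Submodule.coe_zero, map_zero,
        proj_of_mem_ne _ (LXconst_mem N j q a _ (f 1).2), smul_zero]
      intro h2
      have h3 : a = p.1.2 := sub_left_injective h2
      have h4 := p.2
      subst h3
      exact h (Subtype.ext (Prod.ext (by dsimp only; lia) rfl))

theorem RComp_kosProjs {M : CochainComplex (GrS k n) ℤ} (ξ) (hξ) (i : ℤ) (ls : List (Fin n))
    (F : RSum M i) (p : RIdx n i) :
    RComp p (kosProjs ξ hξ i ls F) =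
      ExtHom.bicomp (remGrs ξ hξ p.1.1 p.1.2 ls) (killE ls) (RComp p F) := by
  induction ls with
  | nil => rfl
  | cons l ls ih =>
    refine Eq.trans (b := ExtHom.bicomp (remGr ξ hξ p.1.1 l p.1.2)
      (contr l ∘ₗ LinearMap.mulLeft k (e k l)) (RComp p (kosProjs ξ hξ i ls F))) rfl ?_
    rw [ih]
    rfl

theorem kosProjs_eq_zero (q i : ℤ) (hq : q + n = i) (ls : List (Fin n)) (hls : ∀ l, l ∈ ls)
    (F : RSum (LObj N) i) (hF : counitLin N q i F = 0) :
    kosProjs (LXdiv N) (LXdiv_mem N) i ls F = 0 := by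
  refine DFinsupp.ext fun p => ?_
  refine (RComp_kosProjs (LXdiv N) (LXdiv_mem N) i ls F p).trans (ExtHom.ext fun y => ?_)
  rw [ExtHom.bicomp_apply]
  obtain ⟨r, hr⟩ := exists_killE hls y
  refine Subtype.ext ((coe_remGrs N _ _ _ _).trans ?_)
  refine Lrems_eq_zero N _ q p.1.2 (p.2.trans hq.symm) ls hls _ (RComp p F (killE ls y)).2 ?_
  have h1 := LXconst_RComp N q i p F
  rw [hF, map_zero, smul_zero] at h1
  have h2 : LXconst N p.1.1 q (RComp p F (killE ls y) : (LObj N).X p.1.1) = 0 := by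
    rw [hr, map_smul, Submodule.coe_smul, map_smul, h1, smul_zero]
  exact h2

theorem exists_RdLin_eq (q i' i i'' : ℤ) (hq : q + n = i) (hi : i' + 1 = i) (hi' : i + 1 = i'')
    (F : RSum (LObj N) i) (hdF : RdLin (LObj N) i i'' hi' F = 0) (hF : counitLin N q i F = 0) :
    ∃ G, RdLin (LObj N) i' i hi G = F := by
  obtain ⟨α, β, hα, hβ⟩ := isBounded_LObj N
  suffices ∀ (m : ℕ) (t : ℤ), β < t + m → ∀ F ∈ RCofil (LObj N) i t,
      RdLin (LObj N) i i'' hi' F = 0 → counitLin N q i F = 0 →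
      ∃ G, RdLin (LObj N) i' i hi G = F from
    this (β + 1 - α).toNat α (by lia) F (mem_RCofil (LObj N) i α F) hdF hF
  intro m
  induction m with
  | zero =>
    intro t ht F hFt _ _
    exact ⟨0, by rw [map_zero, eq_zero_of_mem_RCofil (LObj N) i β t (by simpa using ht) F hFt]⟩
  | succ m ih =>
    intro t ht F hFt hdF hF
    obtain ⟨G, hG, hG₁, hG₂⟩ := exists_sub_kosProjs_mem (LXdiv N) (LXdiv_mem N) (LXdiv_smul N)
      (LXdiv_smul_of_ne N)
      i' i i'' hi hi' (List.finRange n) (LinearMap.ker (counitLin N (q - 1) i')).toAddSubgroup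
      (fun l F => counitLin_kosContr N (q - 1) l i i' hi F) t F hFt hdF
    rw [kosProjs_eq_zero N q i hq _ List.mem_finRange F hF, sub_zero] at hG₂
    obtain ⟨G', hG'⟩ := ih (t + 1) (by push_cast at ht; lia) (F - RdLin (LObj N) i' i hi G) hG₂
      (by rw [map_sub, hdF, RdLin_RdLin, sub_zero]) (by
        have : counitLin N (q - 1) i' G = 0 := hG
        rw [map_sub, hF, counitLin_RdLin N (q - 1) q i' i (by lia) hq hi, this, map_zero,
          smul_zero, sub_zero])
    exact ⟨G' + G, by rw [map_add, hG', sub_add_cancel]⟩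

/-- The unit `N[-n] ⟶ R(L(N))`. -/
def unitHom : N.obj⟦-(n : ℤ)⟧ ⟶ RObj ((functorL k n).obj N) where
  f i := ⟨unitLin N (i + -(n : ℤ)) i (by ring), unitLin_mem N _ _ _⟩
  comm' i i' hi := GrMod.hom_ext fun z => by
    refine (RObj_d_lin ((functorL k n).obj N) i i' hi _).trans ?_
    refine (RdLin_unitLin N (i + -(n : ℤ)) (i' + -(n : ℤ)) i i' (by ring) (by ring) hi z).trans ?_
    refine Eq.trans ?_ (congrArg (fun f : N.obj.X (i + -(n : ℤ)) ⟶ N.obj.X (i' + -(n : ℤ)) =>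
      unitLin N (i' + -(n : ℤ)) i' (by ring) (f.lin z))
      (CochainComplex.shiftFunctor_obj_d' N.obj (-(n : ℤ)) i i')).symm
    have key : ∀ z : N.obj.X (i + -(n : ℤ)), ((n : ℤ).negOnePow : ℤ) •
        unitLin N (i' + -(n : ℤ)) i' (by ring) ((N.obj.d (i + -(n : ℤ)) (i' + -(n : ℤ))).lin z) =
        unitLin N (i' + -(n : ℤ)) i' (by ring)
          (((-(n : ℤ)).negOnePow • N.obj.d (i + -(n : ℤ)) (i' + -(n : ℤ))).lin z) := fun z => by
      rw [GrMod.units_smul_lin, LinearMap.smul_apply, map_zsmul, Int.negOnePow_neg]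
    exact key z

theorem exists_of_unitLin_add (q q' i j l : ℤ) (hq : q + n = j) (hq' : q' + n = l)
    (hij : i + 1 = j) (hjl : j + 1 = l) (z : N.obj.X q') (F : RSum (LObj N) j)
    (h : unitLin N q' l hq' z + RdLin (LObj N) j l hjl F = 0) :
    ∃ (z' : N.obj.X q) (F' : RSum (LObj N) i),
      ((n : ℤ).negOnePow : ℤ) • (N.obj.d q q').lin z' = -z ∧
      unitLin N q j hq z' + RdLin (LObj N) i j hij F' = F := by
  have h1 := congrArg (counitLin N q' l) h
  rw [map_add, counitLin_unitLin, counitLin_RdLin N q q' j l hq hq' hjl, map_zero] at h1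
  have h2 := eq_neg_of_add_eq_zero_right h1
  obtain ⟨F', hF'⟩ := exists_RdLin_eq N q i j l hq hij hjl
    (F - unitLin N q j hq (counitLin N q j F)) (by
      rw [map_sub, RdLin_unitLin N q q' j l hq hq' hjl, ← map_zsmul, h2, map_neg, sub_neg_eq_add,
        add_comm, h]) (by rw [map_sub, counitLin_unitLin, sub_self])
  exact ⟨counitLin N q j F, F', h2, by rw [hF', add_sub_cancel]⟩

theorem quasiIso_unitHom : QuasiIso (unitHom N) := by
  refine quasiIso_of_elements _ fun i j l hij hjl z F _ hF => ?_
  rw [RObj_d_lin ((functorL k n).obj N) j l hjl F] at hF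
  obtain ⟨z', F', h1, h2⟩ := exists_of_unitLin_add N (j + -(n : ℤ)) (l + -(n : ℤ)) i j l (by ring)
    (by ring) hij hjl z F hF
  refine ⟨z', F', Eq.trans ?_ h1, Eq.trans (congrArg _ ?_) h2⟩
  · refine (congrArg (fun f : N.obj.X (j + -(n : ℤ)) ⟶ N.obj.X (l + -(n : ℤ)) => f.lin z')
      (CochainComplex.shiftFunctor_obj_d' N.obj (-(n : ℤ)) j l)).trans ?_
    have key : ∀ z : N.obj.X (j + -(n : ℤ)),
        (((-(n : ℤ)).negOnePow • N.obj.d (j + -(n : ℤ)) (l + -(n : ℤ))).lin z) =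
        ((n : ℤ).negOnePow : ℤ) • ((N.obj.d (j + -(n : ℤ)) (l + -(n : ℤ))).lin z) := fun z => by
      rw [GrMod.units_smul_lin, LinearMap.smul_apply, Int.negOnePow_neg]
    exact key z'
  · exact RObj_d_lin ((functorL k n).obj N) i j hij F'

variable (k n) in
/-- The natural transformation `[-n] ⟶ R ∘ L` on complexes. -/
def unitNatTrans : (isBounded (GrE k n)).ι ⋙ CategoryTheory.shiftFunctor _ (-(n : ℤ)) ⟶
    functorL k n ⋙ functorR k n where
  app N := unitHom N
  naturality N N' φ := HomologicalComplex.hom_ext _ _ fun i => GrMod.hom_ext fun z =>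
    (unitLin_naturality φ (i + -(n : ℤ)) i (by ring) z).symm

end Unit

section Evaluation

variable {k : Type u} [Field k] {n : ℕ} (M : CochainComplex (GrS k n) ℤ)

theorem RSumGr_induction {i : ℤ} {b : Fin n → ℤ} {P : RSum M i → Prop} {F : RSum M i}
    (hF : F ∈ RSumGr M i b) (zero : P 0) (add : ∀ F G, P F → P G → P (F + G))
    (lof : ∀ j a hp, ∀ f ∈ ExtHom.gr k n ((M.X j).gr a) a b, P (Rlof M j a hp f)) : P F := by
  classical
  let F' : ⨁ p : RIdx n i, RSummand M p := F
  have h1 : F = ∑ p ∈ DFinsupp.support F', Rlof M p.1.1 p.1.2 p.2 (F' p) :=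
    (DirectSum.sum_support_of (β := fun p : RIdx n i => RSummand M p) F').symm
  rw [h1]
  exact Finset.sum_induction _ P add zero fun p _ => lof _ _ p.2 _ (hF p)

/-- The sum of the evaluations at `1 ∈ E` of the components of an element of `R(M)` which lie
in cohomological degree `p` of `M`. -/
def REval (i p : ℤ) : RSum M i →ₗ[k] M.X p :=
  DirectSum.toModule k (RIdx n i) _ fun q => if h : q.1.1 = p then
    h ▸ ExtHom.evalLin ((M.X q.1.1).gr q.1.2) 1 else 0

theorem REval_lof (i p : ℤ) (a : Fin n → ℤ) (hp : p + deg a = i) (f : ExtHom k n ((M.X p).gr a)) :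
    REval M i p (Rlof M p a hp f) = f 1 := by
  refine (DirectSum.toModule_lof k (ι := RIdx n i) (M := RSummand M)
    (⟨(p, a), hp⟩ : RIdx n i) _).trans ?_
  rw [dif_pos rfl]
  rfl

theorem REval_lof_of_ne (i p j : ℤ) (a : Fin n → ℤ) (hp : j + deg a = i) (hj : j ≠ p)
    (f : ExtHom k n ((M.X j).gr a)) : REval M i p (Rlof M j a hp f) = 0 := by
  refine (DirectSum.toModule_lof k (ι := RIdx n i) (M := RSummand M)
    (⟨(j, a), hp⟩ : RIdx n i) _).trans ?_
  rw [dif_neg hj]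
  rfl

theorem ExtHom.apply_one_of_ne {V : Type u} [AddCommGroup V] [Module k V] {a b : Fin n → ℤ}
    {f : ExtHom k n V} (hf : f ∈ ExtHom.gr k n V a b) (h : b + one ≠ a) : f 1 = 0 :=
  hf one h 1 (by rw [sub_self]; exact SetLike.GradedOne.one_mem)

theorem REval_mem (i p : ℤ) (b : Fin n → ℤ) (F : RSum M i) (hF : F ∈ RSumGr M i b) :
    REval M i p F ∈ (M.X p).gr (b + one) := by
  refine RSumGr_induction M (P := fun F => REval M i p F ∈ (M.X p).gr (b + one)) hF ?_ ?_ ?_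
  · rw [map_zero]; exact zero_mem _
  · intro F G hF hG; rw [map_add]; exact add_mem hF hG
  · intro j a hp f hf
    by_cases hj : j = p
    · subst hj
      rw [REval_lof]
      by_cases ha : b + one = a
      · subst ha; exact (f 1).2
      · rw [ExtHom.apply_one_of_ne hf ha]; exact zero_mem _
    · rw [REval_lof_of_ne M i p j a hp hj]; exact zero_mem _

theorem REval_eq_zero (i p : ℤ) (b : Fin n → ℤ) (F : RSum M i) (hF : F ∈ RSumGr M i b)
    (h : p + deg (b + one) ≠ i) : REval M i p F = 0 := by
  refine RSumGr_induction M (P := fun F => REval M i p F = 0) hF (map_zero _) ?_ ?_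
  · intro F G hF hG; rw [map_add, hF, hG, add_zero]
  · intro j a hp f hf
    by_cases hj : j = p
    · subst hj
      rw [REval_lof, ExtHom.apply_one_of_ne hf fun ha => h (ha ▸ hp)]; rfl
    · exact REval_lof_of_ne M i p j a hp hj f

theorem REval_RMapLin {M M' : CochainComplex (GrS k n) ℤ} (φ : M ⟶ M') (i p : ℤ) (F : RSum M i) :
    REval M' i p (RMapLin φ i F) = (φ.f p).lin (REval M i p F) := by
  induction F using RSum_induction with
  | zero => simp
  | add F G hF hG => simp only [map_add, hF, hG]
  | lof j a hp f =>
    rw [RMapLin_lof]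
    by_cases hj : j = p
    · subst hj
      rw [REval_lof, REval_lof]
      rfl
    · rw [REval_lof_of_ne M i p j a hp hj, REval_lof_of_ne M' i p j a hp hj, map_zero]

theorem REval_RdLin (i i' p p' : ℤ) (hi : i + 1 = i') (hp : p + 1 = p') (F : RSum M i) :
    REval M i' p' (RdLin M i i' hi F) = (∑ l : Fin n, x k l • REval M i p' (e k l • F)) +
      (i.negOnePow : ℤ) • (M.d p p').lin (REval M i p F) := by
  induction F using RSum_induction with
  | zero => simp
  | add F G hF hG =>
    simp only [map_add, smul_add, hF, hG, Finset.sum_add_distrib]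
    abel
  | lof j a hp' f =>
    rw [RdLin_lof, map_add, map_sum, map_zsmul]
    refine congrArg₂ (· + ·) (Finset.sum_congr rfl fun l _ => ?_) (congrArg _ ?_)
    · rw [← map_smul (Rlof M j a hp')]
      by_cases hj : j = p'
      · subst hj
        rw [REval_lof, REval_lof]
        change x k l • (f (e k l * 1) : M.X j) = x k l • (f (1 * e k l) : M.X j)
        rw [mul_one, one_mul]
      · rw [REval_lof_of_ne _ _ _ _ _ _ hj, REval_lof_of_ne _ _ _ _ _ _ hj, smul_zero]
    · by_cases hj : j = p
      · subst hj hp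
        rw [REval_lof, REval_lof]
        rfl
      · rw [REval_lof_of_ne _ _ _ _ _ _ hj, REval_lof_of_ne _ _ _ _ _ _ (by lia), map_zero]

theorem proj_REval (i p : ℤ) (a : Fin n → ℤ) (hp : p + deg a = i) (F : ⨁ q : RIdx n i, RSummand M q) :
    proj (M.X p).isInternal a (REval M i p F) = (F ⟨(p, a), hp⟩ 1 : (M.X p).gr a) := by
  refine RSum_induction M (P := fun F : ⨁ q : RIdx n i, RSummand M q =>
    proj (M.X p).isInternal a (REval M i p F) = (F ⟨(p, a), hp⟩ 1 : (M.X p).gr a)) F ?_ ?_ ?_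
  · rw [map_zero, map_zero]; rfl
  · intro F G hF hG
    rw [map_add, map_add, hF, hG]; rfl
  · intro j b hp' f
    by_cases hj : j = p
    · subst hj
      rw [REval_lof]
      by_cases hb : b = a
      · subst hb
        rw [proj_of_mem _ (f 1).2]
        refine congrArg (fun g : ExtHom k n ((M.X j).gr b) => (g 1 : M.X j)) ?_
        exact (DirectSum.lof_apply (Ext k n) (M := RSummand M) (⟨(j, b), hp'⟩ : RIdx n i) f).symm
      · rw [proj_of_mem_ne _ (f 1).2 hb]
        have : (⟨(j, b), hp'⟩ : RIdx n i) ≠ ⟨(j, a), hp⟩ := fun h =>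
          hb (congrArg (fun q : RIdx n i => q.1.2) h)
        have h2 := DirectSum.of_eq_of_ne (β := RSummand M) (⟨(j, b), hp'⟩ : RIdx n i)
          ⟨(j, a), hp⟩ f this.symm
        exact (congrArg (fun g : ExtHom k n ((M.X j).gr a) => (g 1 : M.X j)) h2).symm
    · rw [REval_lof_of_ne _ _ _ _ _ _ hj, map_zero]
      have : (⟨(j, b), hp'⟩ : RIdx n i) ≠ ⟨(p, a), hp⟩ := fun h =>
          hj (congrArg (fun q : RIdx n i => q.1.1) h)
      have h2 := DirectSum.of_eq_of_ne (β := RSummand M) (⟨(j, b), hp'⟩ : RIdx n i)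
          ⟨(p, a), hp⟩ f this.symm
      exact (congrArg (fun g : ExtHom k n ((M.X p).gr a) => (g 1 : M.X p)) h2).symm

theorem eq_zero_of_REval (i : ℤ) (F : RSum M i) (h : ∀ (y : Ext k n) p, REval M i p (y • F) = 0) :
    F = 0 := by
  let F' : ⨁ q : RIdx n i, RSummand M q := F
  suffices F' = 0 from this
  refine DFinsupp.ext fun q => ExtHom.ext fun y => Subtype.ext ?_
  have := proj_REval M i q.1.1 q.1.2 q.2 (y • F)
  rw [h, map_zero] at this
  refine Eq.trans ?_ this.symm
  change (F' q y : M.X q.1.1) = (F' q (1 * y) : M.X q.1.1)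
  rw [one_mul]

section Coinduction

variable (X : GrE k n)

/-- The components of the morphism to `R(M)` given by linear maps. -/
def coindComp {p : ℤ} (γ : X →ₗ[k] M.X p) (a : Fin n → ℤ) :
    X →ₗ[Ext k n] ExtHom k n ((M.X p).gr a) where
  toFun z := ({
    toFun := fun y => ⟨proj (M.X p).isInternal a (γ (y • z)), proj_mem _ _ _⟩
    map_add' := fun y y' => Subtype.ext (by
      change proj _ a (γ ((y + y') • z)) = proj _ a (γ (y • z)) + proj _ a (γ (y' • z))
      rw [add_smul, map_add, map_add])
    map_smul' := fun c y => Subtype.ext (by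
      change proj _ a (γ ((c • y) • z)) = c • proj _ a (γ (y • z))
      rw [smul_assoc, map_smul, map_smul]) } : Ext k n →ₗ[k] (M.X p).gr a)
  map_add' z z' := ExtHom.ext fun y => Subtype.ext (by
    change proj _ a (γ (y • (z + z'))) = proj _ a (γ (y • z)) + proj _ a (γ (y • z'))
    rw [smul_add, map_add, map_add])
  map_smul' c z := ExtHom.ext fun y => Subtype.ext (by
    change proj _ a (γ (y • c • z)) = proj _ a (γ ((y * c) • z))
    rw [mul_smul])

theorem coind_deg (i : ℤ) (c : Fin n → ℤ) : i - deg (c + one) + deg (c + one) = i :=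
  sub_add_cancel _ _

variable {X} in
/-- The morphism to `R(M)` given by linear maps. -/
def coindLin (i : ℤ) (γ : ∀ p, X →ₗ[k] M.X p) : X →ₗ[Ext k n] RSum M i :=
  ∑ c ∈ degs X, Rlof M (i - deg (c + one)) (c + one) (coind_deg i c) ∘ₗ
    coindComp M X (γ (i - deg (c + one))) (c + one)

variable {X} (i : ℤ) (γ : ∀ p, X →ₗ[k] M.X p)
  (hγ : ∀ p c, ∀ z ∈ X.gr c, γ p z ∈ (M.X p).gr (c + one))
  (hγ' : ∀ p c, ∀ z ∈ X.gr c, p + deg (c + one) ≠ i → γ p z = 0)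

theorem coindLin_apply (z : X) : coindLin M i γ z = ∑ c ∈ degs X,
    Rlof M (i - deg (c + one)) (c + one) (coind_deg i c)
    (coindComp M X (γ (i - deg (c + one))) (c + one) z) :=
  LinearMap.sum_apply _ _ _

include hγ in
theorem coindLin_mem (c : Fin n → ℤ) (z : X) (hz : z ∈ X.gr c) :
    coindLin M i γ z ∈ RSumGr M i c := by
  rw [coindLin_apply]
  refine Submodule.sum_mem _ fun b _ => ?_
  refine lof_mem_sumGr (R := Ext k n) (fun p : RIdx n i => RSummandGr M p) c
    ⟨(i - deg (b + one), b + one), coind_deg i b⟩ ?_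
  intro c' hc' y hy
  refine Subtype.ext (proj_of_mem_ne _ (hγ _ _ _ (X.smul_mem hy hz)) fun h => hc' ?_)
  refine Eq.trans ?_ h
  abel

theorem REval_lof_coindComp (p j : ℤ) (a : Fin n → ℤ) (hp : j + deg a = i) (z : X) :
    REval M i p (Rlof M j a hp (coindComp M X (γ j) a z)) =
      if j = p then proj (M.X p).isInternal a (γ p z) else 0 := by
  split_ifs with hj
  · subst hj
    rw [REval_lof]
    change proj _ a (γ j ((1 : Ext k n) • z)) = _
    rw [one_smul]
  · exact REval_lof_of_ne _ _ _ _ _ _ hj _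

include hγ hγ' in
theorem REval_coindLin (p : ℤ) (z : X) : REval M i p (coindLin M i γ z) = γ p z := by
  have hm := mem_iSup_of_isInternal X.isInternal z
  induction hm using Submodule.iSup_induction' with
  | mem b z hz =>
    rw [coindLin_apply, map_sum, Finset.sum_congr rfl fun c _ => REval_lof_coindComp M i γ p _ _ _ z]
    by_cases hb : p + deg (b + one) = i
    · rw [Finset.sum_eq_single b, if_pos (by lia), proj_of_mem _ (hγ p b z hz)]
      · intro c _ hc
        rw [proj_of_mem_ne _ (hγ p b z hz) fun h => hc (add_right_cancel h).symm, ite_self]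
      · intro hb'
        have := subsingleton_of_notMem_degs X hb'
        obtain rfl : z = 0 := congrArg Subtype.val (Subsingleton.elim (⟨z, hz⟩ : X.gr b) 0)
        rw [map_zero, map_zero, ite_self]
    · rw [hγ' p b z hz hb]
      exact Finset.sum_eq_zero fun c _ => by rw [map_zero, ite_self]
  | zero => simp
  | add y z _ _ hy hz => simp only [map_add, hy, hz]

end Coinduction

theorem GrMod.exists_retraction {X Y : GrE k n} (f : X ⟶ Y) [Mono f] :
    ∃ r : Y →ₗ[k] X, (∀ c, ∀ y ∈ Y.gr c, r y ∈ X.gr c) ∧ ∀ z, r (f.lin z) = z := by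
  have hf := GrMod.injective_of_mono f
  choose r hr using fun c => (grMap f c).exists_leftInverse_of_injective
    (LinearMap.ker_eq_bot.2 fun z z' h => Subtype.ext (hf (congrArg Subtype.val h)))
  let π (c) : Y →ₗ[k] X := (X.gr c).subtype ∘ₗ r c ∘ₗ
    (proj Y.isInternal c).codRestrict _ (proj_mem _ c)
  have hπ : ∀ c, ∀ y ∈ Y.gr c, ∀ b, b ≠ c → π b y = 0 := fun c y hy b hb => by
    have : (proj Y.isInternal b).codRestrict _ (proj_mem _ b) y = 0 :=
      Subtype.ext (proj_of_mem_ne _ hy hb.symm)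
    change ((r b _ : X.gr b) : X) = 0
    rw [this, map_zero]; rfl
  have key : ∀ c, ∀ y ∈ Y.gr c, (∑ b ∈ degs Y, π b) y = π c y := fun c y hy => by
    rw [LinearMap.sum_apply]
    refine Finset.sum_eq_single c (fun b _ hb => hπ c y hy b hb) fun hc => ?_
    have := subsingleton_of_notMem_degs Y hc
    obtain rfl : y = 0 := congrArg Subtype.val (Subsingleton.elim (⟨y, hy⟩ : Y.gr c) 0)
    rw [map_zero]
  refine ⟨∑ c ∈ degs Y, π c, fun c y hy => ?_, fun z => ?_⟩
  · rw [key c y hy]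
    exact (r c _).2
  · have hm := mem_iSup_of_isInternal X.isInternal z
    induction hm using Submodule.iSup_induction' with
    | mem c z hz =>
      rw [key c _ (f.map_mem c z hz)]
      have h1 : (proj Y.isInternal c).codRestrict _ (proj_mem _ c) (f.lin z) =
        grMap f c ⟨z, hz⟩ := Subtype.ext (proj_of_mem _ (f.map_mem c z hz))
      refine (congrArg (fun t => (r c t : X)) h1).trans ?_
      exact congrArg Subtype.val (LinearMap.congr_fun (hr c) ⟨z, hz⟩)
    | zero => simp
    | add y z _ _ hy hz => simp only [map_add, hy, hz]

instance (M : ComB (GrS k n)) (i : ℤ) : Injective (RX M i) where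
  factors {X Y} g f _ := by
    obtain ⟨r, hr, hr'⟩ := GrMod.exists_retraction f
    let γ (p : ℤ) : Y →ₗ[k] M.obj.X p := REval M.obj i p ∘ₗ g.lin.restrictScalars k ∘ₗ r
    have hγ : ∀ p c, ∀ z ∈ Y.gr c, γ p z ∈ (M.obj.X p).gr (c + one) := fun p c z hz =>
      REval_mem M.obj i p c _ (g.map_mem c _ (hr c z hz))
    have hγ' : ∀ p c, ∀ z ∈ Y.gr c, p + deg (c + one) ≠ i → γ p z = 0 := fun p c z hz h =>
      REval_eq_zero M.obj i p c _ (g.map_mem c _ (hr c z hz)) h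
    refine ⟨⟨coindLin M.obj i γ, coindLin_mem M.obj i γ hγ⟩, GrMod.hom_ext fun z => ?_⟩
    refine sub_eq_zero.1 (eq_zero_of_REval M.obj i
      (coindLin M.obj i γ (f.lin z) - (show RSum M.obj i from g.lin z)) fun y p => ?_)
    have h1 : y • (coindLin M.obj i γ (f.lin z) - (show RSum M.obj i from g.lin z)) =
        coindLin M.obj i γ (f.lin (y • z)) - (show RSum M.obj i from g.lin (y • z)) := by
      rw [smul_sub, ← map_smul, ← map_smul]
      exact congrArg _ (g.lin.map_smul y z).symm
    rw [h1, map_sub, REval_coindLin M.obj i γ hγ hγ', sub_eq_zero]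
    exact congrArg (fun t => REval M.obj i p (g.lin t)) (hr' (y • z))

theorem exists_deg_bound (M : GrS k n) : ∃ d : ℤ, ∀ a, deg a < d → Subsingleton (M.gr a) := by
  obtain ⟨T, hT, h⟩ := M.exists_generators
  obtain ⟨d, hd⟩ := (hT.toFinset.image fun t => deg t.2).bddBelow
  refine ⟨d, fun a ha => Submodule.subsingleton_iff_eq_bot.2 (eq_bot_iff.2 ((h a).trans ?_))⟩
  rw [Submodule.span_le]
  rintro _ ⟨t, ht, s, rfl, -⟩
  have h1 := hd (Finset.mem_image_of_mem (fun t : M × (Fin n → ℤ) => deg t.2) (hT.mem_toFinset.2 ht))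
  rw [deg_add, deg_weight_ε] at ha
  lia

theorem exists_isStrictlyGE_RObj (M : ComB (GrS k n)) : ∃ d : ℤ, (RObj M).IsStrictlyGE d := by
  obtain ⟨a, b, _, _⟩ := M.property
  choose d hd using fun p => exists_deg_bound (M.obj.X p)
  obtain ⟨D, hD⟩ := ((Finset.Icc a b).image fun p => p + d p).bddBelow
  refine ⟨D, (CochainComplex.isStrictlyGE_iff _ _).2 fun i hi => ?_⟩
  have key : ∀ F : RSum M.obj i, F = 0 := fun F => by
    induction F using RSum_induction with
    | zero => rfl
    | add F G hF hG => rw [hF, hG, add_zero]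
    | lof j c hp f =>
      suffices Subsingleton ((M.obj.X j).gr c) from
        Rlof_eq_zero M.obj hp f fun y => congrArg Subtype.val (Subsingleton.elim (f y) 0)
      by_cases hj : j ∈ Finset.Icc a b
      · have := hD (Finset.mem_image_of_mem (fun p => p + d p) hj)
        exact hd j c (by lia)
      · have : IsZero (M.obj.X j) := by
          rw [Finset.mem_Icc, not_and_or, not_le, not_le] at hj
          rcases hj with hj | hj
          · exact M.obj.isZero_of_isStrictlyGE a j hj
          · exact M.obj.isZero_of_isStrictlyLE b j hj
        have := GrMod.subsingleton_of_isZero this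
        infer_instance
  have : Subsingleton (RX M i) := ⟨fun F G => (key F).trans (key G).symm⟩
  exact GrMod.isZero_of_subsingleton (RX M i)

instance (M : ComB (GrS k n)) : (RObj M).IsKInjective := by
  obtain ⟨d, _⟩ := exists_isStrictlyGE_RObj M
  have : ∀ i, Injective ((RObj M).X i) := fun i => inferInstanceAs (Injective (RX M i))
  exact CochainComplex.isKInjective_of_injective _ d

/-- The morphism of `S`-modules out of `S ⊗ V` given by a linear map. -/
def SymTensor.desc {V Y : Type u} [AddCommGroup V] [Module k V] [AddCommGroup Y] [Module k Y]
    [Module (Sym k n) Y] [IsScalarTower k (Sym k n) Y] (g : V →ₗ[k] Y) :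
    SymTensor k n V →ₗ[Sym k n] Y :=
  LinearMap.liftBaseChange (Sym k n) g

theorem SymTensor.desc_tmul {V Y : Type u} [AddCommGroup V] [Module k V] [AddCommGroup Y]
    [Module k Y] [Module (Sym k n) Y] [IsScalarTower k (Sym k n) Y] (g : V →ₗ[k] Y) (s : Sym k n)
    (v : V) : SymTensor.desc g (SymTensor.tmul s v) = s • g v :=
  LinearMap.liftBaseChange_tmul _ _ _ _

instance (N : ComB (GrE k n)) (i : ℤ) : Projective (LX N i) where
  factors {X Y} f g _ := by
    have hg := GrMod.surjective_of_epi g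
    choose σ hσ using fun c => (grMap g c).exists_rightInverse_of_surjective
      (LinearMap.range_eq_top.2 fun y => by
        obtain ⟨z, hz⟩ := hg y
        refine ⟨⟨proj X.isInternal c z, proj_mem _ _ _⟩, Subtype.ext ?_⟩
        refine (map_proj X.isInternal Y.isInternal (g.lin.restrictScalars k) g.map_mem c z).trans ?_
        refine (congrArg (proj Y.isInternal c) hz).trans (proj_of_mem _ y.2))
    have hone : ∀ (j : ℤ) (a : Fin n → ℤ) (hp : j - deg a = i) (y : (N.obj.X j).gr a),
        f.lin (Llof N.obj j a hp (SymTensor.tmul 1 y)) ∈ Y.gr (a + one) := fun j a hp y =>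
      f.map_mem _ _ (Llof_tmul_mem N.obj j a hp (one_mem_symGr_sub a) y)
    let τ (j : ℤ) (a : Fin n → ℤ) (hp : j - deg a = i) : (N.obj.X j).gr a →ₗ[k] Y.gr (a + one) :=
      (f.lin.restrictScalars k ∘ₗ (Llof N.obj j a hp).restrictScalars k ∘ₗ
        TensorProduct.mk k (Sym k n) ((N.obj.X j).gr a) 1).codRestrict _ (hone j a hp)
    let h : LSum N.obj i →ₗ[Sym k n] X := Ldesc N.obj fun j a hp =>
      SymTensor.desc ((X.gr (a + one)).subtype ∘ₗ σ (a + one) ∘ₗ τ j a hp)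
    have h_lof : ∀ j a hp s y, h (Llof N.obj j a hp (SymTensor.tmul s y)) =
        s • (σ (a + one) (τ j a hp y) : X) := fun j a hp s y => by
      rw [Ldesc_lof, SymTensor.desc_tmul]; rfl
    refine ⟨⟨h, fun c F hF => ?_⟩, GrMod.hom_ext fun F => ?_⟩
    · refine LSumGr_induction N.obj (P := fun F => h F ∈ X.gr c) hF ?_ ?_ ?_
      · rw [map_zero]; exact zero_mem _
      · intro F G hF hG; rw [map_add]; exact add_mem hF hG
      · intro j a hp s hs y
        rw [h_lof]
        have := X.smul_mem hs (σ (a + one) (τ j a hp y)).2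
        rwa [show c - one - a + (a + one) = c by abel] at this
    · suffices g.lin ∘ₗ h = f.lin from LinearMap.congr_fun this F
      refine Lhom_ext N.obj fun j a hp s y => ?_
      rw [LinearMap.comp_apply, h_lof, map_smul]
      have h1 : g.lin (σ (a + one) (τ j a hp y)) = f.lin (Llof N.obj j a hp (SymTensor.tmul 1 y)) :=
        congrArg Subtype.val (LinearMap.congr_fun (hσ (a + one)) (τ j a hp y))
      rw [h1]
      refine (f.lin.map_smul s _).symm.trans (congrArg f.lin ?_)
      refine (smul_Llof N.obj s j a hp 1 y).trans ?_
      rw [mul_one]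

instance (N : ComB (GrE k n)) : (LObj N).IsKProjective := by
  obtain ⟨a, b, _, _⟩ := isBounded_LObj N
  have : ∀ i, Projective ((LObj N).X i) := fun i => inferInstanceAs (Projective (LX N i))
  exact CochainComplex.isKProjective_of_projective _ b

end Evaluation

section Transport

variable {k : Type u} [Field k] {n : ℕ} {N : ComB (GrE k n)}

theorem REval_unitLin (q i j : ℤ) (b : Fin n → ℤ) (hq : q + n = i) (hj : q - deg b = j)
    (y : (N.obj.X q).gr b) :
    REval (LObj N) i j (unitLin N q i hq y) = (((i + 1) * deg b).negOnePow : ℤ) •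
      (show (LObj N).X j from Llof N.obj q b hj (SymTensor.tmul 1 y)) := by
  have h0 : ∀ c, c ≠ b → REval (LObj N) i j (unitTerm N q i hq c y) = 0 := fun c hc => by
    by_cases h : q - deg c = j
    · rw [unitTerm_apply' N q j i hq c h (by rw [deg_add, deg_one]; lia), map_zsmul, REval_lof]
      refine smul_eq_zero_of_right _ (Llof_eq_zero N.obj _ _ _ ?_)
      change proj _ c ((1 : Ext k n) • (y : N.obj.X q)) = 0
      rw [one_smul, proj_of_mem_ne _ y.2 hc.symm]
    · rw [unitTerm_apply, map_zsmul, REval_lof_of_ne _ _ _ _ _ _ h, smul_zero]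
  rw [unitLin_apply, map_sum, Finset.sum_eq_single b (fun c _ => h0 c)]
  · rw [unitTerm_apply' N q j i hq b hj (by rw [deg_add, deg_one]; lia), map_zsmul, REval_lof]
    refine congrArg _ (Llof_congr N.obj rfl _ _ _ _ rfl _ _ ?_)
    change proj _ b ((1 : Ext k n) • (y : N.obj.X q)) = y
    rw [one_smul, proj_of_mem _ y.2]
  · intro hb
    rw [unitTerm_eq_zero N q i hq b _ hb, map_zero]

variable {M : CochainComplex (GrS k n) ℤ}

section

variable (ρ : ∀ q i'' : ℤ, N.obj.X q →ₗ[Ext k n] RSum M i'')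

/-- The map `L(N) → M` corresponding to a family of maps `N → R(M)`. -/
def transposeLin (i p : ℤ) : LSum N.obj i →ₗ[Sym k n] M.X p :=
  Ldesc N.obj fun j a _ => (((j + n + 1) * (deg a + 1)).negOnePow : ℤ) •
    SymTensor.desc (REval M (j + n - 1) p ∘ₗ (ρ j (j + n - 1)).restrictScalars k ∘ₗ
      ((N.obj.X j).gr a).subtype)

theorem transposeLin_lof (i p j r : ℤ) (a : Fin n → ℤ) (hp : j - deg a = i) (s : Sym k n)
    (y : (N.obj.X j).gr a) (hr : j + n - 1 = r) :
    transposeLin ρ i p (Llof N.obj j a hp (SymTensor.tmul s y)) =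
      (((j + n + 1) * (deg a + 1)).negOnePow : ℤ) • s • REval M r p (ρ j r y) := by
  subst hr
  rw [transposeLin, Ldesc_lof, LinearMap.smul_apply, SymTensor.desc_tmul]
  rfl

theorem transposeLin_mem (hρ : ∀ q r b, ∀ y ∈ (N.obj.X q).gr b, ρ q r y ∈ RSumGr M r b)
    (i p : ℤ) (c : Fin n → ℤ) (F : LSum N.obj i) (hF : F ∈ LSumGr N.obj i c) :
    transposeLin ρ i p F ∈ (M.X p).gr c := by
  refine LSumGr_induction N.obj (P := fun F => transposeLin ρ i p F ∈ (M.X p).gr c) hF ?_ ?_ ?_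
  · rw [map_zero]; exact zero_mem _
  · intro F G hF hG; rw [map_add]; exact add_mem hF hG
  · intro j a hp s hs y
    rw [transposeLin_lof ρ i p j _ a hp s y rfl]
    refine zsmul_mem' _ _ ?_
    have := (M.X p).smul_mem hs (REval_mem M _ p a _ (hρ j (j + n - 1) a y y.2))
    rwa [show c - one - a + (a + one) = c by abel] at this

theorem transposeLin_homotopy (φ : LObj N ⟶ M)
    (hρ : ∀ (q q' i i'' : ℤ) (hq : q + n = i) (_ : q + 1 = q') (hi : i'' + 1 = i) (z),
      RMapLin φ i (unitLin N q i hq z) =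
        RdLin M i'' i hi (ρ q i'' z) + ((n : ℤ).negOnePow : ℤ) • ρ q' i ((N.obj.d q q').lin z))
    (p i i' : ℤ) (hp : p + 1 = i) (hi : i + 1 = i') (F : LSum N.obj i) :
    (φ.f i).lin F = (M.d p i).lin (transposeLin ρ i p F) +
      transposeLin ρ i' i (LdLin N.obj i i' hi F) := by
  induction F using LSum_induction with
  | zero =>
    rw [map_zero, map_zero, map_zero, map_zero, add_zero]
    exact map_zero (φ.f i).lin
  | add F G hF hG =>
    rw [map_add, map_add, map_add, map_add, add_add_add_comm, ← hF, ← hG]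
    exact map_add (φ.f i).lin _ _
  | lof j a hj s y =>
    obtain ⟨r, hr⟩ : ∃ r : ℤ, r = j + n - 1 := ⟨_, rfl⟩
    have h1 : (φ.f i).lin (show (LObj N).X i from Llof N.obj j a hj (SymTensor.tmul s y)) =
        s • (φ.f i).lin (show (LObj N).X i from Llof N.obj j a hj (SymTensor.tmul 1 y)) := by
      refine Eq.trans (congrArg (φ.f i).lin ?_) ((φ.f i).lin.map_smul s _)
      refine Eq.trans ?_ (smul_Llof N.obj s j a hj 1 y).symm
      rw [mul_one]
    have h2 : (φ.f i).lin (show (LObj N).X i from Llof N.obj j a hj (SymTensor.tmul 1 y)) =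
        (((j + n + 1) * deg a).negOnePow : ℤ) •
          REval M (j + n) i (RMapLin φ (j + n) (unitLin N j (j + n) rfl y)) := by
      rw [REval_RMapLin, REval_unitLin j (j + n) i a rfl hj y, map_zsmul, smul_smul,
        negOnePow_mul_self, one_smul]
    refine h1.trans ?_
    rw [h2, hρ j (j + 1) (j + n) r rfl rfl (by lia) y, map_add, map_zsmul,
      REval_RdLin M r (j + n) p i (by lia) hp, transposeLin_lof ρ i p j r a hj s y hr.symm,
      LdLin_lof, map_add, map_sum, map_zsmul, map_zsmul,
      transposeLin_lof ρ i' i (j + 1) (j + n) a (LIdx.right hj hi) s _ (by ring)]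
    simp only [smul_add, Finset.smul_sum]
    rw [add_comm (∑ l, _), add_assoc]
    refine congrArg₂ (· + ·) ?_ (congrArg₂ (· + ·) (Finset.sum_congr rfl fun l _ => ?_) ?_)
    · rw [map_smul, smul_comm s, smul_comm s, smul_smul, ← negOnePow_add_mul]
      refine congrArg (· • _) (negOnePow_congr ⟨-1, ?_⟩)
      rw [hr]; ring
    · rw [transposeLin_lof ρ i' i j r (a - ε l) (LIdx.down hj hi l) (x k l * s) _ hr.symm, deg_sub_ε,
        smul_comm s, sub_add_cancel, mul_comm (x k l) s, mul_smul]
      refine congrArg _ (congrArg _ (congrArg _ (congrArg _ ?_)))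
      exact ((ρ j r).map_smul (e k l) (y : N.obj.X j)).symm
    · rw [smul_comm s, smul_comm s, smul_smul, smul_smul, ← negOnePow_add_mul, ← negOnePow_add_mul]
      refine congrArg₂ (· • ·) (negOnePow_congr ⟨-j - 1, ?_⟩) rfl
      rw [← hj]; ring

end

/-- If the transpose `N[-n] ⟶ R(M)` of `φ : L(N) ⟶ M` is null-homotopic, then so is `φ`. -/
theorem nonempty_homotopy_of_unitHom {M : ComB (GrS k n)} (φ : (functorL k n).obj N ⟶ M)
    (h : Homotopy (unitHom N ≫ RMap φ) 0) : Nonempty (Homotopy φ.hom 0) := by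
  let ρ (q i'' : ℤ) : N.obj.X q →ₗ[Ext k n] RSum M.obj i'' :=
    (h.hom (q + n) i'').lin ∘ₗ
      (HomologicalComplex.XIsoOfEq N.obj (show q = q + n + -(n : ℤ) by ring)).hom.lin
  have hρ : ∀ (q i i'' : ℤ) (hq : q + n = i) (hq' : q = i + -(n : ℤ)) (z : N.obj.X q), ρ q i'' z =
      (h.hom i i'').lin ((HomologicalComplex.XIsoOfEq N.obj hq').hom.lin z) := by
    rintro q _ i'' rfl hq' z
    rfl
  have hρ' : ∀ (i i'' : ℤ) (z : N.obj.X (i + -(n : ℤ))), ρ (i + -(n : ℤ)) i'' z =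
      (h.hom i i'').lin z := fun i i'' z => hρ (i + -(n : ℤ)) i i'' (by ring) rfl z
  have hom : ∀ (i i' i'' : ℤ) (hi : i + 1 = i') (hi' : i'' + 1 = i) (z : N.obj.X (i + -(n : ℤ))),
      RMapLin φ.hom i (unitLin N (i + -(n : ℤ)) i (by ring) z) =
      RdLin M.obj i'' i hi' (ρ (i + -(n : ℤ)) i'' z) + ((n : ℤ).negOnePow : ℤ) •
        ρ (i' + -(n : ℤ)) i ((N.obj.d (i + -(n : ℤ)) (i' + -(n : ℤ))).lin z) := by
    intro i i' i'' hi hi' z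
    have h1 := h.comm i
    rw [dNext_eq h.hom (show (ComplexShape.up ℤ).Rel i i' from hi),
      prevD_eq h.hom (show (ComplexShape.up ℤ).Rel i'' i from hi'), HomologicalComplex.zero_f,
      add_zero, add_comm] at h1
    have h2 := congrArg (fun f : N.obj.X (i + -(n : ℤ)) ⟶ RX M i => f.lin z) h1
    have h3 : (h.hom i' i).lin (((N.obj⟦-(n : ℤ)⟧).d i i').lin z) = ((n : ℤ).negOnePow : ℤ) •
        ρ (i' + -(n : ℤ)) i ((N.obj.d (i + -(n : ℤ)) (i' + -(n : ℤ))).lin z) := by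
      rw [hρ']
      refine Eq.trans ?_ (map_zsmul (h.hom i' i).lin ((n : ℤ).negOnePow : ℤ) _)
      refine congrArg (h.hom i' i).lin ?_
      refine (congrArg (fun f : N.obj.X (i + -(n : ℤ)) ⟶ N.obj.X (i' + -(n : ℤ)) => f.lin z)
        (CochainComplex.shiftFunctor_obj_d' N.obj (-(n : ℤ)) i i')).trans ?_
      have key : ∀ z : N.obj.X (i + -(n : ℤ)),
          (((-(n : ℤ)).negOnePow • N.obj.d (i + -(n : ℤ)) (i' + -(n : ℤ))).lin z) =
          ((n : ℤ).negOnePow : ℤ) • ((N.obj.d (i + -(n : ℤ)) (i' + -(n : ℤ))).lin z) := fun z => by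
        rw [GrMod.units_smul_lin, LinearMap.smul_apply, Int.negOnePow_neg]
      exact key z
    refine h2.trans ((LinearMap.congr_fun (GrMod.add_lin _ _) z).trans ?_)
    refine congrArg₂ (fun a b : RSum M.obj i => a + b) ?_ h3
    rw [hρ']
    exact RObj_d_lin M i'' i hi' _
  have hhom : ∀ (q q' i i'' : ℤ) (hq : q + n = i) (_ : q + 1 = q') (hi : i'' + 1 = i) (z),
      RMapLin φ.hom i (unitLin N q i hq z) =
        RdLin M.obj i'' i hi (ρ q i'' z) +
          ((n : ℤ).negOnePow : ℤ) • ρ q' i ((N.obj.d q q').lin z) := by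
    intro q q' i i'' hq hq' hi z
    obtain rfl : q = i + -(n : ℤ) := by lia
    obtain rfl : q' = i + 1 + -(n : ℤ) := by lia
    exact hom i (i + 1) i'' rfl hi z
  have hmem : ∀ q r b, ∀ y ∈ (N.obj.X q).gr b, ρ q r y ∈ RSumGr M.obj r b := fun q r b y hy =>
    (h.hom (q + n) r).map_mem _ _ ((HomologicalComplex.XIsoOfEq N.obj
      (show q = q + n + -(n : ℤ) by ring)).hom.map_mem _ _ hy)
  refine ⟨{
    hom := fun i p => if p + 1 = i then
      ⟨transposeLin ρ i p, transposeLin_mem ρ hmem i p⟩ else 0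
    zero := fun i p hp => if_neg hp
    comm := fun i => ?_ }⟩
  rw [dNext_eq _ (show (ComplexShape.up ℤ).Rel i (i + 1) from rfl),
    prevD_eq _ (show (ComplexShape.up ℤ).Rel (i - 1) i from sub_add_cancel i 1),
    if_pos rfl, if_pos (sub_add_cancel i 1)]
  refine GrMod.hom_ext fun F => ?_
  refine (transposeLin_homotopy ρ φ.hom hhom (i - 1) i (i + 1) (sub_add_cancel i 1) rfl F).trans ?_
  rw [HomologicalComplex.zero_f, add_zero, add_comm]
  refine congrArg₂ (· + ·) (congrArg (transposeLin ρ (i + 1) i) ?_) rfl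
  exact (LObj_d_lin N i (i + 1) rfl F).symm

end Transport

section InducedFunctor

variable {C : Type*} [Category* C] [Abelian C] {D : Type*} [Category* D] [Abelian D]
  [HasDerivedCategory.{v} C] [HasDerivedCategory.{w} D]
  {F : ComB C ⥤ CochainComplex D ℤ} (Φ : DGFunctor F)
  (hF : ∀ K, K.obj.Acyclic → (F.obj K).Acyclic)

omit [HasDerivedCategory.{v} C] in
include Φ hF in
theorem DGFunctor.isInvertedBy :
    (qisB C).IsInvertedBy (F ⋙ DerivedCategory.Q) := fun _ _ f hf =>
  (DerivedCategory.isIso_Q_map_iff_quasiIso D _).2 (Φ.quasiIso_map hF f hf)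

/-- The functor induced on the bounded derived category by an exact DG-functor. -/
def DGFunctor.induced : DerivedCategory.Bounded C ⥤ DerivedCategory D :=
  Localization.lift (F ⋙ DerivedCategory.Q) (Φ.isInvertedBy hF) (QB C)

/-- The compatibility of the induced functor with the localization functors. -/
def DGFunctor.inducedIso : QB C ⋙ Φ.induced hF ≅ F ⋙ DerivedCategory.Q :=
  Localization.fac _ _ _

instance : (Φ.induced hF).CommShift ℤ :=
  (isTriangulated_of_DGFunctor Φ (Φ.induced hF) (Φ.inducedIso hF)).choose

instance : (Φ.induced hF).IsTriangulated :=
  (isTriangulated_of_DGFunctor Φ (Φ.induced hF) (Φ.inducedIso hF)).choose_spec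

theorem exists_homotopy_of_isKInjective {K L : CochainComplex D ℤ} [L.IsKInjective] (f : K ⟶ L)
    (hf : DerivedCategory.Q.map f = 0) : Nonempty (Homotopy f 0) := by
  refine ⟨HomotopyCategory.homotopyOfEq _ _ ((IsKInjective.Qh_map_bijective _ L).1 ?_)⟩
  rw [← cancel_mono ((DerivedCategory.quotientCompQhIso D).hom.app L),
    DerivedCategory.quotientCompQhIso_hom_naturality,
    DerivedCategory.quotientCompQhIso_hom_naturality, hf, Functor.map_zero]

theorem Q_map_surjective_of_isKProjective {K L : CochainComplex D ℤ} [K.IsKProjective] :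
    Function.Surjective (DerivedCategory.Q.map : (K ⟶ L) → _) := by
  intro f
  obtain ⟨g, hg⟩ := (IsKProjective.Qh_map_bijective K ((HomotopyCategory.quotient _ _).obj L)).2
    ((DerivedCategory.quotientCompQhIso D).hom.app K ≫ f ≫
      (DerivedCategory.quotientCompQhIso D).inv.app L)
  obtain ⟨φ, rfl⟩ := (HomotopyCategory.quotient _ _).map_surjective g
  refine ⟨φ, ?_⟩
  rw [← cancel_epi ((DerivedCategory.quotientCompQhIso D).hom.app K),
    ← DerivedCategory.quotientCompQhIso_hom_naturality, hg]
  simp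

theorem Q_map_eq_zero_of_homotopy {K L : CochainComplex D ℤ} {f : K ⟶ L} (h : Homotopy f 0) :
    DerivedCategory.Q.map f = 0 := by
  rw [← cancel_epi ((DerivedCategory.quotientCompQhIso D).hom.app K),
    ← DerivedCategory.quotientCompQhIso_hom_naturality, HomotopyCategory.eq_of_homotopy _ _ h,
    Functor.map_zero, Functor.map_zero, zero_comp, comp_zero]

end InducedFunctor

section FullyFaithful

open DerivedCategory

variable (k : Type u) [Field k] (n : ℕ) [HasDerivedCategory.{v} (GrS k n)]
  [HasDerivedCategory.{w} (GrE k n)]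

/-- The functor induced by `functorL`, with values in the unbounded derived category. -/
def derivedL : Bounded (GrE k n) ⥤ DerivedCategory (GrS k n) :=
  (dgL k n).induced acyclic_functorL

/-- The functor induced by `functorR`, with values in the unbounded derived category. -/
def derivedR : Bounded (GrS k n) ⥤ DerivedCategory (GrE k n) :=
  (dgR k n).induced acyclic_functorR

instance : (derivedL k n).CommShift ℤ :=
  inferInstanceAs (((dgL k n).induced acyclic_functorL).CommShift ℤ)

instance : (derivedL k n).IsTriangulated :=
  inferInstanceAs (((dgL k n).induced acyclic_functorL).IsTriangulated)

instance : (derivedR k n).CommShift ℤ :=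
  inferInstanceAs (((dgR k n).induced acyclic_functorR).CommShift ℤ)

instance : (derivedR k n).IsTriangulated :=
  inferInstanceAs (((dgR k n).induced acyclic_functorR).IsTriangulated)

/-- The compatibility of `derivedL` with `functorL`. -/
def derivedLIso : QB (GrE k n) ⋙ derivedL k n ≅ functorL k n ⋙ (isBounded _).ι ⋙ Q :=
  (dgL k n).inducedIso acyclic_functorL

/-- The compatibility of `derivedR` with `functorR`. -/
def derivedRIso : QB (GrS k n) ⋙ derivedR k n ≅ functorR k n ⋙ Q :=
  (dgR k n).inducedIso acyclic_functorR

theorem bounded_derivedL (X : Bounded (GrE k n)) :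
    (TStructure.t : Triangulated.TStructure (DerivedCategory (GrS k n))).bounded
      ((derivedL k n).obj X) := by
  refine ObjectProperty.prop_of_iso _ ((derivedLIso k n).symm.app _ ≪≫
    (derivedL k n).mapIso ((QB (GrE k n)).objObjPreimageIso X)) ?_
  exact bounded_Q ((functorL k n).obj _)

/-- The functor induced by `functorL` on the bounded derived categories. -/
def boundedL : Bounded (GrE k n) ⥤ Bounded (GrS k n) :=
  ObjectProperty.lift _ (derivedL k n) (bounded_derivedL k n)

instance : (boundedL k n).CommShift ℤ :=
  inferInstanceAs ((ObjectProperty.lift _ (derivedL k n) (bounded_derivedL k n)).CommShift ℤ)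

instance : (boundedL k n).IsTriangulated :=
  inferInstanceAs ((ObjectProperty.lift _ (derivedL k n) (bounded_derivedL k n)).IsTriangulated)

/-- The compatibility of `boundedL` with `functorL`. -/
def boundedLIso : QB (GrE k n) ⋙ boundedL k n ≅ functorL k n ⋙ QB (GrS k n) :=
  Functor.fullyFaithfulCancelRight Bounded.ι
    (Functor.isoWhiskerLeft (QB (GrE k n))
      (ObjectProperty.liftCompιIso _ (derivedL k n) (bounded_derivedL k n)) ≪≫
      derivedLIso k n ≪≫ Functor.isoWhiskerLeft (functorL k n) (QBιIso (GrS k n)).symm)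

instance : IsIso (Functor.whiskerRight (unitNatTrans k n) Q) := by
  rw [NatTrans.isIso_iff_isIso_app]
  intro N
  exact (isIso_Q_map_iff_quasiIso _ _).2 (quasiIso_unitHom N)

/-- The unit isomorphism `[-n] ≅ R ∘ L`, before localization. -/
def unitIso : (QB (GrE k n) ⋙ Bounded.ι) ⋙ CategoryTheory.shiftFunctor _ (-(n : ℤ)) ≅
    functorL k n ⋙ functorR k n ⋙ Q :=
  Functor.isoWhiskerRight (QBιIso (GrE k n)) _ ≪≫
    Functor.isoWhiskerLeft (isBounded (GrE k n)).ι (Q.commShiftIso (-(n : ℤ))).symm ≪≫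
    asIso (Functor.whiskerRight (unitNatTrans k n) Q)

/-- The isomorphism `R ∘ L ≅ [-n]`. -/
def boundedLderivedRIso : boundedL k n ⋙ derivedR k n ≅
    Bounded.ι ⋙ CategoryTheory.shiftFunctor _ (-(n : ℤ)) :=
  let : Localization.Lifting (QB (GrE k n)) (qisB (GrE k n))
    (QB (GrE k n) ⋙ boundedL k n ⋙ derivedR k n) (boundedL k n ⋙ derivedR k n) := ⟨Iso.refl _⟩
  let : Localization.Lifting (QB (GrE k n)) (qisB (GrE k n))
    (QB (GrE k n) ⋙ Bounded.ι ⋙ CategoryTheory.shiftFunctor _ (-(n : ℤ)))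
    (Bounded.ι ⋙ CategoryTheory.shiftFunctor _ (-(n : ℤ))) := ⟨Iso.refl _⟩
  Localization.liftNatIso (QB (GrE k n)) (qisB (GrE k n))
    (QB (GrE k n) ⋙ boundedL k n ⋙ derivedR k n)
    (QB (GrE k n) ⋙ Bounded.ι ⋙ CategoryTheory.shiftFunctor _ (-(n : ℤ))) _ _
    (Functor.isoWhiskerRight (boundedLIso k n) (derivedR k n) ≪≫
      Functor.isoWhiskerLeft (functorL k n) (derivedRIso k n) ≪≫ (unitIso k n).symm)

instance : (boundedL k n).Faithful :=
  Functor.Faithful.of_comp_iso (boundedLderivedRIso k n)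

variable {k n}

theorem eq_zero_of_derivedR_map_eq_zero (N : ComB (GrE k n)) (M : ComB (GrS k n))
    (f : (QB (GrS k n)).obj ((functorL k n).obj N) ⟶ (QB (GrS k n)).obj M)
    (hf : (derivedR k n).map f = 0) : f = 0 := by
  have : ((functorL k n).obj N).obj.IsKProjective := inferInstanceAs (LObj N).IsKProjective
  obtain ⟨φ, hφ⟩ := Q_map_surjective_of_isKProjective (K := ((functorL k n).obj N).obj) f.hom
  let φ' : (functorL k n).obj N ⟶ M := ObjectProperty.homMk φ
  have hφ' : (QB (GrS k n)).map φ' = f := ObjectProperty.hom_ext _ hφ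
  have h1 : Q.map ((functorR k n).map φ') = 0 := by
    rw [← hφ'] at hf
    have := (derivedRIso k n).hom.naturality φ'
    rw [Functor.comp_map, hf, zero_comp] at this
    exact (cancel_epi ((derivedRIso k n).hom.app _)).1 (this.symm.trans comp_zero.symm)
  have : (((functorR k n).obj M)).IsKInjective := inferInstanceAs (RObj M).IsKInjective
  obtain ⟨h⟩ := exists_homotopy_of_isKInjective 
    ((unitNatTrans k n).app N ≫ (functorR k n).map φ') (by
    refine (Functor.map_comp Q _ ((functorR k n).map φ')).trans ?_
    rw [h1, comp_zero])
  obtain ⟨h'⟩ := nonempty_homotopy_of_unitHom φ' h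
  exact ObjectProperty.hom_ext _ (hφ.symm.trans (Q_map_eq_zero_of_homotopy h'))

theorem derivedR_map_injective (X : Bounded (GrE k n)) (Y : Bounded (GrS k n)) :
    Function.Injective ((derivedR k n).map : ((boundedL k n).obj X ⟶ Y) → _) := by
  suffices ∀ f : (boundedL k n).obj X ⟶ Y, (derivedR k n).map f = 0 → f = 0 from
    fun f g h => sub_eq_zero.1 (this _ (by rw [Functor.map_sub, sub_eq_zero.2 h]))
  intro f hf
  let e := (boundedLIso k n).symm.app _ ≪≫
    (boundedL k n).mapIso ((QB (GrE k n)).objObjPreimageIso X)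
  have := eq_zero_of_derivedR_map_eq_zero _ _
    (e.hom ≫ f ≫ ((QB (GrS k n)).objObjPreimageIso Y).inv) (by
    rw [Functor.map_comp, Functor.map_comp, hf, zero_comp, comp_zero])
  rwa [Preadditive.IsIso.comp_left_eq_zero, Preadditive.IsIso.comp_right_eq_zero] at this

instance : (boundedL k n).Full where
  map_surjective {X Y} f := by
    let e := boundedLderivedRIso k n
    obtain ⟨g, hg⟩ := (Bounded.ι ⋙ CategoryTheory.shiftFunctor _ (-(n : ℤ))).map_surjective
      (e.inv.app X ≫ (derivedR k n).map f ≫ e.hom.app Y)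
    refine ⟨g, derivedR_map_injective _ _ ?_⟩
    rw [← cancel_mono (e.hom.app Y)]
    refine (e.hom.naturality g).trans ?_
    rw [hg, Iso.hom_inv_id_app_assoc]

end FullyFaithful

section Generation

open DerivedCategory Pretriangulated

variable {C : Type*} [Category* C] [Abelian C] [HasDerivedCategory.{w} C]
  (P : ObjectProperty (DerivedCategory C)) [P.IsTriangulated] [P.IsClosedUnderIsomorphisms]

/-- A triangulated subcategory of the derived category which contains the objects of the abelian
category contains all the bounded objects. -/
theorem prop_of_bounded (h : ∀ Y : C, P ((DerivedCategory.singleFunctor C 0).obj Y)) (X : DerivedCategory C)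
    (hX : (TStructure.t : Triangulated.TStructure (DerivedCategory C)).bounded X) : P X := by
  have h' : ∀ (a : ℤ) (Y : C), P ((DerivedCategory.singleFunctor C a).obj Y) := fun a Y =>
    P.prop_of_iso (((DerivedCategory.singleFunctors C).shiftIso (-a) a 0 (neg_add_cancel a)).app Y)
      (P.le_shift (-a) _ (h Y))
  suffices ∀ (m : ℕ) (X : DerivedCategory C) (a : ℤ), X.IsGE a → X.IsLE (a + m) → P X by
    obtain ⟨⟨a, _⟩, ⟨b, _⟩⟩ := hX
    exact this (b - a).toNat X a inferInstance
      (TStructure.t.isLE_of_le X b _ (by lia))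
  intro m
  induction m with
  | zero =>
    intro X a _ h2
    have : X.IsLE a := by simpa using h2
    obtain ⟨Y, ⟨e⟩⟩ := X.exists_iso_singleFunctor_obj_of_isGE_of_isLE a
    exact P.prop_of_iso e.symm (h' a Y)
  | succ m ih =>
    intro X a h1 h2
    obtain ⟨Z, Y, hZ, hY, f, g, δ, hT⟩ := TStructure.t.exists_triangle X (a + m) (a + m + 1) rfl
    have hZ : Z.IsLE (a + m) := ⟨hZ⟩
    have hY : Y.IsGE (a + m + 1) := ⟨hY⟩
    have hZ' : Z.IsGE a := by
      refine TStructure.t.isGE₂ _ (inv_rot_of_distTriang _ hT) a ?_ h1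
      have := TStructure.t.isGE_shift Y (a + m + 1) (-1) (a + m + 2)
      exact TStructure.t.isGE_of_ge (Y⟦(-1 : ℤ)⟧) a (a + m + 2)
    have hY' : Y.IsLE (a + m + 1) := by
      refine TStructure.t.isLE₂ _ (rot_of_distTriang _ hT) (a + m + 1) ?_ ?_
      · simpa [add_assoc] using h2
      · have := TStructure.t.isLE_shift Z (a + m) 1 (a + m - 1)
        exact TStructure.t.isLE_of_le (Z⟦(1 : ℤ)⟧) (a + m - 1) (a + m + 1)
    obtain ⟨Y', ⟨e⟩⟩ := Y.exists_iso_singleFunctor_obj_of_isGE_of_isLE (a + m + 1)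
    exact P.ext_of_isTriangulatedClosed₂ _ hT (ih Z a hZ' hZ) (P.prop_of_iso e.symm (h' _ Y'))

/-- The objects of the abelian category which belong to a triangulated subcategory. -/
theorem prop_single_of_shortExact {S : ShortComplex C} (hS : S.ShortExact) :
    (P ((DerivedCategory.singleFunctor C 0).obj S.X₁) → P ((DerivedCategory.singleFunctor C 0).obj S.X₃) →
      P ((DerivedCategory.singleFunctor C 0).obj S.X₂)) ∧
    (P ((DerivedCategory.singleFunctor C 0).obj S.X₁) → P ((DerivedCategory.singleFunctor C 0).obj S.X₂) →
      P ((DerivedCategory.singleFunctor C 0).obj S.X₃)) :=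
  ⟨P.ext_of_isTriangulatedClosed₂ _ hS.singleTriangle_distinguished,
    P.ext_of_isTriangulatedClosed₃ _ hS.singleTriangle_distinguished⟩

end Generation

section Induction

variable {k : Type u} [Field k] {A : Type u} [Ring A] [Algebra k A] {ι : Type v} [AddCommGroup ι]
  [DecidableEq ι] {𝒜 : ι → Submodule k A} [IsNoetherianRing A]

theorem GrMod.shortExact_coker {M N : GrMod 𝒜} (f : M ⟶ N) (hf : Function.Injective f.lin) :
    (ShortComplex.mk f (GrMod.cokerπ f) (GrMod.comp_cokerπ f)).ShortExact where
  exact := (GrMod.exact_iff _).2 fun y hy => by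
    obtain ⟨x, hx⟩ := (Submodule.Quotient.mk_eq_zero (LinearMap.range f.lin)).1 hy
    exact ⟨x, hx⟩
  mono_f := GrMod.mono_of_injective f hf
  epi_g := GrMod.epi_of_surjective _ (Submodule.mkQ_surjective _)

/-- Noetherian induction for graded modules. -/
theorem GrMod.induction (P : GrMod 𝒜 → Prop) (zero : ∀ M : GrMod 𝒜, Subsingleton M → P M)
    (ext : ∀ {M N : GrMod 𝒜} (f : M ⟶ N), Function.Injective f.lin → P M → P (GrMod.coker f) → P N)
    (sub : ∀ N : GrMod 𝒜, Nontrivial N →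
      ∃ (M : GrMod 𝒜) (f : M ⟶ N), Function.Injective f.lin ∧ Nontrivial M ∧ P M)
    (M : GrMod 𝒜) : P M := by
  suffices ∀ (K : Submodule A M) (N : GrMod 𝒜) (p : M ⟶ N), Function.Surjective p.lin →
    LinearMap.ker p.lin = K → P N from this _ M (𝟙 M) Function.surjective_id rfl
  intro K
  induction K using WellFoundedGT.induction with
  | ind K ih =>
    intro N p hp hK
    rcases subsingleton_or_nontrivial N with hN | hN
    · exact zero N hN
    · obtain ⟨T, f, hf, hT, hPT⟩ := sub N hN
      refine ext f hf hPT (ih (LinearMap.ker (p ≫ GrMod.cokerπ f).lin) ?_ _ (p ≫ GrMod.cokerπ f)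
        ((Submodule.mkQ_surjective _).comp hp) rfl)
      obtain ⟨t, ht⟩ := exists_ne (0 : T)
      obtain ⟨m, hm⟩ := hp (f.lin t)
      refine lt_of_le_of_ne ?_ fun h => ?_
      · rw [← hK]
        intro y hy
        rw [LinearMap.mem_ker] at hy ⊢
        rw [GrMod.comp_lin, LinearMap.comp_apply, hy, map_zero]
      · have : m ∈ LinearMap.ker (p ≫ GrMod.cokerπ f).lin := by
          rw [LinearMap.mem_ker, GrMod.comp_lin, LinearMap.comp_apply, hm]
          exact GrMod.lin_apply_of_comp_eq_zero (GrMod.comp_cokerπ f) t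
        rw [← h, ← hK, LinearMap.mem_ker, hm] at this
        exact ht (hf (this.trans (map_zero f.lin).symm))

end Induction

section Cyclic

variable {k : Type u} [Field k] {n : ℕ}

/-- The ideal generated by a set of variables. -/
def varIdeal (F : Finset (Fin n)) (s : Sym k n) : Prop :=
  ∀ t, coeffS t s ≠ 0 → ∃ i ∈ F, t i ≠ 0

theorem varIdeal_of_x_mul {F : Finset (Fin n)} {i : Fin n} (hi : i ∉ F) {s : Sym k n}
    (h : varIdeal F (x k i * s)) : varIdeal F s := fun t ht => by
  obtain ⟨j, hj, hj'⟩ := h (t + Finsupp.single i 1) (by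
    rw [coeffS_x_mul, if_neg (by simp), add_tsub_cancel_right]
    exact ht)
  have : i ≠ j := fun h => hi (h ▸ hj)
  refine ⟨j, hj, ?_⟩
  simpa [Finsupp.single_eq_of_ne this.symm] using hj'

theorem varIdeal_insert {F : Finset (Fin n)} {i : Fin n} {s : Sym k n} :
    varIdeal (insert i F) s ↔ ∃ t, varIdeal F (s - x k i * t) := by
  constructor
  · refine fun h => ⟨divX i s, fun t ht => ?_⟩
    have h1 : coeffS t (remX [i] s) ≠ 0 := ht
    rw [coeffS_remX] at h1
    have h2 : t i = 0 := by by_contra h; simp [h] at h1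
    rw [if_pos (by simpa using h2)] at h1
    obtain ⟨j, hj, hj'⟩ := h t h1
    rcases Finset.mem_insert.1 hj with rfl | hj
    · exact (hj' h2).elim
    · exact ⟨j, hj, hj'⟩
  · rintro ⟨s', hs'⟩ t ht
    by_cases hti : t i = 0
    · obtain ⟨j, hj, hj'⟩ := hs' t (by
        rw [map_sub, coeffS_x_mul, if_pos hti, sub_zero]; exact ht)
      exact ⟨j, Finset.mem_insert_of_mem hj, hj'⟩
    · exact ⟨i, Finset.mem_insert_self i F, hti⟩

/-- The degree of a monomial. -/
def degM (t : Fin n →₀ ℕ) : Fin n → ℤ := fun i => t i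

theorem mono_mem (t : Fin n →₀ ℕ) : mono k t ∈ symGr k n (degM t) := by
  rw [mem_symGr_iff]
  intro t' ht'
  have : coeffS t' (mono k t) = if t = t' then 1 else 0 := MvPolynomial.coeff_monomial _ _ _
  rw [this] at ht'
  by_cases h : t = t'
  · rw [h]; rfl
  · simp [h] at ht'

theorem mono_add (t t' : Fin n →₀ ℕ) : mono k (t + t') = mono k t * mono k t' := by
  refine ((MvPolynomial.monomial_mul (R := k) (s := t) (s' := t') (a := 1) (b := 1)).trans ?_).symm
  rw [one_mul]; rfl

theorem mono_single (i : Fin n) : mono k (Finsupp.single i 1) = x k i := rfl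

theorem mono_zero : mono k (0 : Fin n →₀ ℕ) = 1 := rfl

theorem sum_coeffS_mono (s : Sym k n) :
    ∃ T : Finset (Fin n →₀ ℕ), (∀ t ∉ T, coeffS t s = 0) ∧
      s = ∑ t ∈ T, coeffS t s • mono k t := by
  refine ⟨MvPolynomial.support (R := k) s, fun t ht => MvPolynomial.notMem_support_iff.1 ht, ?_⟩
  refine (MvPolynomial.support_sum_monomial_coeff (R := k) s).symm.trans ?_
  refine Finset.sum_congr rfl fun t _ => ?_
  refine Eq.trans ?_ (MvPolynomial.smul_monomial (σ := Fin n) (s := t) (a := (1 : k))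
    (coeffS t s)).symm
  rw [smul_eq_mul, mul_one]
  rfl

theorem proj_mono_smul (M : GrS k n) {b : Fin n → ℤ} {m : M} (hm : m ∈ M.gr b) (s : Sym k n)
    (t : Fin n →₀ ℕ) :
    proj M.isInternal (degM t + b) (s • m) = coeffS t s • mono k t • m := by
  obtain ⟨T, hT, hs⟩ := sum_coeffS_mono s
  have h1 : s • m = ∑ t ∈ T, coeffS t s • mono k t • m := by
    conv_lhs => rw [hs]
    rw [Finset.sum_smul]
    exact Finset.sum_congr rfl fun t _ => smul_assoc _ _ _
  rw [h1, map_sum]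
  have h2 : ∀ t', proj M.isInternal (degM t + b) (coeffS t' s • mono k t' • m) =
      if t' = t then coeffS t' s • mono k t' • m else 0 := fun t' => by
    rw [map_smul]
    split_ifs with h
    · subst h; rw [proj_of_mem _ (M.smul_mem (mono_mem t') hm)]
    · rw [proj_of_mem_ne _ (M.smul_mem (mono_mem t') hm), smul_zero]
      refine fun h' => h (Finsupp.ext fun i => ?_)
      exact Nat.cast_injective (R := ℤ) (congrFun (add_right_cancel h') i)
  rw [Finset.sum_congr rfl fun t' _ => h2 t', Finset.sum_ite_eq']
  split_ifs with h
  · rfl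
  · rw [hT t h, zero_smul]

/-- A homogeneous generator of a graded module whose annihilator is the ideal generated by a set
of variables. -/
structure IsCyclic (M : GrS k n) (F : Finset (Fin n)) (b : Fin n → ℤ) (m : M) : Prop where
  mem : m ∈ M.gr b
  surj : ∀ y, ∃ s : Sym k n, s • m = y
  ann : ∀ s : Sym k n, s • m = 0 ↔ varIdeal F s

theorem IsCyclic.exists_of_mem {M : GrS k n} {F : Finset (Fin n)} {b : Fin n → ℤ} {m : M}
    (h : IsCyclic M F b m) {c : Fin n → ℤ} {y : M} (hy : y ∈ M.gr c) :
    ∃ s ∈ symGr k n (c - b), s • m = y := by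
  obtain ⟨s, hs⟩ := h.surj y
  by_cases hc : ∃ t, degM t + b = c
  · obtain ⟨t, rfl⟩ := hc
    refine ⟨coeffS t s • mono k t, Submodule.smul_mem _ _ ?_, ?_⟩
    · rw [add_sub_cancel_right]; exact mono_mem t
    · rw [smul_assoc, ← proj_mono_smul M h.mem, hs, proj_of_mem _ hy]
  · refine ⟨0, zero_mem _, ?_⟩
    obtain ⟨T, hT, hs'⟩ := sum_coeffS_mono s
    rw [zero_smul, ← proj_of_mem M.isInternal hy, ← hs]
    conv_rhs => rw [hs']
    rw [Finset.sum_smul, map_sum]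
    refine (Finset.sum_eq_zero fun t _ => ?_).symm
    rw [smul_assoc, map_smul, proj_of_mem_ne _ (M.smul_mem (mono_mem t) h.mem)
      fun h' => hc ⟨t, h'⟩, smul_zero]

/-- The morphism out of a cyclic module. -/
theorem IsCyclic.exists_hom {M : GrS k n} {F : Finset (Fin n)} {b : Fin n → ℤ} {m : M}
    (h : IsCyclic M F b m) (N : GrS k n) {y : N} (hy : y ∈ N.gr b)
    (hann : ∀ s : Sym k n, varIdeal F s → s • y = 0) :
    ∃ f : M ⟶ N, ∀ s : Sym k n, f.lin (s • m) = s • y := by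
  let φ := LinearMap.toSpanSingleton (Sym k n) M m
  have hφ : Function.Surjective φ := h.surj
  have hle : LinearMap.ker φ ≤ LinearMap.ker (LinearMap.toSpanSingleton (Sym k n) N y) :=
    fun s hs => hann s ((h.ann s).1 hs)
  let f : M →ₗ[Sym k n] N := (LinearMap.ker φ).liftQ _ hle ∘ₗ (φ.quotKerEquivOfSurjective hφ).symm.toLinearMap
  have hf : ∀ s : Sym k n, f (s • m) = s • y := fun s => by
    have : (φ.quotKerEquivOfSurjective hφ).symm (s • m) = (LinearMap.ker φ).mkQ s := by
      rw [LinearEquiv.symm_apply_eq]; rfl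
    change (LinearMap.ker φ).liftQ _ hle ((φ.quotKerEquivOfSurjective hφ).symm (s • m)) = _
    rw [this]; rfl
  refine ⟨⟨f, fun c z hz => ?_⟩, hf⟩
  obtain ⟨s, hs, rfl⟩ := h.exists_of_mem hz
  rw [hf]
  have := N.smul_mem hs hy
  rwa [sub_add_cancel] at this

theorem exists_isCyclic (P : GrS k n → Prop)
    (coker : ∀ {M N : GrS k n} (f : M ⟶ N), Function.Injective f.lin → P M → P N →
      P (GrMod.coker f))
    (free : ∀ b, ∃ (M : GrS k n) (m : M), IsCyclic M ∅ b m ∧ P M) (F : Finset (Fin n)) :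
    ∀ b, ∃ (M : GrS k n) (m : M), IsCyclic M F b m ∧ P M := by
  induction F using Finset.induction_on with
  | empty => exact free
  | insert i F hi ih =>
    intro b
    obtain ⟨M, m, hm, hM⟩ := ih b
    obtain ⟨M', m', hm', hM'⟩ := ih (ε i + b)
    have hxm : ∀ s : Sym k n, s • x k i • m = (x k i * s) • m := fun s => by
      rw [smul_smul, mul_comm]
    obtain ⟨f, hf⟩ := hm'.exists_hom M (M.smul_mem (x_mem k i) hm.mem) fun s hs => by
      rw [hxm, mul_smul, (hm.ann s).2 hs, smul_zero]
    have hinj : Function.Injective f.lin := by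
      rw [injective_iff_map_eq_zero]
      intro y hy
      obtain ⟨s, rfl⟩ := hm'.surj y
      rw [hf, hxm, hm.ann] at hy
      exact (hm'.ann s).2 (varIdeal_of_x_mul hi hy)
    refine ⟨GrMod.coker f, (GrMod.cokerπ f).lin m, ⟨(GrMod.cokerπ f).map_mem _ _ hm.mem,
      fun y => ?_, fun s => ?_⟩, coker f hinj hM' hM⟩
    · obtain ⟨z, rfl⟩ : ∃ z, (GrMod.cokerπ f).lin z = y := Submodule.mkQ_surjective _ y
      obtain ⟨s, rfl⟩ := hm.surj z
      exact ⟨s, (map_smul _ _ _).symm⟩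
    · rw [varIdeal_insert, ← map_smul]
      refine (Submodule.Quotient.mk_eq_zero (LinearMap.range f.lin)).trans ⟨?_, ?_⟩
      · rintro ⟨y, hy⟩
        obtain ⟨t, rfl⟩ := hm'.surj y
        rw [hf, hxm] at hy
        exact ⟨t, (hm.ann _).1 (by rw [sub_smul, hy, sub_self])⟩
      · rintro ⟨t, ht⟩
        refine ⟨t • m', ?_⟩
        rw [hf, hxm]
        exact (sub_eq_zero.1 (by rw [← sub_smul, (hm.ann _).2 ht])).symm

/-- A nonzero graded module contains a homogeneous element whose annihilator is generated by
variables. -/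
theorem exists_ann_eq_varIdeal (M : GrS k n) [Nontrivial M] :
    ∃ (F : Finset (Fin n)) (b : Fin n → ℤ) (m : M), m ∈ M.gr b ∧ m ≠ 0 ∧
      ∀ s : Sym k n, s • m = 0 ↔ varIdeal F s := by
  classical
  let 𝒮 : Set (Ideal (Sym k n)) := {I | ∃ (b : Fin n → ℤ) (m : M), m ∈ M.gr b ∧ m ≠ 0 ∧
    LinearMap.ker (LinearMap.toSpanSingleton (Sym k n) M m) = I}
  have h𝒮 : 𝒮.Nonempty := by
    by_contra h
    rw [Set.not_nonempty_iff_eq_empty] at h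
    obtain ⟨y, hy⟩ := exists_ne (0 : M)
    refine hy ?_
    have h1 := mem_iSup_of_isInternal M.isInternal y
    have h2 : ⨆ a, M.gr a ≤ ⊥ := iSup_le fun a z hz => by
      by_contra hz'
      have : LinearMap.ker (LinearMap.toSpanSingleton (Sym k n) M z) ∈ 𝒮 := ⟨a, z, hz, hz', rfl⟩
      rw [h] at this
      exact this
    exact h2 h1
  obtain ⟨I, ⟨b, m, hm, hm0, hI⟩, hmax⟩ := set_has_maximal_iff_noetherian.2
    (inferInstance : IsNoetherian (Sym k n) (Sym k n)) 𝒮 h𝒮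
  refine ⟨Finset.univ.filter fun i => x k i • m = 0, b, m, hm, hm0, fun s => ⟨fun hs => ?_, fun hs => ?_⟩⟩
  · intro t ht
    by_contra hF
    push Not at hF
    have h1 : mono k t • m = 0 := by
      have := proj_mono_smul M hm s t
      rw [hs, map_zero] at this
      exact (smul_eq_zero.1 this.symm).resolve_left ht
    have key : ∀ (t : Fin n →₀ ℕ), (∀ i, x k i ∈ I → t i = 0) → ∀ (c : Fin n → ℤ) (y : M),
        y ∈ M.gr c → y ≠ 0 → LinearMap.ker (LinearMap.toSpanSingleton (Sym k n) M y) = I →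
        mono k t • y ≠ 0 ∧
          LinearMap.ker (LinearMap.toSpanSingleton (Sym k n) M (mono k t • y)) = I := by
      intro t
      induction t using Finsupp.induction_linear with
      | zero => intro _ c y _ h0 hy; rw [mono_zero, one_smul]; exact ⟨h0, hy⟩
      | add t t' ih ih' =>
        intro ht c y hc h0 hy
        obtain ⟨h1, h2⟩ := ih' (fun i hi => (Nat.add_eq_zero_iff.1 (ht i hi)).2) c y hc h0 hy
        rw [mono_add, mul_smul]
        exact ih (fun i hi => (Nat.add_eq_zero_iff.1 (ht i hi)).1) _ _
          (M.smul_mem (mono_mem t') hc) h1 h2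
      | single i d =>
        intro ht c y hc h0 hy
        induction d with
        | zero => rw [Finsupp.single_zero, mono_zero, one_smul]; exact ⟨h0, hy⟩
        | succ d ihd =>
          have hi : x k i ∉ I := fun hi => by simpa using ht i hi
          obtain ⟨h1, h2⟩ := ihd fun j hj => by
            rw [Finsupp.single_eq_of_ne]
            rintro rfl
            exact hi hj
          rw [Finsupp.single_add, add_comm, mono_add, mul_smul, mono_single]
          have h3 : x k i • mono k (Finsupp.single i d) • y ≠ 0 := fun h => hi (h2 ▸ h)
          refine ⟨h3, ?_⟩
          refine ((lt_or_eq_of_le ?_).resolve_left (hmax _ ⟨_, _,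
            M.smul_mem (x_mem k i) (M.smul_mem (mono_mem _) hc), h3, rfl⟩)).symm
          rw [← h2]
          intro s hs
          rw [LinearMap.mem_ker, LinearMap.toSpanSingleton_apply] at hs ⊢
          rw [smul_comm, hs, smul_zero]
    exact (key t (fun i hi => hF i (by rw [← hI] at hi; simpa using hi)) b m hm hm0 hI).1 h1
  · obtain ⟨T, hT, hs'⟩ := sum_coeffS_mono s
    rw [hs', Finset.sum_smul]
    refine Finset.sum_eq_zero fun t _ => ?_
    rw [smul_assoc]
    by_cases ht : coeffS t s = 0
    · rw [ht, zero_smul]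
    · obtain ⟨i, hi, hi'⟩ := hs t ht
      have h3 : t = (t - Finsupp.single i 1) + Finsupp.single i 1 :=
        (tsub_add_cancel_of_le (Finsupp.single_le_iff.2 (Nat.one_le_iff_ne_zero.2 hi'))).symm
      rw [h3, mono_add, mono_single, mul_smul, (Finset.mem_filter.1 hi).2, smul_zero, smul_zero]

end Cyclic

section Residue

variable {k : Type u} [Field k] {n : ℕ}

variable (k n) in
/-- The augmentation of the exterior algebra. -/
def augE : Ext k n →ₐ[k] k := (ExteriorAlgebra.algebraMapInv : ExteriorAlgebra k (Fin n → k) →ₐ[k] k)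

theorem augE_e (i : Fin n) : augE k n (e k i) = 0 :=
  (ExteriorAlgebra.lift_ι_apply k (0 : (Fin n → k) →ₗ[k] k) _ _).trans rfl

theorem augE_of_mem {a : Fin n → ℤ} (ha : a ≠ 0) {r : Ext k n} (hr : r ∈ extGr k n a) :
    augE k n r = 0 := by
  have : extGr k n a ≤ LinearMap.ker (augE k n).toLinearMap := by
    refine Submodule.span_le.2 ?_
    rintro _ ⟨l, hl, rfl⟩
    cases l with
    | nil => exact (ha hl.symm).elim
    | cons i l =>
      change augE k n _ = 0
      rw [List.map_cons, List.prod_cons, map_mul, augE_e, zero_mul]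
  exact this hr

/-- The residue field of the exterior algebra. -/
def Residue (k : Type u) (_n : ℕ) : Type u := k

instance : AddCommGroup (Residue k n) := inferInstanceAs (AddCommGroup k)
instance : Module k (Residue k n) := inferInstanceAs (Module k k)
instance : Module.Finite k (Residue k n) := inferInstanceAs (Module.Finite k k)
instance : Module (Ext k n) (Residue k n) := Module.compHom k (augE k n).toRingHom

theorem smul_residue (r : Ext k n) (m : Residue k n) : r • m = augE k n r • m := rfl

instance : IsScalarTower k (Ext k n) (Residue k n) :=
  ⟨fun c r m => by rw [smul_residue, smul_residue, map_smul, smul_assoc]⟩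

variable (k) in
/-- The residue field of the exterior algebra, placed in degree `a`. -/
def residue (a : Fin n → ℤ) : GrE k n where
  carrier := Residue k n
  gr c := if c = a then ⊤ else ⊥
  isInternal := by
    refine isInternal_of_proj (fun c => if c = a then LinearMap.id else 0) (fun c m hm => ?_)
      (fun b c m hm hcb => ?_) fun m => ?_
    · split_ifs with h
      · rfl
      · rw [if_neg h] at hm; exact hm.symm
    · split_ifs with h
      · rw [if_neg fun h' => hcb (h'.trans h.symm)] at hm; exact hm
      · rfl
    · exact Submodule.mem_iSup_of_mem a (by rw [if_pos rfl]; trivial)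
  smul_mem {c b r m} hr hm := by
    by_cases hc : c = 0
    · subst hc
      rw [zero_add, smul_residue]
      exact Submodule.smul_mem _ _ hm
    · rw [smul_residue, augE_of_mem hc hr, zero_smul]
      exact zero_mem _
  finite := Module.Finite.of_restrictScalars_finite k (Ext k n) (Residue k n)

theorem residue_gr_subsingleton {a c : Fin n → ℤ} (h : c ≠ a) :
    Subsingleton ((residue k a).gr c) := by
  have : (residue k a).gr c = ⊥ := by change ite _ _ _ = _; exact if_neg h
  rw [this]; infer_instance

end Residue

section Free

variable {k : Type u} [Field k] {n : ℕ}

theorem SymTensor.tmul_eq_zero_iff {V : Type u} [AddCommGroup V] [Module k V] (φ : V →ₗ[k] k)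
    {v : V} (hv : φ v ≠ 0) {s : Sym k n} : SymTensor.tmul s v = 0 ↔ s = 0 := by
  constructor
  · intro h
    have h1 : (TensorProduct.rid k (Sym k n)) (LinearMap.lTensor (Sym k n) φ (s ⊗ₜ[k] v)) = 0 := by
      refine (congrArg (fun z : Sym k n ⊗[k] V => (TensorProduct.rid k (Sym k n))
        (LinearMap.lTensor (Sym k n) φ z)) (show s ⊗ₜ[k] v = 0 from h)).trans ?_
      rw [map_zero, map_zero]
    rw [LinearMap.lTensor_tmul, TensorProduct.rid_tmul] at h1
    exact (smul_eq_zero.1 h1).resolve_left hv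
  · rintro rfl
    exact TensorProduct.zero_tmul _ _

theorem smul_tmul_one {V : Type u} [AddCommGroup V] [Module k V] (s : Sym k n) (v : V) :
    s • SymTensor.tmul 1 v = SymTensor.tmul s v :=
  (SymTensor.smul_tmul s 1 v).trans (by rw [mul_one])

theorem Llof_injective (N : CochainComplex (GrE k n) ℤ) {i : ℤ} (j : ℤ) (a : Fin n → ℤ)
    (h : j - deg a = i) : Function.Injective (Llof N j a h) :=
  DirectSum.of_injective (β := fun p : LIdx n i => LSummand N p) ⟨(j, a), h⟩

/-- If `N` is one-dimensional, then `L(N)` is free of rank one. -/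
theorem isCyclic_LX (N : ComB (GrE k n)) {d : ℤ} {a : Fin n → ℤ}
    (hN : ∀ j c, j = d ∧ c = a ∨ Subsingleton ((N.obj.X j).gr c)) (u : (N.obj.X d).gr a)
    (φ : (N.obj.X d).gr a →ₗ[k] k) (hφ : ∀ y, φ y • u = y) (hu : φ u ≠ 0) {i : ℤ}
    (hi : d - deg a = i) :
    IsCyclic (LX N i) ∅ (a + one) (Llof N.obj d a hi (SymTensor.tmul 1 u) : LSum N.obj i) where
  mem := Llof_tmul_mem N.obj d a hi (by
    have : a + one - one - a = 0 := by rw [add_sub_cancel_right, sub_self]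
    rw [this]
    exact SetLike.GradedOne.one_mem) u
  surj F := by
    refine LSum_induction N.obj (P := fun F => ∃ s : Sym k n,
      s • (Llof N.obj d a hi (SymTensor.tmul 1 u)) = F) F ⟨0, zero_smul _ _⟩ ?_ ?_
    · rintro _ _ ⟨s, rfl⟩ ⟨t, rfl⟩
      exact ⟨s + t, add_smul _ _ _⟩
    · intro j c hp s y
      rcases hN j c with ⟨rfl, rfl⟩ | h
      · refine ⟨φ y • s, ?_⟩
        rw [← map_smul]
        refine congrArg (Llof N.obj j c hi) ?_
        rw [smul_tmul_one]
        conv_rhs => rw [← hφ y]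
        exact TensorProduct.smul_tmul _ _ _
      · refine ⟨0, ?_⟩
        rw [zero_smul, Subsingleton.elim y 0, SymTensor.tmul_zero, map_zero]
  ann s := by
    have h1 : s • (Llof N.obj d a hi (SymTensor.tmul 1 u)) = 0 ↔ s = 0 := by
      rw [← map_smul, smul_tmul_one, map_eq_zero_iff _ (Llof_injective _ _ _ _),
        SymTensor.tmul_eq_zero_iff φ hu]
    refine h1.trans ⟨?_, fun h => sym_ext fun t => ?_⟩
    · rintro rfl t ht
      exact (ht (map_zero _)).elim
    · by_contra ht
      obtain ⟨i, hi, _⟩ := h t (by simpa using ht)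
      simp at hi

/-- The residue field, placed in degree `a` and in cohomological degree `||a||`. -/
def residueComplex (a : Fin n → ℤ) : ComB (GrE k n) :=
  ⟨(HomologicalComplex.single (GrE k n) (ComplexShape.up ℤ) (deg a)).obj (residue k a),
    deg a, deg a, inferInstance, inferInstance⟩

theorem residueComplex_subsingleton (a : Fin n → ℤ) (j : ℤ) (c : Fin n → ℤ) :
    j = deg a ∧ c = a ∨ Subsingleton (((residueComplex (k := k) a).obj.X j).gr c) := by
  by_cases hj : j = deg a
  · subst hj
    by_cases hc : c = a
    · exact Or.inl ⟨rfl, hc⟩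
    · right
      let e := HomologicalComplex.singleObjXSelf (ComplexShape.up ℤ) (deg a) (residue k a)
      have := residue_gr_subsingleton (k := k) hc
      refine ⟨fun y z => ?_⟩
      have h := Subsingleton.elim (grMap e.hom c y) (grMap e.hom c z)
      have h2 := congrArg (grMap e.inv c) h
      have h3 : ∀ y, grMap e.inv c (grMap e.hom c y) = y := fun y => Subtype.ext
        (congrArg (fun f => f.lin (y : _)) e.hom_inv_id)
      exact (h3 y).symm.trans (h2.trans (h3 z))
  · right
    have := GrMod.subsingleton_of_isZero
      (HomologicalComplex.isZero_single_obj_X (ComplexShape.up ℤ) (deg a) (residue k a) j hj)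
    exact ⟨fun y z => Subtype.ext (this.elim _ _)⟩

theorem isCyclic_LX_residueComplex (a : Fin n → ℤ) :
    ∃ m : LX (residueComplex (k := k) a) 0, IsCyclic _ ∅ (a + one) m := by
  let e : (residueComplex (k := k) a).obj.X (deg a) ≅ residue k a :=
    HomologicalComplex.singleObjXSelf (ComplexShape.up ℤ) (deg a) (residue k a)
  have h1 : (1 : k) ∈ (residue k a).gr a := by
    have : (residue k a).gr a = ⊤ := if_pos rfl
    rw [this]; trivial
  have h3 : ∀ y, grMap e.inv a (grMap e.hom a y) = y := fun y => Subtype.ext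
    (congrArg (fun f => f.lin (y : _)) e.hom_inv_id)
  have h4 : ∀ y, grMap e.hom a (grMap e.inv a y) = y := fun y => Subtype.ext
    (congrArg (fun f => f.lin (y : _)) e.inv_hom_id)
  let ψ : (residue k a).gr a →ₗ[k] k := ((residue k a).gr a).subtype
  refine ⟨_, isCyclic_LX (residueComplex (k := k) a) (residueComplex_subsingleton a)
    (grMap e.inv a ⟨(1 : k), h1⟩) (ψ ∘ₗ grMap e.hom a) (fun y => ?_) ?_ (sub_self _)⟩
  · rw [← map_smul]
    refine (congrArg (grMap e.inv a) (Subtype.ext ?_)).trans (h3 y)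
    exact mul_one (ψ (grMap e.hom a y))
  · have h5 : ψ (grMap e.hom a (grMap e.inv a ⟨(1 : k), h1⟩)) = (1 : k) := by rw [h4]; rfl
    exact fun h => one_ne_zero (α := k) (h5.symm.trans h)

theorem isZero_LX_residueComplex (a : Fin n → ℤ) {i : ℤ} (hi : i ≠ 0) :
    IsZero (LX (residueComplex (k := k) a) i) := by
  refine isZero_LX _ _ fun j c hj h => ?_
  obtain ⟨rfl, rfl⟩ := (residueComplex_subsingleton a j c).resolve_right hj
  exact hi (h.symm.trans (sub_self _))

variable (k n) [HasDerivedCategory.{v} (GrS k n)] [HasDerivedCategory.{w} (GrE k n)]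

theorem derivedL_essImage_free (b : Fin n → ℤ) : ∃ (M : GrS k n) (m : M), IsCyclic M ∅ b m ∧
    (derivedL k n).essImage ((DerivedCategory.singleFunctor _ 0).obj M) := by
  obtain ⟨m, hm⟩ := isCyclic_LX_residueComplex (k := k) (b - one)
  rw [sub_add_cancel] at hm
  let N := residueComplex (k := k) (b - one)
  refine ⟨_, m, hm, (QB (GrE k n)).obj N, ⟨(derivedLIso k n).app N ≪≫ ?_⟩⟩
  let K := LObj N
  have h1 : K.IsStrictlyGE 0 := by
    rw [CochainComplex.isStrictlyGE_iff]
    exact fun i hi => isZero_LX_residueComplex _ hi.ne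
  have h2 : K.IsStrictlyLE 0 := by
    rw [CochainComplex.isStrictlyLE_iff]
    exact fun i hi => isZero_LX_residueComplex _ hi.ne'
  let Y := (CochainComplex.exists_iso_single K 0).choose
  let α : K ≅ (HomologicalComplex.single (GrS k n) (ComplexShape.up ℤ) 0).obj Y :=
    (CochainComplex.exists_iso_single K 0).choose_spec.some
  let β : LX N 0 ≅ Y := (HomologicalComplex.eval _ _ 0).mapIso α ≪≫
    HomologicalComplex.singleObjXSelf (ComplexShape.up ℤ) 0 Y
  exact DerivedCategory.Q.mapIso (α ≪≫ (HomologicalComplex.single _ _ 0).mapIso β.symm) ≪≫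
    (DerivedCategory.singleFunctorIsoCompQ (GrS k n) 0).symm.app _

end Free

section Equivalence

open DerivedCategory

variable (k : Type u) [Field k] (n : ℕ) [HasDerivedCategory.{v} (GrS k n)]
  [HasDerivedCategory.{w} (GrE k n)]

/-- The comparison of `boundedL` and `derivedL`. -/
def boundedLCompιIso : boundedL k n ⋙ Bounded.ι ≅ derivedL k n :=
  ObjectProperty.liftCompιIso _ (derivedL k n) (bounded_derivedL k n)

instance : (derivedL k n).Full :=
  Functor.Full.of_iso (boundedLCompιIso k n)

instance : (derivedL k n).essImage.IsTriangulated := inferInstance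

theorem derivedL_essImage_single (M : GrS k n) :
    (derivedL k n).essImage ((DerivedCategory.singleFunctor _ 0).obj M) := by
  have coker : ∀ {M N : GrS k n} (f : M ⟶ N), Function.Injective f.lin →
      (derivedL k n).essImage ((DerivedCategory.singleFunctor _ 0).obj M) →
      (derivedL k n).essImage ((DerivedCategory.singleFunctor _ 0).obj N) →
      (derivedL k n).essImage ((DerivedCategory.singleFunctor _ 0).obj (GrMod.coker f)) :=
    fun f hf => (prop_single_of_shortExact _ (GrMod.shortExact_coker f hf)).2
  refine GrMod.induction (fun M : GrS k n =>
    (derivedL k n).essImage ((DerivedCategory.singleFunctor _ 0).obj M)) (fun M hM => ?_)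
    (fun f hf => (prop_single_of_shortExact _ (GrMod.shortExact_coker f hf)).1) (fun N hN => ?_) M
  · exact ObjectProperty.prop_of_isZero _
      ((DerivedCategory.singleFunctor _ 0).map_isZero (GrMod.isZero_of_subsingleton M))
  · obtain ⟨F, b, y, hy, hy0, hann⟩ := exists_ann_eq_varIdeal N
    obtain ⟨M, m, hm, hM⟩ := exists_isCyclic (fun M : GrS k n =>
      (derivedL k n).essImage ((DerivedCategory.singleFunctor _ 0).obj M)) coker
      (derivedL_essImage_free k n) F b
    obtain ⟨f, hf⟩ := hm.exists_hom N hy fun s hs => (hann s).2 hs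
    refine ⟨M, f, ?_, ⟨m, 0, fun h => hy0 ?_⟩, hM⟩
    · rw [injective_iff_map_eq_zero]
      intro z hz
      obtain ⟨s, rfl⟩ := hm.surj z
      rw [hf, hann] at hz
      exact (hm.ann s).2 hz
    · have := hf 1
      rw [one_smul, one_smul, h, map_zero] at this
      exact this.symm

instance : (boundedL k n).EssSurj where
  mem_essImage Y := by
    obtain ⟨X, ⟨e⟩⟩ := prop_of_bounded _ (derivedL_essImage_single k n) Y.obj Y.property
    exact ⟨X, ⟨Bounded.ι.preimageIso ((boundedLCompιIso k n).app X ≪≫ e)⟩⟩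

instance : (boundedL k n).IsEquivalence where

theorem bounded_derivedR (X : Bounded (GrS k n)) :
    (TStructure.t : Triangulated.TStructure (DerivedCategory (GrE k n))).bounded
      ((derivedR k n).obj X) :=
  ObjectProperty.prop_of_iso _ ((boundedLderivedRIso k n).symm.app _ ≪≫
      (derivedR k n).mapIso ((boundedL k n).objObjPreimageIso X))
    (ObjectProperty.le_shift _ (-(n : ℤ)) _ ((boundedL k n).objPreimage X).property)

/-- The functor induced by `functorR` on the bounded derived categories. -/
def boundedR : Bounded (GrS k n) ⥤ Bounded (GrE k n) :=
  ObjectProperty.lift _ (derivedR k n) (bounded_derivedR k n)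

instance : (boundedR k n).CommShift ℤ :=
  inferInstanceAs ((ObjectProperty.lift _ (derivedR k n) (bounded_derivedR k n)).CommShift ℤ)

instance : (boundedR k n).IsTriangulated :=
  inferInstanceAs ((ObjectProperty.lift _ (derivedR k n) (bounded_derivedR k n)).IsTriangulated)

/-- The compatibility of `boundedR` with `functorR`. -/
def boundedRIso : QB (GrS k n) ⋙ boundedR k n ⋙ Bounded.ι ≅ functorR k n ⋙ Q :=
  Functor.isoWhiskerLeft (QB (GrS k n))
    (ObjectProperty.liftCompιIso _ (derivedR k n) (bounded_derivedR k n)) ≪≫ derivedRIso k n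

/-- The isomorphism `R ∘ L ≅ [-n]`. -/
def boundedLboundedRIso : boundedL k n ⋙ boundedR k n ≅
    CategoryTheory.shiftFunctor (Bounded (GrE k n)) (-(n : ℤ)) :=
  Functor.fullyFaithfulCancelRight Bounded.ι
    (Functor.isoWhiskerLeft (boundedL k n)
      (ObjectProperty.liftCompιIso _ (derivedR k n) (bounded_derivedR k n)) ≪≫
      boundedLderivedRIso k n ≪≫ (Bounded.ι.commShiftIso (-(n : ℤ))).symm)

instance : (boundedR k n).IsEquivalence :=
  have := Functor.isEquivalence_of_iso (boundedLboundedRIso k n).symm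
  Functor.isEquivalence_of_comp_left (boundedL k n) (boundedR k n)

/-- The isomorphism `L ∘ R ≅ [-n]`. -/
def boundedRboundedLIso : boundedR k n ⋙ boundedL k n ≅
    CategoryTheory.shiftFunctor (Bounded (GrS k n)) (-(n : ℤ)) :=
  Functor.fullyFaithfulCancelRight (boundedR k n)
    (NatIso.ofComponents (fun X => Iso.refl _) ≪≫
      Functor.isoWhiskerLeft (boundedR k n) (boundedLboundedRIso k n) ≪≫
      ((boundedR k n).commShiftIso (-(n : ℤ))).symm)

end Equivalence

end ZnBGG

end

theorem theorem4p1 {k : Type u} [Field k] (n : ℕ)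
    [HasDerivedCategory.{v} (ZnBGG.GrS k n)] [HasDerivedCategory.{w} (ZnBGG.GrE k n)] :
    ∃ (R : DerivedCategory.Bounded (ZnBGG.GrS k n) ⥤ DerivedCategory.Bounded (ZnBGG.GrE k n))
      (L : DerivedCategory.Bounded (ZnBGG.GrE k n) ⥤ DerivedCategory.Bounded (ZnBGG.GrS k n))
      (_ : R.CommShift ℤ) (_ : L.CommShift ℤ),
      Nonempty (ZnBGG.QB (ZnBGG.GrS k n) ⋙ R ⋙ DerivedCategory.Bounded.ι ≅
        ZnBGG.functorR k n ⋙ DerivedCategory.Q) ∧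
      Nonempty (ZnBGG.QB (ZnBGG.GrE k n) ⋙ L ≅
        ZnBGG.functorL k n ⋙ ZnBGG.QB (ZnBGG.GrS k n)) ∧
      R.IsTriangulated ∧ L.IsTriangulated ∧ R.IsEquivalence ∧ L.IsEquivalence ∧
      Nonempty (R ⋙ L ≅ shiftFunctor (DerivedCategory.Bounded (ZnBGG.GrS k n)) (-(n : ℤ))) ∧
      Nonempty (L ⋙ R ≅ shiftFunctor (DerivedCategory.Bounded (ZnBGG.GrE k n)) (-(n : ℤ))) := by
  exact ⟨ZnBGG.boundedR k n, ZnBGG.boundedL k n, inferInstance, inferInstance,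
    ⟨ZnBGG.boundedRIso k n⟩, ⟨ZnBGG.boundedLIso k n⟩, inferInstance, inferInstance, inferInstance,
    inferInstance, ⟨ZnBGG.boundedRboundedLIso k n⟩, ⟨ZnBGG.boundedLboundedRIso k n⟩⟩
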